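/- **Theorem (Continuity).** *Setting.* Let $\Omega\subset\mathbb R^n$ be a bounded domain and $w$ a weight on $\Omega$ (locally integrable and positive a.e.); write $d\mu=w\,dx$ and $w(S)=\int_S w\,dx$. Let $A$ be a measurable, bounded, symmetric nonnegative semidefinite $n\times n$ matrix function on $\Omega$ such that, for some constant $\kappa>0$, $|A(x)\xi|\le \kappa\, w(x)|\xi|$ for a.e. $x\in\Omega$ and all $\xi\in\mathbb R^n$. Let $B(x)$ be a Lipschitz continuous $n\times n$ matrix function on $\Omega$ and $c,C>0$ constants with $c\,\xi^{\rm tr}A(x)\xi\le|B(x)\xi|^2\le C\,\xi^{\rm tr}A(x)\xi$ for a.e. $x\in\Omega$ and all $\xi$, and put $\nabla_A v=B\nabla v$. Let $d$ be a metric on $\Omega$, with balls $B(x,r)=\{y\in\Omega: d(x,y)<r\}$; for $B=B(x,r)$ put $\tfrac32B=B(x,\tfrac32r)$ and $d\mu_B=w\,dx/w(B)$. "Lipschitz" refers to the Euclidean distance. *Weak solutions.* $W^{1,2}_A(\Omega)$ is the completion of the locally Lipschitz functions on $\Omega$ with finite norm $\big(\int_\Omega |v|^2+\nabla v^{\rm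 tr}A\nabla v\big)^{1/2}$, and $(W^{1,2}_A)_0(\Omega)$ is the closure in it of the Lipschitz functions with compact support in $\Omega$. A weak solution of $Lu=\nabla^{\rm tr}A\nabla u=0$ in $\Omega$ is a $u\in W^{1,2}_A(\Omega)$ with $-\int_\Omega\nabla g^{\rm tr}A\nabla u=0$ for all nonnegative $g\in (W^{1,2}_A)_0(\Omega)$. *Notation.* $f^{(i)}$ is the $i$-th iterate of $f$. Fix an integer $k\ge1$ and $N>1$, and put $E=\exp^{(k)}(2N)$. For $t\ge0$ let $s=\max(t^2,E)$ and $$\Phi_{k,N}(t)=t^2(\ln s)^2(\ln\ln s)^2\cdots(\ln^{(k-1)}s)^2(\ln^{(k)}s)^{2N}.$$ Let $\|f\|_{L^\Phi_\nu}=\inf\{a>0:\int\Phi(|f|/a)\,d\nu\le1\}$. For integers $j\ge1$ let $\kappa_{k,N}(j)=j^2$ if $j\le E$ and $\kappa_{k,N}(j)=j\,\ln j\cdots\ln^{(k-2)}j\,(\ln^{(k-1)}j)^{(N+1)/2}$ if $j>E$ (so $\kappa_{1,N}(j)=j^{(N+1)/2}$ for $j>E$). *Hypotheses.* Let $\varphi$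 be an increasing function on some interval $[0,R_0]$, $R_0>0$, with $\varphi(0)=0$ and $\varphi(r)\ge r$. Assume that for every $x\in\Omega$ there are $R>0$ and $C>0$ such that for all $0<r<R$ the following hold for $B=B(x,r)$. 1. (Proportional vanishing Poincaré inequality) $$\int_B|v|^2\,d\mu\le Cr^2\int_{\frac32B}|\nabla_Av|^2\,dx$$ for every Lipschitz function $v$ on $\tfrac32B$ that vanishes on some subset $S\subseteq B$ with $w(S)\ge\tfrac12w(B)$. 2. (Orlicz–Sobolev inequality with superradius $\varphi$) $$\|v\|_{L^{\Phi_{k,N}}_{\mu_B}}\le C\,\frac{\varphi(r)}{w(B)^{1/2}}\,\|\nabla_Av\|_{L^2(B)}$$ for every Lipschitz function $v$ with compact support in $B$. 3. (Adapted cutoff functions) Let $r_1=r$ and $r_j-r_{j+1}=c\,r/\kappa_{k,N}(j)$, where $c>0$ is the constant for which $\lim_j r_j=r/2$. There are Lipschitz functions $\psi_j$, $j\ge1$, with $\operatorname{supp}\psi_j\subset B(x,r_j)$, $\psi_j=1$ on $B(x,r_{j+1})$ and $$\big\||\nabla_A\psi_j|\,w^{-1/2}\big\|_{L^\infty}\le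 C\,\kappa_{k,N}(j)/r .$$ Finally assume that there are $r_0>0$, $\alpha\in\big(0,\tfrac{N-1}{2N}\big)$ and $C_0>0$ with $$\varphi(r)\le C_0\,r\,\Big[\ln^{(k+2)}\big(\tfrac1r\big)\Big]^{\alpha N}\qquad\text{for all } r\in(0,r_0).$$ *Conclusion.* Every weak solution $u$ of $Lu=0$ in $\Omega$ is continuous in $\Omega$, that is, $u$ agrees a.e. in $\Omega$ with a continuous function. -/

import Mathlib

open MeasureTheory Filter Topology
open scoped ENNReal NNReal

noncomputable section

namespace DegElliptic

/-- Euclidean space `ℝⁿ`. -/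
abbrev E (n : ℕ) : Type := EuclideanSpace ℝ (Fin n)

/-- The action of a matrix on a vector of `ℝⁿ`. -/
def act {n : ℕ} (M : Matrix (Fin n) (Fin n) ℝ) (ξ : E n) : E n :=
  Matrix.toEuclideanLin M ξ

/-- The quadratic form `ξᵀ M ξ`. -/
def quad {n : ℕ} (M : Matrix (Fin n) (Fin n) ℝ) (ξ : E n) : ℝ :=
  inner ℝ ξ (act M ξ)

/-! ### The operator and its structure -/

/-- `w` is a weight on `Ω`: locally integrable and positive almost everywhere. -/
structure IsWeight {n : ℕ} (Ω : Set (E n)) (w : E n → ℝ) : Prop where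
  locallyIntegrable : LocallyIntegrableOn w Ω volume
  pos : ∀ᵐ x ∂(volume.restrict Ω), 0 < w x

/-- The measure `dμ = w dx`. -/
def wMeasure {n : ℕ} (w : E n → ℝ) : Measure (E n) :=
  volume.withDensity (fun x => ENNReal.ofReal (w x))

/-- `A` is a measurable, bounded, symmetric nonnegative semidefinite matrix function on `Ω` with
`|A(x) ξ| ≤ κ w(x) |ξ|` for some constant `κ > 0`. -/
structure IsCoefficient {n : ℕ} (Ω : Set (E n)) (w : E n → ℝ)
    (A : E n → Matrix (Fin n) (Fin n) ℝ) : Prop where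
  measurable : ∀ i j, AEMeasurable (fun x => A x i j) (volume.restrict Ω)
  bounded : ∃ M : ℝ, ∀ i j, ∀ᵐ x ∂(volume.restrict Ω), |A x i j| ≤ M
  posSemidef : ∀ᵐ x ∂(volume.restrict Ω), (A x).PosSemidef
  upper : ∃ κ : ℝ, 0 < κ ∧ ∀ᵐ x ∂(volume.restrict Ω), ∀ ξ : E n, ‖act (A x) ξ‖ ≤ κ * w x * ‖ξ‖

/-- `B` is a Lipschitz matrix function on `Ω` with `c ξᵀAξ ≤ |Bξ|² ≤ C ξᵀAξ`. -/
structure IsLipschitzRoot {n : ℕ} (Ω : Set (E n)) (A B : E n → Matrix (Fin n) (Fin n) ℝ) :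
    Prop where
  lipschitz : ∃ K : ℝ≥0, ∀ i j, LipschitzOnWith K (fun x => B x i j) Ω
  comparable : ∃ c C : ℝ, 0 < c ∧ 0 < C ∧ ∀ᵐ x ∂(volume.restrict Ω), ∀ ξ : E n,
    c * quad (A x) ξ ≤ ‖act (B x) ξ‖ ^ 2 ∧ ‖act (B x) ξ‖ ^ 2 ≤ C * quad (A x) ξ

/-- The `A`-gradient `∇_A v = B ∇v` of a (Lipschitz) function `v`. -/
def gradA {n : ℕ} (B : E n → Matrix (Fin n) (Fin n) ℝ) (v : E n → ℝ) (x : E n) : E n :=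
  act (B x) (gradient v x)

/-! ### The degenerate Sobolev space and weak solutions -/

/-- The squared norm `∫_Ω (|v|² + pᵀ A p)` of a pair (function, gradient field). -/
def sobolevNormSq {n : ℕ} (Ω : Set (E n)) (A : E n → Matrix (Fin n) (Fin n) ℝ)
    (v : E n → ℝ) (p : E n → E n) : ℝ≥0∞ :=
  ∫⁻ x in Ω, ENNReal.ofReal (v x ^ 2 + quad (A x) (p x))

/-- The pair `(u, p)` is the limit, in the norm of `W_A^{1,2}(Ω)`, of pairs `(v_j, ∇v_j)` of
functions `v_j` of the class `S` that have finite norm. -/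
def IsSobolevLimit {n : ℕ} (Ω : Set (E n)) (A : E n → Matrix (Fin n) (Fin n) ℝ)
    (S : Set (E n → ℝ)) (u : E n → ℝ) (p : E n → E n) : Prop :=
  AEStronglyMeasurable u (volume.restrict Ω) ∧ AEStronglyMeasurable p (volume.restrict Ω) ∧
  ∃ v : ℕ → E n → ℝ,
    (∀ j, v j ∈ S ∧ sobolevNormSq Ω A (v j) (gradient (v j)) < ∞) ∧
    Tendsto (fun j => sobolevNormSq Ω A (fun x => v j x - u x) (fun x => gradient (v j) x - p x))
      atTop (𝓝 0)

/-- Lipschitz functions on `ℝⁿ` whose support is a compact subset of `U`. -/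
def LipC {n : ℕ} (U : Set (E n)) : Set (E n → ℝ) :=
  {v | (∃ K : ℝ≥0, LipschitzWith K v) ∧ HasCompactSupport v ∧ tsupport v ⊆ U}

/-- `u ∈ W_A^{1,2}(Ω)` with (weak) gradient field `p`: the completion, in the norm
`(∫_Ω |v|² + ∇vᵀ A ∇v)^{1/2}`, of the locally Lipschitz functions on `Ω` of finite norm.
The field `p` is determined up to fields `q` with `qᵀ A q = 0` when `A` has a Lipschitz root. -/
def MemW {n : ℕ} (Ω : Set (E n)) (A : E n → Matrix (Fin n) (Fin n) ℝ)
    (u : E n → ℝ) (p : E n → E n) : Prop :=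
  IsSobolevLimit Ω A {v | LocallyLipschitzOn Ω v} u p

/-- `g ∈ (W_A^{1,2})_0(Ω)` with gradient field `q`: the closure in `W_A^{1,2}(Ω)` of the Lipschitz
functions with compact support in `Ω`. -/
def MemW0 {n : ℕ} (Ω : Set (E n)) (A : E n → Matrix (Fin n) (Fin n) ℝ)
    (g : E n → ℝ) (q : E n → E n) : Prop :=
  IsSobolevLimit Ω A (LipC Ω) g q

/-- `u` is a weak solution of `Lu = ∇ᵗʳ A ∇u = 0` in `Ω`: `u ∈ W_A^{1,2}(Ω)` and
`-∫_Ω ∇gᵀ A ∇u = 0` for all nonnegative `g ∈ (W_A^{1,2})_0(Ω)`. -/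
def IsWeakSolution {n : ℕ} (Ω : Set (E n)) (A : E n → Matrix (Fin n) (Fin n) ℝ)
    (u : E n → ℝ) : Prop :=
  ∃ p : E n → E n, MemW Ω A u p ∧
    ∀ (g : E n → ℝ) (q : E n → E n), MemW0 Ω A g q →
      (∀ᵐ x ∂(volume.restrict Ω), 0 ≤ g x) →
        -∫ x in Ω, inner ℝ (q x) (act (A x) (p x)) = 0

/-! ### Young functions and Orlicz norms -/

/-- `E_{k,N} = exp^{(k)}(2N)`. -/
def expE (k : ℕ) (N : ℝ) : ℝ := Real.exp^[k] (2 * N)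

/-- The Young function `Φ_{k,N}`: with `s = max(t², E_{k,N})`, it is
`t² (ln s)² (ln ln s)² ⋯ (ln^{(k-1)} s)² (ln^{(k)} s)^{2N}`. -/
def youngPhi (k : ℕ) (N : ℝ) (t : ℝ) : ℝ :=
  t ^ 2 * (∏ i ∈ Finset.Ico 1 k, (Real.log^[i] (max (t ^ 2) (expE k N))) ^ 2) *
    (Real.log^[k] (max (t ^ 2) (expE k N))) ^ (2 * N)

/-- The Luxemburg norm `inf {a > 0 : ∫ Φ(|f|/a) dν ≤ 1}` (`∞` if there is no such `a`). -/
def orliczNorm {X : Type*} [MeasurableSpace X] (Φ : ℝ → ℝ) (ν : Measure X) (f : X → ℝ) : ℝ≥0∞ :=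
  sInf {b : ℝ≥0∞ | ∃ a : ℝ, 0 < a ∧ b = ENNReal.ofReal a ∧
    ∫⁻ x, ENNReal.ofReal (Φ (|f x| / a)) ∂ν ≤ 1}

/-! ### Metric balls and the hypotheses on the metric measure space -/

/-- `d` is a metric on the set `Ω`. -/
structure IsMetricOn {X : Type*} (Ω : Set X) (d : X → X → ℝ) : Prop where
  nonneg : ∀ x ∈ Ω, ∀ y ∈ Ω, 0 ≤ d x y
  eq_zero_iff : ∀ x ∈ Ω, ∀ y ∈ Ω, d x y = 0 ↔ x = y
  symm : ∀ x ∈ Ω, ∀ y ∈ Ω, d x y = d y x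
  triangle : ∀ x ∈ Ω, ∀ y ∈ Ω, ∀ z ∈ Ω, d x z ≤ d x y + d y z

/-- The metric ball `B(x, r) = {y ∈ Ω : d(x, y) < r}`. -/
def mball {X : Type*} (Ω : Set X) (d : X → X → ℝ) (x : X) (r : ℝ) : Set X :=
  {y | y ∈ Ω ∧ d x y < r}

/-- The normalized measure `dμ_S = w dx / w(S)` on `S`. -/
def normMeasure {n : ℕ} (w : E n → ℝ) (S : Set (E n)) : Measure (E n) :=
  (wMeasure w S)⁻¹ • (wMeasure w).restrict S

/-- The proportional vanishing Poincaré inequality with constant `C` in `B(x, r)`: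
`∫_B |v|² dμ ≤ C r² ∫_{(3/2)B} |∇_A v|² dx` for every Lipschitz `v` on `(3/2)B` that vanishes on
some `S ⊆ B` with `w(S) ≥ w(B) / 2`. -/
def ProportionalPoincare {n : ℕ} (Ω : Set (E n)) (d : E n → E n → ℝ) (w : E n → ℝ)
    (B : E n → Matrix (Fin n) (Fin n) ℝ) (C : ℝ) (x : E n) (r : ℝ) : Prop :=
  ∀ v : E n → ℝ, (∃ K : ℝ≥0, LipschitzOnWith K v (mball Ω d x (3 / 2 * r))) →
    (∃ S ⊆ mball Ω d x r, wMeasure w (mball Ω d x r) / 2 ≤ wMeasure w S ∧ ∀ y ∈ S, v y = 0) →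
      ∫⁻ y in mball Ω d x r, ENNReal.ofReal (v y ^ 2) ∂(wMeasure w) ≤
        ENNReal.ofReal (C * r ^ 2) *
          ∫⁻ y in mball Ω d x (3 / 2 * r), ENNReal.ofReal (‖gradA B v y‖ ^ 2)

/-- The Orlicz-Sobolev inequality with Young function `Φ`, superradius `φ` and constant `C` in
`B(x, r)`: `‖v‖_{L^Φ(μ_B)} ≤ C φ(r) w(B)^{-1/2} ‖∇_A v‖_{L²}` for all `v ∈ Lip_c(B)`. -/
def OrliczSobolev {n : ℕ} (Ω : Set (E n)) (d : E n → E n → ℝ) (w : E n → ℝ)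
    (B : E n → Matrix (Fin n) (Fin n) ℝ) (Φ : ℝ → ℝ) (φ : ℝ → ℝ) (C : ℝ) (x : E n) (r : ℝ) :
    Prop :=
  ∀ v ∈ LipC (mball Ω d x r),
    orliczNorm Φ (normMeasure w (mball Ω d x r)) v ≤
      ENNReal.ofReal (C * φ r) / (wMeasure w (mball Ω d x r)) ^ (1 / 2 : ℝ) *
        (∫⁻ y in mball Ω d x r, ENNReal.ofReal (‖gradA B v y‖ ^ 2)) ^ (1 / 2 : ℝ)

/-- `φ` is a superradius on `[0, R₀]`: increasing, `φ(0) = 0` and `φ(r) ≥ r`. -/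
structure IsSuperradius (R₀ : ℝ) (φ : ℝ → ℝ) : Prop where
  mono : MonotoneOn φ (Set.Icc 0 R₀)
  zero : φ 0 = 0
  ge : ∀ r ∈ Set.Icc 0 R₀, r ≤ φ r

/-- `κ_{k,N}(j)`: it is `j²` for `j ≤ E_{k,N}`, and
`j (ln j) ⋯ (ln^{(k-2)} j) (ln^{(k-1)} j)^{(N+1)/2}` for `j > E_{k,N}`. -/
def kappa (k : ℕ) (N : ℝ) (j : ℕ) : ℝ :=
  if (j : ℝ) ≤ expE k N then (j : ℝ) ^ 2
  else (∏ i ∈ Finset.range (k - 1), Real.log^[i] (j : ℝ)) *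
    (Real.log^[k - 1] (j : ℝ)) ^ ((N + 1) / 2)

/-- The radii `r_1 = r`, `r_j - r_{j+1} = c r / κ_{k,N}(j)`, where `c > 0` is the constant for
which `r_j → r/2`. -/
def IsAdaptedRadii (k : ℕ) (N : ℝ) (r : ℝ) (ρ : ℕ → ℝ) : Prop :=
  ρ 1 = r ∧ (∃ c : ℝ, 0 < c ∧ ∀ j : ℕ, 1 ≤ j → ρ j - ρ (j + 1) = c * r / kappa k N j) ∧
    Tendsto ρ atTop (𝓝 (r / 2))

/-- There is an `(A, d, w; k, N)`-adapted sequence `ψ_1, ψ_2, …` of Lipschitz cutoff functions at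
`(x, r)`, with constant `C` in the bound `‖ |∇_A ψ_j| / w^{1/2} ‖_∞ ≤ C κ_{k,N}(j) / r`. -/
def HasAdaptedCutoffs {n : ℕ} (Ω : Set (E n)) (d : E n → E n → ℝ) (w : E n → ℝ)
    (B : E n → Matrix (Fin n) (Fin n) ℝ) (k : ℕ) (N : ℝ) (C : ℝ) (x : E n) (r : ℝ) : Prop :=
  ∃ (ρ : ℕ → ℝ) (ψ : ℕ → E n → ℝ), IsAdaptedRadii k N r ρ ∧ ∀ j : ℕ, 1 ≤ j →
    (∃ K : ℝ≥0, LipschitzWith K (ψ j)) ∧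
    tsupport (ψ j) ⊆ mball Ω d x (ρ j) ∧
    (∀ y ∈ mball Ω d x (ρ (j + 1)), ψ j y = 1) ∧
    ∀ᵐ y ∂(volume.restrict Ω), ‖gradA B (ψ j) y‖ / Real.sqrt (w y) ≤ C * kappa k N j / r

end DegElliptic

end

/-! This is De Giorgi's method in a setting where the Sobolev gain is only iterated-logarithmic, so
the oscillation decays by a factor that itself tends to 1 and every constant must be tracked in `r`.

A weak solution is replaced by Lipschitz functions V_i solving the equation up to residuals that
tend to 0 (`IsApprox`, `IsWeakSolution.exists_isApprox`). The chain rule is then needed only for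
Lipschitz functions. All energy estimates carry errors e_i → 0, and the passage to the limit in the
sup bounds is by Fatou.

Sup bound (`exists_deGiorgi_constant`). Write Φ(t) = t²Ψ(t). For a truncation on the j-th set, the
Orlicz–Sobolev inequality and a splitting at height T bound the new mean square by the energy times
T²·(measure of the support) + 1/Ψ(T). With mean squares Y_j = τ² e^(-4(Q+j)) and T² = e^(Q+j), the
total loss is κ(j)²/Ψ(T), which is at most a constant over (ln^(k-1) Q)^(N-1)
(`exists_kappa_sq_mul_le`). If S is the Sobolev constant and G the gradient scale of the cutoffs,
the iteration closes as soon as (SG)² is at most a small multiple of (ln^(k-1) Q)^(N-1), provided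
that the initial mean square is at most τ² e^(-4(Q+1)). With Q and τ large this already gives local
boundedness (`exists_ae_le`).

Oscillation (`exists_oscillation_constant`). Scale so that u ≤ 1 and u ≤ 0 on half of the ball, and
apply the sup bound to f = ln(1+δ) - ln(1+δ-u). The energy of f is bounded independently of δ, so by
the Poincaré inequality its mean square is bounded by a constant. What is needed is therefore C
e^(4(Q+1)) ≤ τ², and f ≤ τ with δ = e^(-τ)/2 means u ≤ 1 - e^(-τ)/2. Means are normalised by the
weight of the larger ball, so doubling plays no role.

On balls of radius comparable to r, SG is of size φ(3r)/r. Taking τ = ln ln(1/(3r)), the growth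
condition on φ with 2αN < N-1 leaves room for an admissible Q (`eventually_exists_exponent`). The
oscillation thus shrinks by 1 - 1/(4 ln(1/(3r))) from B(x,6r) to B(x,r/2). Along r = s/12^j the
subtracted terms are comparable to 1/j, so the product of the factors is 0 and the essential
oscillation at x vanishes. Continuity of a representative follows. -/

namespace DegElliptic

/-! ### The bilinear form of a matrix -/

/-- The bilinear form `ξᵀ M ζ`. -/
noncomputable def bil {n : ℕ} (M : Matrix (Fin n) (Fin n) ℝ) (ξ ζ : E n) : ℝ :=
  inner ℝ ξ (act M ζ)

section Bil

variable {n : ℕ} (M : Matrix (Fin n) (Fin n) ℝ)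

lemma bil_self (ξ : E n) : bil M ξ ξ = quad M ξ := rfl

lemma bil_add_left (ξ ξ' ζ : E n) : bil M (ξ + ξ') ζ = bil M ξ ζ + bil M ξ' ζ := by
  simp [bil, inner_add_left]

lemma bil_add_right (ξ ζ ζ' : E n) : bil M ξ (ζ + ζ') = bil M ξ ζ + bil M ξ ζ' := by
  simp [bil, act, inner_add_right]

lemma bil_sub_left (ξ ξ' ζ : E n) : bil M (ξ - ξ') ζ = bil M ξ ζ - bil M ξ' ζ := by
  simp [bil, inner_sub_left]

lemma bil_sub_right (ξ ζ ζ' : E n) : bil M ξ (ζ - ζ') = bil M ξ ζ - bil M ξ ζ' := by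
  simp [bil, act, inner_sub_right]

lemma bil_smul_left (a : ℝ) (ξ ζ : E n) : bil M (a • ξ) ζ = a * bil M ξ ζ := by
  simp [bil, inner_smul_left]

lemma bil_smul_right (a : ℝ) (ξ ζ : E n) : bil M ξ (a • ζ) = a * bil M ξ ζ := by
  simp [bil, act, inner_smul_right]

lemma bil_zero_left (ζ : E n) : bil M 0 ζ = 0 := by simp [bil]

lemma quad_smul (a : ℝ) (ξ : E n) : quad M (a • ξ) = a ^ 2 * quad M ξ := by
  simp only [← bil_self, bil_smul_left, bil_smul_right]; ring

lemma quad_zero : quad M 0 = 0 := by simp [quad]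

lemma bil_eq_sum (ξ ζ : E n) : bil M ξ ζ = ∑ i, ∑ j, ξ i * (M i j * ζ j) := by
  simp only [bil, act, PiLp.inner_apply, Matrix.toLpLin_apply, Matrix.mulVec, dotProduct]
  simp only [RCLike.inner_apply, conj_trivial, Finset.sum_mul]
  refine Finset.sum_congr rfl fun i _ => Finset.sum_congr rfl fun j _ => by ring

variable {M}

lemma bil_comm (hM : M.PosSemidef) (ξ ζ : E n) : bil M ξ ζ = bil M ζ ξ := by
  rw [bil_eq_sum, bil_eq_sum, Finset.sum_comm]
  refine Finset.sum_congr rfl fun i _ => Finset.sum_congr rfl fun j _ => ?_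
  have := hM.isHermitian.apply i j
  simp only [star_trivial] at this
  rw [this]; ring

lemma quad_nonneg (hM : M.PosSemidef) (ξ : E n) : 0 ≤ quad M ξ := by
  rw [← bil_self, bil_eq_sum]
  have := hM.dotProduct_mulVec_nonneg ξ
  simpa [dotProduct, Matrix.mulVec, Finset.mul_sum] using this

lemma quad_add (hM : M.PosSemidef) (ξ ζ : E n) :
    quad M (ξ + ζ) = quad M ξ + 2 * bil M ξ ζ + quad M ζ := by
  simp only [← bil_self, bil_add_left, bil_add_right, bil_comm hM ζ ξ]; ring

lemma two_mul_bil_le (hM : M.PosSemidef) (ξ ζ : E n) {t : ℝ} (ht : 0 < t) :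
    2 * bil M ξ ζ ≤ t * quad M ξ + t⁻¹ * quad M ζ := by
  have h := quad_nonneg hM (t • ξ + (-1 : ℝ) • ζ)
  rw [quad_add hM, quad_smul, quad_smul, bil_smul_left, bil_smul_right] at h
  have : 2 * t * bil M ξ ζ ≤ t ^ 2 * quad M ξ + quad M ζ := by linarith
  have h2 := mul_le_mul_of_nonneg_left this (inv_nonneg.2 ht.le)
  have e1 : t⁻¹ * (2 * t * bil M ξ ζ) = 2 * bil M ξ ζ := by field_simp
  have e2 : t⁻¹ * (t ^ 2 * quad M ξ + quad M ζ) = t * quad M ξ + t⁻¹ * quad M ζ := by field_simp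
  linarith

lemma two_mul_abs_bil_le (hM : M.PosSemidef) (ξ ζ : E n) {t : ℝ} (ht : 0 < t) :
    2 * |bil M ξ ζ| ≤ t * quad M ξ + t⁻¹ * quad M ζ := by
  rcases abs_cases (bil M ξ ζ) with ⟨h, -⟩ | ⟨h, -⟩
  · rw [h]; exact two_mul_bil_le hM ξ ζ ht
  · have h1 := two_mul_bil_le hM ((-1 : ℝ) • ξ) ζ ht
    rw [bil_smul_left, quad_smul] at h1
    rw [h]; linarith

lemma quad_add_le (hM : M.PosSemidef) (ξ ζ : E n) :
    quad M (ξ + ζ) ≤ 2 * quad M ξ + 2 * quad M ζ := by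
  have h := two_mul_bil_le hM ξ ζ one_pos
  rw [quad_add hM]; simp at h; linarith

lemma abs_bil_le {C : ℝ} (hM : ∀ i j, |M i j| ≤ C) (ξ ζ : E n) :
    |bil M ξ ζ| ≤ n * n * C * (‖ξ‖ * ‖ζ‖) := by
  rw [bil_eq_sum]
  calc |∑ i, ∑ j, ξ i * (M i j * ζ j)| ≤ ∑ i : Fin n, ∑ j : Fin n, C * (‖ξ‖ * ‖ζ‖) := by
        refine (Finset.abs_sum_le_sum_abs _ _).trans (Finset.sum_le_sum fun i _ => ?_)
        refine (Finset.abs_sum_le_sum_abs _ _).trans (Finset.sum_le_sum fun j _ => ?_)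
        have h1 : |ξ i| ≤ ‖ξ‖ := by simpa using PiLp.norm_apply_le ξ i
        have h2 : |ζ j| ≤ ‖ζ‖ := by simpa using PiLp.norm_apply_le ζ j
        rw [abs_mul, abs_mul]
        have h3 : |M i j| * (|ξ i| * |ζ j|) ≤ C * (‖ξ‖ * ‖ζ‖) := by
          have := (abs_nonneg (M i j)).trans (hM i j)
          gcongr; exact hM i j
        linarith
    _ = n * n * C * (‖ξ‖ * ‖ζ‖) := by simp; ring

end Bil

/-! ### Gradients -/

section Gradient

variable {n : ℕ}

lemma gradient_mul {f g : E n → ℝ} {x : E n} (hf : DifferentiableAt ℝ f x)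
    (hg : DifferentiableAt ℝ g x) :
    gradient (fun y => f y * g y) x = f x • gradient g x + g x • gradient f x := by
  simp only [gradient, fderiv_fun_mul hf hg, map_add, map_smulₛₗ]; simp

lemma gradient_sub {f g : E n → ℝ} {x : E n} (hf : DifferentiableAt ℝ f x)
    (hg : DifferentiableAt ℝ g x) :
    gradient (fun y => f y - g y) x = gradient f x - gradient g x := by
  simp only [gradient, fderiv_fun_sub hf hg, map_sub]

/-- No differentiability is needed: where `f` is not differentiable both sides take the default
value 0. -/
lemma gradient_const_mul_add (a b : ℝ) (f : E n → ℝ) (x : E n) :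
    gradient (fun y => a * f y + b) x = a • gradient f x := by
  have : fderiv ℝ (fun y => a * f y + b) x = a • fderiv ℝ f x := by
    rw [fderiv_add_const]
    change fderiv ℝ (a • f) x = _
    rw [fderiv_const_smul_field]
    rfl
  simp only [gradient, this, map_smulₛₗ]; simp

lemma gradient_sub_const (f : E n → ℝ) (c : ℝ) (x : E n) :
    gradient (fun y => f y - c) x = gradient f x := by
  simpa [sub_eq_add_neg] using gradient_const_mul_add 1 (-c) f x

lemma gradient_comp {h : ℝ → ℝ} {h' : ℝ} {f : E n → ℝ} {x : E n} (hh : HasDerivAt h h' (f x))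
    (hf : DifferentiableAt ℝ f x) :
    gradient (fun y => h (f y)) x = h' • gradient f x := by
  have : fderiv ℝ (fun y => h (f y)) x = h' • fderiv ℝ f x :=
    (hh.comp_hasFDerivAt x hf.hasFDerivAt).fderiv
  simp only [gradient, this, map_smulₛₗ]; simp

-- This holds at every point, also on {f = 0}: wherever f ≤ 0 the positive part has a minimum, so
-- its derivative is 0, if only as a default value. No argument about level sets is required.
open Classical in
lemma gradient_max_zero {f : E n → ℝ} (hf : Continuous f) (x : E n) :
    gradient (fun y => max (f y) 0) x = if 0 < f x then gradient f x else 0 := by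
  split_ifs with h
  · refine Filter.EventuallyEq.gradient_eq ?_
    filter_upwards [hf.continuousAt.eventually (lt_mem_nhds h)] with y hy
    exact max_eq_left hy.le
  · have hmin : IsLocalMin (fun y => max (f y) 0) x := by
      refine Eventually.of_forall fun y => ?_
      simp only [max_eq_right (not_lt.1 h)]
      exact le_max_right _ _
    simp [gradient, hmin.fderiv_eq_zero]

lemma measurable_gradient (f : E n → ℝ) : Measurable (gradient f) :=
  (InnerProductSpace.toDual ℝ (E n)).symm.continuous.measurable.comp (measurable_fderiv ℝ f)

lemma norm_gradient_le {f : E n → ℝ} {K : ℝ≥0} (hf : LipschitzWith K f) (x : E n) :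
    ‖gradient f x‖ ≤ K := by
  simpa [gradient] using norm_fderiv_le_of_lipschitz ℝ hf

lemma gradient_eq_zero_of_notMem_tsupport {f : E n → ℝ} {x : E n} (hx : x ∉ tsupport f) :
    gradient f x = 0 := by
  have : fderiv ℝ f x = 0 := by
    by_contra h
    exact hx (support_fderiv_subset ℝ h)
  simp [gradient, this]

end Gradient

/-! ### Bounded Lipschitz functions -/

/-- Bounded Lipschitz functions. -/
def BLip {n : ℕ} (f : E n → ℝ) : Prop :=
  (∃ K : ℝ≥0, LipschitzWith K f) ∧ ∃ M : ℝ, ∀ x, |f x| ≤ M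

section BLip

variable {n : ℕ} {f g : E n → ℝ}

lemma BLip.continuous (hf : BLip f) : Continuous f := hf.1.choose_spec.continuous

lemma BLip.ae_differentiableAt (hf : BLip f) (μ : Measure (E n)) (hμ : μ ≪ volume) :
    ∀ᵐ x ∂μ, DifferentiableAt ℝ f x :=
  hμ.ae_le hf.1.choose_spec.ae_differentiableAt

lemma BLip.gradient_bdd (hf : BLip f) : ∃ K : ℝ, ∀ x, ‖gradient f x‖ ≤ K :=
  ⟨hf.1.choose, norm_gradient_le hf.1.choose_spec⟩

lemma BLip.mul (hf : BLip f) (hg : BLip g) : BLip (fun x => f x * g x) := by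
  obtain ⟨⟨K, hK⟩, M, hM⟩ := hf
  obtain ⟨⟨L, hL⟩, M', hM'⟩ := hg
  have h0 : 0 ≤ M := (abs_nonneg _).trans (hM 0)
  have h0' : 0 ≤ M' := (abs_nonneg _).trans (hM' 0)
  refine ⟨⟨M.toNNReal * L + K * M'.toNNReal, LipschitzWith.of_dist_le_mul fun x y => ?_⟩, M * M',
    fun x => ?_⟩
  · have e : f x * g x - f y * g y = f x * (g x - g y) + (f x - f y) * g y := by ring
    have h1 := hK.dist_le_mul x y
    have h2 := hL.dist_le_mul x y
    rw [Real.dist_eq] at h1 h2 ⊢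
    rw [e]
    refine (abs_add_le _ _).trans ?_
    rw [abs_mul, abs_mul]
    push_cast
    rw [Real.coe_toNNReal _ h0, Real.coe_toNNReal _ h0']
    calc |f x| * |g x - g y| + |f x - f y| * |g y|
        ≤ M * (L * dist x y) + (K * dist x y) * M' := by gcongr <;> simp_all
      _ = _ := by ring
  · rw [abs_mul]; gcongr <;> simp_all

lemma BLip.const (c : ℝ) : BLip (fun _ : E n => c) :=
  ⟨⟨0, LipschitzWith.const c⟩, |c|, fun _ => le_rfl⟩

lemma BLip.comp {h : ℝ → ℝ} {I : Set ℝ} {L : ℝ≥0} (hf : BLip f) (hI : ∀ x, f x ∈ I)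
    (hh : LipschitzOnWith L h I) : BLip (fun x => h (f x)) := by
  obtain ⟨⟨K, hK⟩, M, hM⟩ := hf
  have h1 : LipschitzWith (L * K) (fun x => h (f x)) := by
    have := hh.comp (hK.lipschitzOnWith (s := Set.univ)) (fun x _ => hI x)
    exact lipschitzOnWith_univ.1 this
  refine ⟨⟨_, h1⟩, |h (f 0)| + L * (M + M), fun x => ?_⟩
  have h2 := hh.dist_le_mul _ (hI x) _ (hI 0)
  rw [Real.dist_eq, Real.dist_eq] at h2
  have h3 : |h (f x)| ≤ |h (f 0)| + |h (f x) - h (f 0)| := by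
    have := abs_add_le (h (f 0)) (h (f x) - h (f 0)); simpa using this
  have h4 : |f x - f 0| ≤ M + M := (abs_sub _ _).trans (add_le_add (hM x) (hM 0))
  have : (L : ℝ) * |f x - f 0| ≤ L * (M + M) := by gcongr
  linarith

lemma BLip.affine (hf : BLip f) (a b : ℝ) : BLip (fun x => a * f x + b) := by
  refine hf.comp (h := fun t => a * t + b) (I := Set.univ) (L := ‖a‖₊) (fun _ => trivial)
    (LipschitzOnWith.of_dist_le_mul fun x _ y _ => ?_)
  simp [Real.dist_eq, ← mul_sub, abs_mul]

lemma BLip.sub_const (hf : BLip f) (c : ℝ) : BLip (fun x => f x - c) := by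
  simpa [sub_eq_add_neg] using hf.affine 1 (-c)

lemma BLip.max_zero (hf : BLip f) : BLip (fun x => max (f x) 0) :=
  hf.comp (h := fun t => max t 0) (I := Set.univ) (L := 1) (fun _ => trivial)
    ((LipschitzWith.id.max_const 0).lipschitzOnWith)

/-- Bounds on the compact support of `f` suffice. If one of the two points lies outside it, the
product vanishes there and the Lipschitz constant of `f` alone controls the difference. Hence `g`
may be merely locally Lipschitz on `U`, like the functions that generate the Sobolev space. -/
lemma LipC.mul {U : Set (E n)} (hf : f ∈ LipC U) (hg : LocallyLipschitzOn U g) :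
    (fun x => f x * g x) ∈ LipC U := by
  obtain ⟨⟨K, hK⟩, hc, hs⟩ := hf
  obtain ⟨L, hL⟩ := (hg.mono hs).exists_lipschitzOnWith_of_compact hc
  obtain ⟨M, hM⟩ := hc.bddAbove_image (hK.continuous.abs.continuousOn)
  obtain ⟨M', hM'⟩ := hc.bddAbove_image (f := fun x => |g x|) hL.continuousOn.abs
  have hM1 : ∀ x ∈ tsupport f, |f x| ≤ |M| := fun x hx =>
    (hM (Set.mem_image_of_mem _ hx)).trans (le_abs_self _)
  have hM2 : ∀ x ∈ tsupport f, |g x| ≤ |M'| := fun x hx =>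
    (hM' (Set.mem_image_of_mem (fun x => |g x|) hx)).trans (le_abs_self _)
  have key : ∀ x ∈ tsupport f, ∀ y,
      dist (f x * g x) (f y * g y) ≤ (|M| * L + K * |M'|) * dist x y := by
    intro x hx y
    have h1 := hK.dist_le_mul x y
    rw [Real.dist_eq] at h1 ⊢
    by_cases hy : y ∈ tsupport f
    · have e : f x * g x - f y * g y = f y * (g x - g y) + (f x - f y) * g x := by ring
      have h2 := hL.dist_le_mul x hx y hy
      rw [Real.dist_eq] at h2
      rw [e]
      refine (abs_add_le _ _).trans ?_
      rw [abs_mul, abs_mul]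
      have h3 := hM1 y hy
      have h4 := hM2 x hx
      calc |f y| * |g x - g y| + |f x - f y| * |g x|
          ≤ |M| * (L * dist x y) + (K * dist x y) * |M'| := by gcongr
        _ = _ := by ring
    · have h0 : f y = 0 := image_eq_zero_of_notMem_tsupport hy
      have h4 := hM2 x hx
      rw [h0, sub_zero] at h1
      rw [h0, zero_mul, sub_zero, abs_mul]
      calc |f x| * |g x| ≤ (K * dist x y) * |M'| := by gcongr
        _ ≤ (|M| * L + K * |M'|) * dist x y := by
          have : 0 ≤ |M| * L * dist x y := by positivity
          nlinarith
  refine ⟨⟨‖M‖₊ * L + K * ‖M'‖₊, LipschitzWith.of_dist_le_mul fun x y => ?_⟩,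
    hc.mul_right, (tsupport_mul_subset_left).trans hs⟩
  push_cast
  simp only [Real.norm_eq_abs]
  by_cases hx : x ∈ tsupport f
  · exact key x hx y
  · by_cases hy : y ∈ tsupport f
    · rw [dist_comm, dist_comm x]; exact key y hy x
    · rw [image_eq_zero_of_notMem_tsupport hx, image_eq_zero_of_notMem_tsupport hy]
      simp; positivity

lemma LipC.mono {U U' : Set (E n)} (h : U ⊆ U') (hf : f ∈ LipC U) : f ∈ LipC U' :=
  ⟨hf.1, hf.2.1, hf.2.2.trans h⟩

lemma LipC.bLip {U : Set (E n)} (hf : f ∈ LipC U) : BLip f := by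
  obtain ⟨⟨K, hK⟩, hc, -⟩ := hf
  obtain ⟨M, hM⟩ := hc.exists_bound_of_continuous hK.continuous
  exact ⟨⟨K, hK⟩, M, hM⟩

lemma BLip.locallyLipschitzOn (hf : BLip f) (U : Set (E n)) : LocallyLipschitzOn U f :=
  hf.1.choose_spec.locallyLipschitz.locallyLipschitzOn

lemma LipC.mul_bLip {U : Set (E n)} (hf : f ∈ LipC U) (hg : BLip g) :
    (fun x => f x * g x) ∈ LipC U :=
  LipC.mul hf (hg.locallyLipschitzOn U)

end BLip

/-! ### Integrals of the energy density -/

/-- `U` is an open set of finite volume on which the matrix function `A` is measurable, bounded and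
positive semidefinite. -/
structure GoodCoef {n : ℕ} (U : Set (E n)) (A : E n → Matrix (Fin n) (Fin n) ℝ) : Prop where
  isOpen : IsOpen U
  finite : volume U < ∞
  meas : ∀ i j, AEMeasurable (fun x => A x i j) (volume.restrict U)
  bdd : ∃ C : ℝ, 0 ≤ C ∧ ∀ᵐ x ∂(volume.restrict U), ∀ i j, |A x i j| ≤ C
  psd : ∀ᵐ x ∂(volume.restrict U), (A x).PosSemidef

section GoodCoef

variable {n : ℕ} {U : Set (E n)} {A : E n → Matrix (Fin n) (Fin n) ℝ}

lemma GoodCoef.mono (hA : GoodCoef U A) {U' : Set (E n)} (hU' : IsOpen U') (h : U' ⊆ U) :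
    GoodCoef U' A where
  isOpen := hU'
  finite := (measure_mono h).trans_lt hA.finite
  meas i j := (hA.meas i j).mono_set h
  bdd := by
    obtain ⟨C, hC, h1⟩ := hA.bdd
    exact ⟨C, hC, ae_mono (Measure.restrict_mono h le_rfl) h1⟩
  psd := ae_mono (Measure.restrict_mono h le_rfl) hA.psd

lemma aestronglyMeasurable_bil {μ : Measure (E n)} (hA : ∀ i j, AEMeasurable (fun x => A x i j) μ)
    {ξ ζ : E n → E n} (hξ : AEStronglyMeasurable ξ μ) (hζ : AEStronglyMeasurable ζ μ) :
    AEStronglyMeasurable (fun x => bil (A x) (ξ x) (ζ x)) μ := by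
  simp only [bil_eq_sum]
  have hcoord : ∀ {η : E n → E n}, AEStronglyMeasurable η μ → ∀ i,
      AEMeasurable (fun x => η x i) μ := fun {η} h i =>
    ((EuclideanSpace.proj (𝕜 := ℝ) i).continuous.comp_aestronglyMeasurable h).aemeasurable
  refine (Finset.aemeasurable_fun_sum _ fun i _ => Finset.aemeasurable_fun_sum _ fun j _ =>
    (hcoord hξ i).mul ((hA i j).mul (hcoord hζ j))).aestronglyMeasurable

lemma GoodCoef.integrable_bil (hA : GoodCoef U A) {ξ ζ : E n → E n} (hξ : Measurable ξ)
    (hζ : Measurable ζ) (bξ : ∃ K : ℝ, ∀ x, ‖ξ x‖ ≤ K) (bζ : ∃ K : ℝ, ∀ x, ‖ζ x‖ ≤ K) :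
    Integrable (fun x => bil (A x) (ξ x) (ζ x)) (volume.restrict U) := by
  obtain ⟨C, hC0, hC⟩ := hA.bdd
  obtain ⟨K, hK⟩ := bξ
  obtain ⟨L, hL⟩ := bζ
  have : IsFiniteMeasure (volume.restrict U) := ⟨by simpa using hA.finite⟩
  refine Integrable.of_bound (aestronglyMeasurable_bil hA.meas hξ.aestronglyMeasurable
    hζ.aestronglyMeasurable) (n * n * C * (K * L)) ?_
  filter_upwards [hC] with x hx
  refine (abs_bil_le hx _ _).trans ?_
  have := (norm_nonneg _).trans (hK x)
  gcongr <;> simp_all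

lemma GoodCoef.integrable_bil_gradient (hA : GoodCoef U A) {f g : E n → ℝ} (hf : BLip f)
    (hg : BLip g) :
    Integrable (fun x => bil (A x) (gradient f x) (gradient g x)) (volume.restrict U) :=
  hA.integrable_bil (measurable_gradient f) (measurable_gradient g) hf.gradient_bdd hg.gradient_bdd

lemma GoodCoef.integrable_quad_gradient (hA : GoodCoef U A) {f : E n → ℝ} (hf : BLip f) :
    Integrable (fun x => quad (A x) (gradient f x)) (volume.restrict U) :=
  hA.integrable_bil_gradient hf hf

lemma BLip.integrable_mul {μ : Measure (E n)} {f q : E n → ℝ} (hf : BLip f)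
    (hq : Integrable q μ) : Integrable (fun x => f x * q x) μ := by
  obtain ⟨M, hM⟩ := hf.2
  exact hq.bdd_mul hf.continuous.aestronglyMeasurable (Eventually.of_forall hM)

lemma BLip.integrable_sq_mul {μ : Measure (E n)} {f q : E n → ℝ} (hf : BLip f)
    (hq : Integrable q μ) : Integrable (fun x => f x ^ 2 * q x) μ := by
  simpa [sq] using (hf.mul hf).integrable_mul hq

lemma BLip.integrable_sq {μ : Measure (E n)} [IsFiniteMeasure μ] {f : E n → ℝ} (hf : BLip f) :
    Integrable (fun x => f x ^ 2) μ := by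
  simpa using hf.integrable_sq_mul (integrable_const (1 : ℝ) (μ := μ))

lemma GoodCoef.isFiniteMeasure (hA : GoodCoef U A) : IsFiniteMeasure (volume.restrict U) :=
  ⟨by simpa using hA.finite⟩

lemma GoodCoef.quad_gradient_le (hA : GoodCoef U A) {f : E n → ℝ} (hf : BLip f) :
    ∃ Q : ℝ, 0 ≤ Q ∧ ∀ᵐ x ∂(volume.restrict U), quad (A x) (gradient f x) ≤ Q := by
  obtain ⟨C, hC0, hC⟩ := hA.bdd
  obtain ⟨K, hK⟩ := hf.gradient_bdd
  have hK0 := (norm_nonneg _).trans (hK 0)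
  refine ⟨n * n * C * (K * K), by positivity, ?_⟩
  filter_upwards [hC] with x hx
  refine (le_abs_self _).trans ((abs_bil_le hx _ _).trans ?_)
  gcongr <;> exact hK x

/-- Young's inequality for the integrated bilinear form. -/
lemma GoodCoef.abs_integral_bil_le (hA : GoodCoef U A) {ξ ζ : E n → E n} {η t : ℝ}
    (hξ : Integrable (fun x => quad (A x) (ξ x)) (volume.restrict U))
    (hζ : Integrable (fun x => quad (A x) (ζ x)) (volume.restrict U))
    (hη : ∫ x in U, quad (A x) (ζ x) ≤ η) (ht : Real.sqrt η < t) :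
    |∫ x in U, bil (A x) (ξ x) (ζ x)| ≤ t * (1 + ∫ x in U, quad (A x) (ξ x)) := by
  -- The strict inequality keeps `t` positive even for `η = 0`, so Young's inequality applies with
  -- weight `t`.
  have ht0 : 0 < t := (Real.sqrt_nonneg _).trans_lt ht
  have hq : 0 ≤ ∫ x in U, quad (A x) (ξ x) :=
    integral_nonneg_of_ae (hA.psd.mono fun x hx => quad_nonneg hx _)
  have h2 : ∫ x in U, quad (A x) (ζ x) ≤ t ^ 2 := by
    refine hη.trans ?_
    exact ((Real.sqrt_lt' ht0).1 ht).le
  have h1 : |∫ x in U, bil (A x) (ξ x) (ζ x)|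
      ≤ ∫ x in U, (t / 2 * quad (A x) (ξ x) + t⁻¹ / 2 * quad (A x) (ζ x)) := by
    refine (abs_integral_le_integral_abs).trans ?_
    refine integral_mono_of_nonneg (Eventually.of_forall fun x => abs_nonneg _)
      ((hξ.const_mul _).add (hζ.const_mul _)) ?_
    filter_upwards [hA.psd] with x hx
    have := two_mul_abs_bil_le hx (ξ x) (ζ x) ht0
    linarith
  rw [integral_add (hξ.const_mul _) (hζ.const_mul _), integral_const_mul, integral_const_mul] at h1
  have h3 : t⁻¹ / 2 * ∫ x in U, quad (A x) (ζ x) ≤ t / 2 := by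
    calc t⁻¹ / 2 * ∫ x in U, quad (A x) (ζ x) ≤ t⁻¹ / 2 * t ^ 2 := by gcongr
      _ = t / 2 := by field_simp
  nlinarith

end GoodCoef

/-! ### Lipschitz approximate solutions -/

/-- A sequence of bounded Lipschitz functions that is bounded in the energy norm of `U` and whose
equation residuals tend to `0`. -/
structure IsApprox {n : ℕ} (A : E n → Matrix (Fin n) (Fin n) ℝ) (U : Set (E n))
    (V : ℕ → E n → ℝ) : Prop where
  bLip : ∀ i, BLip (V i)
  l2 : ∃ M : ℝ, ∀ i, ∫ x in U, V i x ^ 2 ≤ M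
  energy : ∃ M : ℝ, ∀ i, ∫ x in U, quad (A x) (gradient (V i) x) ≤ M
  test : ∃ ε : ℕ → ℝ, (∀ i, 0 ≤ ε i) ∧ Tendsto ε atTop (𝓝 0) ∧ ∀ i, ∀ g ∈ LipC U,
    |∫ x in U, bil (A x) (gradient g x) (gradient (V i) x)|
      ≤ ε i * (1 + ∫ x in U, quad (A x) (gradient g x))

section IsApprox

variable {n : ℕ} {U : Set (E n)} {A : E n → Matrix (Fin n) (Fin n) ℝ} {V : ℕ → E n → ℝ}

/-- The energy estimate obtained from the test functions `ψ² H_i`. -/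
lemma IsApprox.energy_estimate (hA : GoodCoef U A) (hV : IsApprox A U V)
    {W H Z : ℕ → E n → ℝ} (hW : ∀ i, BLip (W i)) (hH : ∀ i, BLip (H i)) (hZ : ∀ i, BLip (Z i))
    (h1 : ∀ i, ∀ᵐ x ∂(volume.restrict U),
      quad (A x) (gradient (W i) x) ≤ bil (A x) (gradient (H i) x) (gradient (V i) x))
    (h2 : ∀ i, ∀ᵐ x ∂(volume.restrict U), H i x • gradient (V i) x = Z i x • gradient (W i) x)
    (hH2 : ∃ M : ℝ, ∀ i, ∫ x in U, H i x ^ 2 ≤ M)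
    (hHq : ∃ M : ℝ, ∀ i, ∀ᵐ x ∂(volume.restrict U),
      quad (A x) (gradient (H i) x) ≤ M * quad (A x) (gradient (V i) x))
    {ψ : E n → ℝ} (hψ : ψ ∈ LipC U) :
    ∃ e : ℕ → ℝ, Tendsto e atTop (𝓝 0) ∧ (∀ i, 0 ≤ e i) ∧
      ∀ i, ∫ x in U, ψ x ^ 2 * quad (A x) (gradient (W i) x)
        ≤ 4 * (∫ x in U, Z i x ^ 2 * quad (A x) (gradient ψ x)) + e i := by
  obtain ⟨ε, hε0, hε, htest⟩ := hV.test
  obtain ⟨M1, hM1⟩ := hH2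
  obtain ⟨M2, hM2⟩ := hHq
  obtain ⟨M3, hM3⟩ := hV.energy
  have hψL := LipC.bLip hψ
  obtain ⟨P, hP⟩ := hψL.2
  have hP0 := (abs_nonneg _).trans (hP 0)
  obtain ⟨Q, hQ0, hQ⟩ := hA.quad_gradient_le hψL
  have := hA.isFiniteMeasure
  have hac : volume.restrict U ≪ volume := Measure.absolutelyContinuous_of_le Measure.restrict_le_self
  -- `M` bounds the energy of the test functions ψ²H_i uniformly in i: the first term comes from
  -- ∇H_i, the second from ∇ψ. The residual of the equation at these test functions therefore tends
  -- to 0.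
  set M : ℝ := 2 * P ^ 4 * |M2| * M3 + 8 * P ^ 2 * Q * M1 with hM
  have hg : ∀ i, (fun x => ψ x * (ψ x * H i x)) ∈ LipC U := fun i =>
    LipC.mul_bLip hψ (hψL.mul (hH i))
  have hgrad : ∀ i, ∀ᵐ x ∂(volume.restrict U), gradient (fun x => ψ x * (ψ x * H i x)) x
      = (ψ x ^ 2) • gradient (H i) x + (2 * ψ x * H i x) • gradient ψ x := by
    intro i
    filter_upwards [hψL.ae_differentiableAt _ hac, (hH i).ae_differentiableAt _ hac] with x hx hx'
    rw [gradient_mul hx (hx.fun_mul hx'), gradient_mul hx hx']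
    module
  have hgq : ∀ i, ∫ x in U, quad (A x) (gradient (fun x => ψ x * (ψ x * H i x)) x) ≤ M := by
    intro i
    have i1 := hA.integrable_quad_gradient (hV.bLip i)
    have i2 := (hH i).integrable_sq (μ := volume.restrict U)
    have : ∫ x in U, quad (A x) (gradient (fun x => ψ x * (ψ x * H i x)) x) ≤
        ∫ x in U, ((2 * P ^ 4 * |M2|) * quad (A x) (gradient (V i) x)
          + (8 * P ^ 2 * Q) * H i x ^ 2) := by
      refine integral_mono_ae (hA.integrable_quad_gradient (LipC.bLip (hg i)))
        ((i1.const_mul _).add (i2.const_mul _)) ?_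
      filter_upwards [hgrad i, hA.psd, hM2 i, hQ] with x e1 e2 e3 e4
      rw [e1]
      refine (quad_add_le e2 _ _).trans ?_
      rw [quad_smul, quad_smul]
      have p1 : ψ x ^ 2 ≤ P ^ 2 := by rw [← sq_abs]; gcongr; exact hP x
      have p2 : (ψ x ^ 2) ^ 2 ≤ P ^ 4 := by nlinarith [sq_nonneg (ψ x), sq_nonneg P]
      have q0 := quad_nonneg e2 (gradient (V i) x)
      have q1 := quad_nonneg e2 (gradient (H i) x)
      have q2 := quad_nonneg e2 (gradient ψ x)
      have a1 : (ψ x ^ 2) ^ 2 * quad (A x) (gradient (H i) x)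
          ≤ P ^ 4 * (|M2| * quad (A x) (gradient (V i) x)) := by
        gcongr
        exact e3.trans (by gcongr; exact le_abs_self _)
      have a2 : (2 * ψ x * H i x) ^ 2 * quad (A x) (gradient ψ x)
          ≤ (4 * (P ^ 2 * H i x ^ 2)) * Q := by
        gcongr
        calc (2 * ψ x * H i x) ^ 2 = 4 * (ψ x ^ 2 * H i x ^ 2) := by ring
          _ ≤ _ := by gcongr
      linarith
    refine this.trans ?_
    rw [integral_add (i1.const_mul _) (i2.const_mul _), integral_const_mul, integral_const_mul]
    have := hM3 i
    have := hM1 i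
    rw [hM]; gcongr
  have hM0 : 0 ≤ M := (integral_nonneg_of_ae (hA.psd.mono fun x hx => quad_nonneg hx _)).trans
    (hgq 0)
  refine ⟨fun i => 2 * (ε i * (1 + M)), ?_, fun i => by have := hε0 i; positivity, fun i => ?_⟩
  · simpa using (hε.mul_const (1 + M)).const_mul 2
  have j1 := hψL.integrable_sq_mul (hA.integrable_quad_gradient (hW i))
  have j2 := (hZ i).integrable_sq_mul (hA.integrable_quad_gradient hψL)
  have j3 := hA.integrable_bil_gradient (LipC.bLip (hg i)) (hV.bLip i)
  -- Expanding ∇(ψ²H_i) leaves the cross term 2ψH⟨∇ψ,∇V⟩ = 2ψZ⟨∇ψ,∇W⟩. Young's inequality moves half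
  -- of ψ²|∇W|² to the left, and doubling gives the factors 4 and 2.
  have main : ∫ x in U, ψ x ^ 2 * quad (A x) (gradient (W i) x) ≤
      ∫ x in U, (4 * (Z i x ^ 2 * quad (A x) (gradient ψ x)) +
        2 * bil (A x) (gradient (fun x => ψ x * (ψ x * H i x)) x) (gradient (V i) x)) := by
    refine integral_mono_ae j1 ((j2.const_mul _).add (j3.const_mul _)) ?_
    filter_upwards [hgrad i, hA.psd, h1 i, h2 i] with x e1 e2 e3 e4
    rw [e1, bil_add_left, bil_smul_left, bil_smul_left]
    have e5 : H i x * bil (A x) (gradient ψ x) (gradient (V i) x)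
        = Z i x * bil (A x) (gradient ψ x) (gradient (W i) x) := by
      rw [← bil_smul_right, ← bil_smul_right, e4]
    have e6 := two_mul_abs_bil_le e2 ((2 * Z i x) • gradient ψ x) (ψ x • gradient (W i) x) one_pos
    rw [bil_smul_left, bil_smul_right, quad_smul, quad_smul] at e6
    have e7 := neg_abs_le (2 * Z i x * (ψ x * bil (A x) (gradient ψ x) (gradient (W i) x)))
    have e8 := mul_le_mul_of_nonneg_left e3 (sq_nonneg (ψ x))
    have e9 : 2 * ψ x * H i x * bil (A x) (gradient ψ x) (gradient (V i) x)
      = 2 * Z i x * (ψ x * bil (A x) (gradient ψ x) (gradient (W i) x)) := by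
      linear_combination (2 * ψ x) * e5
    rw [e9]
    simp only [inv_one, one_mul] at e6
    linarith
  refine main.trans ?_
  rw [integral_add (j2.const_mul _) (j3.const_mul _), integral_const_mul, integral_const_mul]
  have t1 := (le_abs_self _).trans (htest i _ (hg i))
  have t2 : ε i * (1 + ∫ x in U, quad (A x) (gradient (fun x => ψ x * (ψ x * H i x)) x))
    ≤ ε i * (1 + M) := by
    have := hε0 i; have := hgq i; gcongr
  linarith

lemma IsApprox.subseq (hV : IsApprox A U V) {σ : ℕ → ℕ} (hσ : StrictMono σ) :
    IsApprox A U (fun i => V (σ i)) where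
  bLip i := hV.bLip _
  l2 := hV.l2.imp fun _ h i => h _
  energy := hV.energy.imp fun _ h i => h _
  test := by
    obtain ⟨ε, h0, h1, h2⟩ := hV.test
    exact ⟨fun i => ε (σ i), fun i => h0 _, h1.comp hσ.tendsto_atTop, fun i => h2 _⟩

lemma IsApprox.affine (hA : GoodCoef U A) (hV : IsApprox A U V) (a b : ℝ) :
    IsApprox A U (fun i x => a * V i x + b) where
  bLip i := (hV.bLip i).affine a b
  l2 := by
    obtain ⟨M, hM⟩ := hV.l2
    have := hA.isFiniteMeasure
    refine ⟨2 * a ^ 2 * M + 2 * b ^ 2 * (volume U).toReal, fun i => ?_⟩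
    have i1 := (hV.bLip i).integrable_sq (μ := volume.restrict U)
    calc ∫ x in U, (a * V i x + b) ^ 2 ≤ ∫ x in U, (2 * a ^ 2 * V i x ^ 2 + 2 * b ^ 2) := by
          refine integral_mono (((hV.bLip i).affine a b).integrable_sq)
            ((i1.const_mul _).add (integrable_const _)) fun x => ?_
          nlinarith [sq_nonneg (a * V i x - b)]
      _ = 2 * a ^ 2 * (∫ x in U, V i x ^ 2) + 2 * b ^ 2 * (volume U).toReal := by
          rw [integral_add (i1.const_mul _) (integrable_const _), integral_const_mul]
          simp [Measure.real, mul_comm]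
      _ ≤ _ := by have := hM i; gcongr
  energy := by
    obtain ⟨M, hM⟩ := hV.energy
    refine ⟨a ^ 2 * M, fun i => ?_⟩
    simp only [gradient_const_mul_add, quad_smul, integral_const_mul]
    have := hM i
    gcongr
  test := by
    obtain ⟨ε, h0, h1, h2⟩ := hV.test
    refine ⟨fun i => |a| * ε i, fun i => mul_nonneg (abs_nonneg _) (h0 _),
      by simpa using h1.const_mul |a|, fun i g hg => ?_⟩
    simp only [gradient_const_mul_add, bil_smul_right, integral_const_mul, abs_mul, mul_assoc]
    have := h2 i g hg
    gcongr

end IsApprox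

/-! ### Compositions with convex functions -/

/-- `h` is a nondecreasing convex function on the interval `I`, with derivatives `h1` and `h2`,
subject to the bounds that make `h₊ h1` an admissible test function. -/
structure ConvexData (I : Set ℝ) (h h1 h2 : ℝ → ℝ) (L : ℝ≥0) : Prop where
  convex : Convex ℝ I
  d1 : ∀ t ∈ I, HasDerivAt h (h1 t) t
  d2 : ∀ t ∈ I, HasDerivAt h1 (h2 t) t
  h1_nonneg : ∀ t ∈ I, 0 ≤ h1 t
  h1_le : ∀ t ∈ I, h1 t ≤ L
  h2_nonneg : ∀ t ∈ I, 0 ≤ h2 t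
  h2_le : ∀ t ∈ I, h2 t ≤ L
  mul_le : ∀ t ∈ I, max (h t) 0 * h2 t ≤ L
  growth : ∀ t ∈ I, max (h t) 0 ≤ L * (1 + |t|)

/-- A sequence of nonnegative bounded Lipschitz functions whose truncations satisfy the
Caccioppoli inequality in `U` up to errors that tend to `0`. -/
structure IsSubSeq {n : ℕ} (A : E n → Matrix (Fin n) (Fin n) ℝ) (U : Set (E n))
    (f : ℕ → E n → ℝ) : Prop where
  bLip : ∀ i, BLip (f i)
  nonneg : ∀ i x, 0 ≤ f i x
  caccioppoli : ∀ c : ℝ, 0 ≤ c → ∀ ψ ∈ LipC U, ∃ e : ℕ → ℝ, Tendsto e atTop (𝓝 0) ∧ (∀ i, 0 ≤ e i) ∧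
    ∀ i, ∫ x in U, ψ x ^ 2 * quad (A x) (gradient (fun y => max (f i y - c) 0) x)
      ≤ 4 * (∫ x in U, max (f i x - c) 0 ^ 2 * quad (A x) (gradient ψ x)) + e i

section

variable {n : ℕ} {U : Set (E n)} {A : E n → Matrix (Fin n) (Fin n) ℝ} {V : ℕ → E n → ℝ}

lemma Convex.lipschitzOnWith_of_hasDerivAt {I : Set ℝ} {h h1 : ℝ → ℝ} {L : ℝ≥0}
    (hI : Convex ℝ I) (hd : ∀ t ∈ I, HasDerivAt h (h1 t) t) (h0 : ∀ t ∈ I, 0 ≤ h1 t)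
    (hL : ∀ t ∈ I, h1 t ≤ L) : LipschitzOnWith L h I := by
  refine hI.lipschitzOnWith_of_nnnorm_hasDerivWithin_le (fun t ht => (hd t ht).hasDerivWithinAt)
    fun t ht => ?_
  rw [← NNReal.coe_le_coe, coe_nnnorm, Real.norm_of_nonneg (h0 t ht)]
  exact hL t ht

lemma restrict_absolutelyContinuous (U : Set (E n)) : volume.restrict U ≪ (volume : Measure (E n)) :=
  Measure.absolutelyContinuous_of_le Measure.restrict_le_self

/-- Test with ψ²Wh'(V_i), where W = (h(V_i) - c)₊. Since W and h'' are nonnegative,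
⟨∇(Wh'(V_i)),∇V_i⟩ ≥ |∇W|² in the form of `A`, and Wh'(V_i)∇V_i = W∇W, so the energy estimate
applies with Z = W. The field `mul_le` controls the gradient of the test function and `growth` its
mean square. -/
lemma IsApprox.isSubSeq (hA : GoodCoef U A) (hV : IsApprox A U V) {I : Set ℝ} {h h1 h2 : ℝ → ℝ}
    {L : ℝ≥0} (hc : ConvexData I h h1 h2 L) (hI : ∀ i x, V i x ∈ I) :
    IsSubSeq A U (fun i x => max (h (V i x)) 0) := by
  have lh := Convex.lipschitzOnWith_of_hasDerivAt hc.convex hc.d1 hc.h1_nonneg hc.h1_le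
  have lh1 := Convex.lipschitzOnWith_of_hasDerivAt hc.convex hc.d2 hc.h2_nonneg hc.h2_le
  have bh : ∀ i, BLip (fun x => h (V i x)) := fun i => (hV.bLip i).comp (hI i) lh
  have bh1 : ∀ i, BLip (fun x => h1 (V i x)) := fun i => (hV.bLip i).comp (hI i) lh1
  refine ⟨fun i => (bh i).max_zero, fun i x => le_max_right _ _, fun c hc0 ψ hψ => ?_⟩
  have hmax : ∀ i x, max (max (h (V i x)) 0 - c) 0 = max (h (V i x) - c) 0 := by
    intro i x
    rcases le_total (h (V i x)) 0 with h0 | h0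
    · rw [max_eq_right h0, max_eq_right (by linarith), max_eq_right (by linarith)]
    · rw [max_eq_left h0]
  simp only [hmax]
  have := hA.isFiniteMeasure
  have hac := restrict_absolutelyContinuous U
  have bW : ∀ i, BLip (fun x => max (h (V i x) - c) 0) := fun i => ((bh i).sub_const c).max_zero
  have bH : ∀ i, BLip (fun x => max (h (V i x) - c) 0 * h1 (V i x)) := fun i => (bW i).mul (bh1 i)
  -- θ is the indicator of h(V_i) > c.
  have key : ∀ i, ∀ᵐ x ∂(volume.restrict U), ∃ θ : ℝ, (θ = 0 ∨ θ = 1) ∧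
      gradient (fun y => max (h (V i y) - c) 0) x = (θ * h1 (V i x)) • gradient (V i) x ∧
      θ * max (h (V i x) - c) 0 = max (h (V i x) - c) 0 ∧
      gradient (fun x => max (h (V i x) - c) 0 * h1 (V i x)) x
        = (max (h (V i x) - c) 0 * h2 (V i x) + h1 (V i x) * (θ * h1 (V i x))) •
          gradient (V i) x := by
    intro i
    filter_upwards [(hV.bLip i).ae_differentiableAt _ hac, (bW i).ae_differentiableAt _ hac,
      (bh1 i).ae_differentiableAt _ hac] with x e1 e2 e3
    have g1 := gradient_max_zero ((bh i).sub_const c).continuous x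
    rw [gradient_sub_const, gradient_comp (hc.d1 _ (hI i x)) e1] at g1
    have g2 := gradient_comp (hc.d2 _ (hI i x)) e1
    by_cases hp : 0 < h (V i x) - c
    · rw [if_pos hp] at g1
      refine ⟨1, Or.inr rfl, by rw [g1, one_mul], one_mul _, ?_⟩
      rw [gradient_mul e2 e3, g1, g2]; module
    · rw [if_neg hp] at g1
      have h0 := max_eq_right (not_lt.1 hp)
      refine ⟨0, Or.inl rfl, by simp [g1], by rw [h0, mul_zero], ?_⟩
      rw [gradient_mul e2 e3, g1, g2, h0]; module
  refine hV.energy_estimate hA (W := fun i x => max (h (V i x) - c) 0)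
    (H := fun i x => max (h (V i x) - c) 0 * h1 (V i x))
    (Z := fun i x => max (h (V i x) - c) 0) bW bH bW ?_ ?_ ?_ ?_ hψ
  · intro i
    filter_upwards [key i, hA.psd] with x ⟨θ, hθ, e1, e2, e3⟩ hp
    rw [e1, e3, quad_smul, bil_smul_left, bil_self]
    have q0 := quad_nonneg hp (gradient (V i) x)
    have : θ ^ 2 = θ := by rcases hθ with rfl | rfl <;> simp
    have w0 : 0 ≤ max (h (V i x) - c) 0 * h2 (V i x) :=
      mul_nonneg (le_max_right _ _) (hc.h2_nonneg _ (hI i x))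
    gcongr
    rw [mul_pow, this]; linarith
  · intro i
    filter_upwards [key i] with x ⟨θ, hθ, e1, e2, e3⟩
    rw [e1, smul_smul, ← mul_assoc, mul_comm _ θ, e2]
  · obtain ⟨M, hM⟩ := hV.l2
    refine ⟨(∫ x in U, (L : ℝ) ^ 4 * 2) + (L : ℝ) ^ 4 * 2 * M, fun i => ?_⟩
    have i1 := (hV.bLip i).integrable_sq (μ := volume.restrict U)
    have : ∫ x in U, (max (h (V i x) - c) 0 * h1 (V i x)) ^ 2
        ≤ ∫ x in U, ((L : ℝ) ^ 4 * 2 + (L : ℝ) ^ 4 * 2 * V i x ^ 2) := by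
      refine integral_mono (bH i).integrable_sq ((integrable_const _).add (i1.const_mul _))
        fun x => ?_
      have a1 := hc.growth _ (hI i x)
      have a2 : max (h (V i x) - c) 0 ≤ L * (1 + |V i x|) :=
        (max_le_max (by linarith) le_rfl).trans a1
      have a3 := hc.h1_le _ (hI i x)
      have a4 := hc.h1_nonneg _ (hI i x)
      have a5 : max (h (V i x) - c) 0 * h1 (V i x) ≤ L * (1 + |V i x|) * L := by gcongr
      have a6 : 0 ≤ max (h (V i x) - c) 0 * h1 (V i x) := mul_nonneg (le_max_right _ _) a4
      calc (max (h (V i x) - c) 0 * h1 (V i x)) ^ 2 ≤ (L * (1 + |V i x|) * L) ^ 2 := by gcongr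
        _ = (L : ℝ) ^ 4 * (1 + |V i x|) ^ 2 := by ring
        _ ≤ (L : ℝ) ^ 4 * (2 + 2 * V i x ^ 2) := by
          gcongr
          nlinarith [sq_nonneg (1 - |V i x|), sq_abs (V i x)]
        _ = _ := by ring
    refine this.trans ?_
    rw [integral_add (integrable_const _) (i1.const_mul _),
      integral_const_mul _ (fun x => V i x ^ 2)]
    have := hM i
    gcongr
  · refine ⟨((L : ℝ) + L * L) ^ 2, fun i => ?_⟩
    filter_upwards [key i, hA.psd] with x ⟨θ, hθ, e1, e2, e3⟩ hp
    rw [e3, quad_smul]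
    have q0 := quad_nonneg hp (gradient (V i) x)
    have a1 : max (h (V i x) - c) 0 * h2 (V i x) ≤ L :=
      (mul_le_mul_of_nonneg_right (max_le_max (by linarith) le_rfl)
        (hc.h2_nonneg _ (hI i x))).trans (hc.mul_le _ (hI i x))
    have a3 := hc.h1_le _ (hI i x)
    have a4 := hc.h1_nonneg _ (hI i x)
    have w0 : 0 ≤ max (h (V i x) - c) 0 * h2 (V i x) :=
      mul_nonneg (le_max_right _ _) (hc.h2_nonneg _ (hI i x))
    have t0 : 0 ≤ θ := by rcases hθ with rfl | rfl <;> simp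
    have t1 : θ ≤ 1 := by rcases hθ with rfl | rfl <;> simp
    have a5 : θ * h1 (V i x) ≤ L := by nlinarith
    gcongr

lemma convexData_id : ConvexData Set.univ (fun t => t) (fun _ => 1) (fun _ => 0) 1 where
  convex := convex_univ
  d1 t _ := hasDerivAt_id t
  d2 t _ := hasDerivAt_const t 1
  h1_nonneg _ _ := zero_le_one
  h1_le _ _ := by simp
  h2_nonneg _ _ := le_rfl
  h2_le _ _ := by simp
  mul_le _ _ := by simp
  growth t _ := by
    simp only [NNReal.coe_one, one_mul]
    exact max_le ((le_abs_self t).trans (by linarith)) (by positivity)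

/-- On t ≤ 1 the logarithm stays away from its pole because 1 + δ - t ≥ δ. The constant blows up
with δ, but it only enters error terms that vanish in the limit. -/
lemma convexData_log {δ : ℝ} (hδ : 0 < δ) : ∃ L : ℝ≥0,
    ConvexData (Set.Iic 1) (fun t => Real.log (1 + δ) - Real.log (1 + δ - t))
      (fun t => (1 + δ - t)⁻¹) (fun t => ((1 + δ - t)⁻¹) ^ 2) L := by
  have hlog : 0 ≤ Real.log (1 + δ) - Real.log δ :=
    sub_nonneg.2 (Real.log_le_log hδ (by linarith))
  set a := Real.log (1 + δ) - Real.log δ with ha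
  have hinv : ∀ t ∈ Set.Iic (1 : ℝ), (1 + δ - t)⁻¹ ≤ δ⁻¹ := fun t ht => by
    have : t ≤ 1 := ht
    gcongr; linarith
  have hpos : ∀ t ∈ Set.Iic (1 : ℝ), 0 < 1 + δ - t := fun t ht => by
    have : t ≤ 1 := ht
    linarith
  have hmax : ∀ t ∈ Set.Iic (1 : ℝ), max (Real.log (1 + δ) - Real.log (1 + δ - t)) 0 ≤ a :=
    fun t ht => max_le (by
      have : t ≤ 1 := ht
      rw [ha]
      gcongr
      linarith) hlog
  have hsq : ∀ t ∈ Set.Iic (1 : ℝ), ((1 + δ - t)⁻¹) ^ 2 ≤ δ⁻¹ ^ 2 := fun t ht => by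
    have := inv_pos.2 (hpos t ht)
    exact pow_le_pow_left₀ this.le (hinv t ht) 2
  have hδi : 0 < δ⁻¹ := inv_pos.2 hδ
  refine ⟨⟨δ⁻¹ + δ⁻¹ ^ 2 + a * δ⁻¹ ^ 2 + a, by positivity⟩, convex_Iic 1, fun t ht => ?_,
    fun t ht => ?_, fun t ht => (inv_pos.2 (hpos t ht)).le, fun t ht => ?_, fun t ht => by positivity,
    fun t ht => ?_, fun t ht => ?_, fun t ht => ?_⟩
  · have h1 : HasDerivAt (fun t => 1 + δ - t) (-1) t := by
      simpa using (hasDerivAt_id t).const_sub (1 + δ)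
    have := (h1.log (hpos t ht).ne').const_sub (Real.log (1 + δ))
    simpa [neg_div] using this
  · have h1 : HasDerivAt (fun t => 1 + δ - t) (-1) t := by
      simpa using (hasDerivAt_id t).const_sub (1 + δ)
    have := h1.fun_inv (hpos t ht).ne'
    simpa using this
  · have := hinv t ht
    change _ ≤ δ⁻¹ + δ⁻¹ ^ 2 + a * δ⁻¹ ^ 2 + a
    have : 0 ≤ a * δ⁻¹ ^ 2 := by positivity
    nlinarith
  · have := hsq t ht
    change _ ≤ δ⁻¹ + δ⁻¹ ^ 2 + a * δ⁻¹ ^ 2 + a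
    have : 0 ≤ a * δ⁻¹ ^ 2 := by positivity
    nlinarith
  · change _ ≤ δ⁻¹ + δ⁻¹ ^ 2 + a * δ⁻¹ ^ 2 + a
    have := mul_le_mul (hmax t ht) (hsq t ht) (by positivity) hlog
    nlinarith [sq_nonneg δ⁻¹]
  · change _ ≤ (δ⁻¹ + δ⁻¹ ^ 2 + a * δ⁻¹ ^ 2 + a) * (1 + |t|)
    have : 0 ≤ δ⁻¹ + δ⁻¹ ^ 2 + a * δ⁻¹ ^ 2 := by positivity
    have := hmax t ht
    have := abs_nonneg t
    nlinarith

/-- The energy estimate for `log (1 / (1 + δ - V_i))`. -/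
lemma IsApprox.log_energy (hA : GoodCoef U A) (hV : IsApprox A U V) (h1 : ∀ i x, V i x ≤ 1)
    {δ : ℝ} (hδ : 0 < δ) {ψ : E n → ℝ} (hψ : ψ ∈ LipC U) :
    ∃ e : ℕ → ℝ, Tendsto e atTop (𝓝 0) ∧ (∀ i, 0 ≤ e i) ∧
      ∀ i, ∫ x in U, ψ x ^ 2 * quad (A x)
          (gradient (fun y => max (Real.log (1 + δ) - Real.log (1 + δ - V i y)) 0) x)
        ≤ 4 * (∫ x in U, quad (A x) (gradient ψ x)) + e i := by
  obtain ⟨L, hc⟩ := convexData_log hδ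
  have lh := Convex.lipschitzOnWith_of_hasDerivAt hc.convex hc.d1 hc.h1_nonneg hc.h1_le
  have lh1 := Convex.lipschitzOnWith_of_hasDerivAt hc.convex hc.d2 hc.h2_nonneg hc.h2_le
  have bh := fun i => (hV.bLip i).comp (h1 i) lh
  have bh1 := fun i => (hV.bLip i).comp (h1 i) lh1
  have := hA.isFiniteMeasure
  have hac := restrict_absolutelyContinuous U
  have hd := fun i => (hV.bLip i).ae_differentiableAt _ hac
  -- The test function is ψ²h'(V_i). Because h'' = (h')², the energy condition is an equality, and
  -- h'(V_i)∇V_i = ∇h(V_i) permits Z = 1; this makes the bound independent of δ and of V_i.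
  obtain ⟨e, he, he0, hle⟩ := hV.energy_estimate hA bh bh1 (fun _ => BLip.const 1)
    (fun i => by
      filter_upwards [hd i] with x hx
      rw [gradient_comp (hc.d1 _ (h1 i x)) hx, gradient_comp (hc.d2 _ (h1 i x)) hx, quad_smul,
        bil_smul_left, bil_self])
    (fun i => by
      filter_upwards [hd i] with x hx
      rw [gradient_comp (hc.d1 _ (h1 i x)) hx, one_smul])
    (by
      refine ⟨∫ x in U, (L : ℝ) ^ 2, fun i => integral_mono (bh1 i).integrable_sq
        (integrable_const _) fun x => ?_⟩
      have := hc.h1_le _ (h1 i x)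
      have := hc.h1_nonneg _ (h1 i x)
      gcongr)
    (by
      refine ⟨(L : ℝ) ^ 2, fun i => ?_⟩
      filter_upwards [hd i, hA.psd] with x hx hp
      rw [gradient_comp (hc.d2 _ (h1 i x)) hx, quad_smul]
      have := quad_nonneg hp (gradient (V i) x)
      have := hc.h2_le _ (h1 i x)
      have := hc.h2_nonneg _ (h1 i x)
      gcongr) hψ
  refine ⟨e, he, he0, fun i => ?_⟩
  have := hle i
  simp only [one_pow, one_mul] at this
  refine le_trans (integral_mono_ae ?_ ?_ ?_) this
  · exact (LipC.bLip hψ).integrable_sq_mul (hA.integrable_quad_gradient (bh i).max_zero)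
  · exact (LipC.bLip hψ).integrable_sq_mul (hA.integrable_quad_gradient (bh i))
  · filter_upwards [hA.psd] with x hp
    rw [gradient_max_zero (bh i).continuous]
    split_ifs
    · exact le_rfl
    · rw [quad_zero, mul_zero]
      exact mul_nonneg (sq_nonneg _) (quad_nonneg hp _)

/-! ### Truncation from above -/

lemma IsApprox.mono (hA : GoodCoef U A) (hV : IsApprox A U V) {U' : Set (E n)}
    (h : U' ⊆ U) : IsApprox A U' V where
  bLip := hV.bLip
  l2 := by
    obtain ⟨M, hM⟩ := hV.l2
    have := hA.isFiniteMeasure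
    exact ⟨M, fun i => (setIntegral_mono_set (s := U') (t := U) (hV.bLip i).integrable_sq
      (Eventually.of_forall fun x => sq_nonneg _) (Eventually.of_forall h)).trans (hM i)⟩
  energy := by
    obtain ⟨M, hM⟩ := hV.energy
    exact ⟨M, fun i => (setIntegral_mono_set (hA.integrable_quad_gradient (hV.bLip i))
      (hA.psd.mono fun x hx => quad_nonneg hx _) (Eventually.of_forall h)).trans (hM i)⟩
  test := by
    obtain ⟨ε, h0, h1, h2⟩ := hV.test
    refine ⟨ε, h0, h1, fun i g hg => ?_⟩
    have hz : ∀ x ∈ U \ U', gradient g x = 0 := fun x hx =>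
      gradient_eq_zero_of_notMem_tsupport fun hx' => hx.2 (hg.2.2 hx')
    rw [← setIntegral_eq_of_subset_of_forall_sdiff_eq_zero hA.isOpen.measurableSet h
        (f := fun x => bil (A x) (gradient g x) (gradient (V i) x))
        (fun x hx => by rw [hz x hx, bil_zero_left]),
      ← setIntegral_eq_of_subset_of_forall_sdiff_eq_zero hA.isOpen.measurableSet h
        (f := fun x => quad (A x) (gradient g x)) (fun x hx => by rw [hz x hx, quad_zero])]
    exact h2 i g (LipC.mono h hg)

/-- As u ≤ 1, the excess (V_i - 1)₊ is at most |V_i - u| and tends to 0 in mean square. By the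
Caccioppoli inequality its energy tends to 0 where χ = 1, so subtracting it from V_i changes the
residual by a null sequence. -/
lemma IsApprox.min_one (hA : GoodCoef U A) (hV : IsApprox A U V) {u : E n → ℝ}
    (hu : ∀ᵐ x ∂(volume.restrict U), u x ≤ 1)
    (hVu : Tendsto (fun i => ∫⁻ x in U, ENNReal.ofReal ((V i x - u x) ^ 2)) atTop (𝓝 0))
    {U' : Set (E n)} (hU' : IsOpen U') (hUU' : U' ⊆ U) {χ : E n → ℝ} (hχ : χ ∈ LipC U)
    (hχ1 : ∀ x ∈ U', χ x = 1) : IsApprox A U' (fun i x => min (V i x) 1) := by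
  have hA' := hA.mono hU' hUU'
  have hV' := hV.mono hA hUU'
  have := hA.isFiniteMeasure
  have := hA'.isFiniteMeasure
  have hac := restrict_absolutelyContinuous U
  have hac' := restrict_absolutelyContinuous U'
  have bW : ∀ i, BLip (fun x => max (V i x - 1) 0) := fun i => ((hV.bLip i).sub_const 1).max_zero
  have hmin : ∀ i x, min (V i x) 1 = V i x - max (V i x - 1) 0 := by
    intro i x
    rcases le_total (V i x) 1 with h | h
    · rw [min_eq_left h, max_eq_right (by linarith), sub_zero]
    · rw [min_eq_right h, max_eq_left (by linarith)]; ring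
  have gW : ∀ i x, gradient (fun y => max (V i y - 1) 0) x = gradient (V i) x ∨
      gradient (fun y => max (V i y - 1) 0) x = 0 ∧ max (V i x - 1) 0 = 0 := by
    intro i x
    have := gradient_max_zero ((hV.bLip i).sub_const 1).continuous x
    rw [gradient_sub_const] at this
    rw [this]
    split_ifs with hp
    · exact Or.inl rfl
    · exact Or.inr ⟨rfl, max_eq_right (not_lt.1 hp)⟩
  have gmin : ∀ i, ∀ᵐ x ∂(volume.restrict U'), gradient (fun y => min (V i y) 1) x
      = gradient (V i) x - gradient (fun y => max (V i y - 1) 0) x := by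
    intro i
    filter_upwards [(hV.bLip i).ae_differentiableAt _ hac', (bW i).ae_differentiableAt _ hac']
      with x e1 e2
    simp only [hmin]
    exact gradient_sub e1 e2
  obtain ⟨M1, hM1⟩ := hV.l2
  obtain ⟨e, he, he0, hle⟩ := hV.energy_estimate hA bW bW bW
    (fun i => Eventually.of_forall fun x => by
      rcases gW i x with h | h
      · rw [h, bil_self]
      · rw [h.1, quad_zero, bil_zero_left])
    (fun i => Eventually.of_forall fun x => by
      rcases gW i x with h | h
      · rw [h]
      · rw [h.2, zero_smul, zero_smul])
    ⟨M1, fun i => le_trans (integral_mono (bW i).integrable_sq (hV.bLip i).integrable_sq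
      fun x => sq_le_sq.2 (by
        rw [abs_of_nonneg (le_max_right _ _)]
        exact max_le (by linarith [le_abs_self (V i x)]) (abs_nonneg _))) (hM1 i)⟩
    ⟨1, fun i => by
      filter_upwards [hA.psd] with x hp
      rcases gW i x with h | h
      · rw [h, one_mul]
      · rw [h.1, quad_zero, one_mul]; exact quad_nonneg hp _⟩ hχ
  obtain ⟨Q, hQ0, hQ⟩ := hA.quad_gradient_le (LipC.bLip hχ)
  have hL : Tendsto (fun i => ∫ x in U, max (V i x - 1) 0 ^ 2) atTop (𝓝 0) := by
    have h1 : ∀ i, ∫ x in U, max (V i x - 1) 0 ^ 2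
        = (∫⁻ x in U, ENNReal.ofReal (max (V i x - 1) 0 ^ 2)).toReal := fun i =>
      integral_eq_lintegral_of_nonneg_ae (Eventually.of_forall fun x => sq_nonneg _)
        (bW i).integrable_sq.aestronglyMeasurable
    simp only [h1]
    refine (ENNReal.tendsto_toReal ENNReal.zero_ne_top).comp
      (tendsto_of_tendsto_of_tendsto_of_le_of_le tendsto_const_nhds hVu (fun _ => zero_le)
        fun i => lintegral_mono_ae ?_)
    filter_upwards [hu] with x hx
    refine ENNReal.ofReal_le_ofReal (sq_le_sq.2 ?_)
    rw [abs_of_nonneg (le_max_right _ _)]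
    exact max_le (by linarith [le_abs_self (V i x - u x)]) (abs_nonneg _)
  set η : ℕ → ℝ := fun i => 4 * (Q * ∫ x in U, max (V i x - 1) 0 ^ 2) + e i with hη
  have hη0 : Tendsto η atTop (𝓝 0) := by simpa using ((hL.const_mul Q).const_mul 4).add he
  have hWη : ∀ i, ∫ x in U', quad (A x) (gradient (fun y => max (V i y - 1) 0) x) ≤ η i := by
    intro i
    have j1 := (LipC.bLip hχ).integrable_sq_mul (hA.integrable_quad_gradient (bW i))
    calc ∫ x in U', quad (A x) (gradient (fun y => max (V i y - 1) 0) x)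
        = ∫ x in U', χ x ^ 2 * quad (A x) (gradient (fun y => max (V i y - 1) 0) x) :=
          setIntegral_congr_fun hU'.measurableSet fun x hx => by simp [hχ1 x hx]
      _ ≤ ∫ x in U, χ x ^ 2 * quad (A x) (gradient (fun y => max (V i y - 1) 0) x) :=
          setIntegral_mono_set j1
            (hA.psd.mono fun x hx => mul_nonneg (sq_nonneg _) (quad_nonneg hx _))
            (Eventually.of_forall hUU')
      _ ≤ _ := hle i
      _ ≤ η i := by
          rw [hη]
          simp only
          gcongr
          rw [← integral_const_mul]
          refine integral_mono_ae ((bW i).integrable_sq_mul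
            (hA.integrable_quad_gradient (LipC.bLip hχ))) ((bW i).integrable_sq.const_mul _) ?_
          filter_upwards [hQ] with x hx
          rw [mul_comm Q]
          gcongr
  have bm : ∀ i, BLip (fun x => min (V i x) 1) := fun i => by
    refine (hV.bLip i).comp (h := fun t => min t 1) (I := Set.univ) (L := 1) (fun _ => trivial)
      ((LipschitzWith.id.min_const 1).lipschitzOnWith)
  refine ⟨bm, ?_, ?_, ?_⟩
  · obtain ⟨M, hM⟩ := (hV'.affine hA' 1 1).l2
    obtain ⟨M', hM'⟩ := hV'.l2
    refine ⟨M' + ∫ x in U', (1 : ℝ), fun i => ?_⟩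
    calc ∫ x in U', min (V i x) 1 ^ 2 ≤ ∫ x in U', (V i x ^ 2 + 1) := by
          refine integral_mono (bm i).integrable_sq
            ((hV.bLip i).integrable_sq.add (integrable_const _)) fun x => ?_
          rcases min_choice (V i x) 1 with h | h <;> rw [h] <;> nlinarith [sq_nonneg (V i x)]
      _ = (∫ x in U', V i x ^ 2) + ∫ x in U', (1 : ℝ) :=
          integral_add (hV.bLip i).integrable_sq (integrable_const _)
      _ ≤ _ := by gcongr; exact hM' i
  · obtain ⟨M, hM⟩ := hV'.energy
    refine ⟨M, fun i => (integral_mono_ae (hA'.integrable_quad_gradient (bm i))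
      (hA'.integrable_quad_gradient (hV.bLip i)) ?_).trans (hM i)⟩
    filter_upwards [gmin i, hA'.psd] with x e1 hp
    rw [e1]
    rcases gW i x with h | h
    · rw [h, sub_self, quad_zero]; exact quad_nonneg hp _
    · rw [h.1, sub_zero]
  · obtain ⟨ε, h0, h1, h2⟩ := hV'.test
    -- The summand 1/(i+1) supplies the strict inequality that `abs_integral_bil_le` requires.
    set t : ℕ → ℝ := fun i => Real.sqrt (η i) + 1 / ((i : ℝ) + 1) with ht
    have ht0 : ∀ i, Real.sqrt (η i) < t i := fun i => by
      have : 0 < 1 / ((i : ℝ) + 1) := by positivity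
      simp only [ht]; linarith
    refine ⟨fun i => ε i + t i, fun i => add_nonneg (h0 i) ((Real.sqrt_nonneg _).trans (ht0 i).le),
      ?_, fun i g hg => ?_⟩
    · have : Tendsto t atTop (𝓝 0) := by
        have := ((Real.continuous_sqrt.tendsto 0).comp hη0).add
          (tendsto_one_div_add_atTop_nhds_zero_nat (𝕜 := ℝ))
        rwa [Real.sqrt_zero, add_zero] at this
      simpa using h1.add this
    · have b1 := h2 i g hg
      have b2 := hA'.abs_integral_bil_le (hA'.integrable_quad_gradient (LipC.bLip hg))
        (hA'.integrable_quad_gradient (bW i)) (hWη i) (ht0 i)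
      have b3 : ∫ x in U', bil (A x) (gradient g x) (gradient (fun y => min (V i y) 1) x)
          = (∫ x in U', bil (A x) (gradient g x) (gradient (V i) x))
            - ∫ x in U', bil (A x) (gradient g x) (gradient (fun y => max (V i y - 1) 0) x) := by
        rw [← integral_sub (hA'.integrable_bil_gradient (LipC.bLip hg) (hV.bLip i))
          (hA'.integrable_bil_gradient (LipC.bLip hg) (bW i))]
        refine integral_congr_ae ?_
        filter_upwards [gmin i] with x e1
        rw [e1, bil_sub_right]
      rw [b3, add_mul]
      exact (abs_sub _ _).trans (add_le_add b1 b2)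

end

/-! ### Approximation of weak solutions -/

section

variable {n : ℕ} {Ω : Set (E n)} {w : E n → ℝ} {A : E n → Matrix (Fin n) (Fin n) ℝ}

lemma IsCoefficient.goodCoef (hA : IsCoefficient Ω w A) (hΩo : IsOpen Ω)
    (hΩb : Bornology.IsBounded Ω) : GoodCoef Ω A where
  isOpen := hΩo
  finite := hΩb.measure_lt_top
  meas := hA.measurable
  bdd := by
    obtain ⟨M, hM⟩ := hA.bounded
    refine ⟨max M 0, le_max_right _ _, ?_⟩
    have := ae_all_iff.2 fun i => ae_all_iff.2 fun j => hM i j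
    filter_upwards [this] with x hx i j
    exact (hx i j).trans (le_max_left _ _)
  psd := hA.posSemidef

lemma LipC.max_zero {U : Set (E n)} {g : E n → ℝ} (hg : g ∈ LipC U) :
    (fun x => max (g x) 0) ∈ LipC U := by
  refine ⟨(LipC.bLip hg).max_zero.1, hg.2.1.comp_left (g := fun t => max t 0) (by simp),
    (closure_mono ?_).trans hg.2.2⟩
  intro x hx h0
  exact hx (by simp [h0])

lemma LipC.neg {U : Set (E n)} {g : E n → ℝ} (hg : g ∈ LipC U) : (fun x => -g x) ∈ LipC U := by
  have := LipC.mul_bLip hg (BLip.const (-1))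
  simpa using this

lemma lintegral_sq_le {μ : Measure (E n)} {f g : E n → ℝ} (hf : AEMeasurable f μ)
    (hg : AEMeasurable g μ) :
    ∫⁻ x, ENNReal.ofReal (f x ^ 2) ∂μ ≤ 2 * (∫⁻ x, ENNReal.ofReal ((f x - g x) ^ 2) ∂μ)
      + 2 * ∫⁻ x, ENNReal.ofReal (g x ^ 2) ∂μ := by
  have h2 : (2 : ℝ≥0∞) = ENNReal.ofReal 2 := by simp
  have m1 : AEMeasurable (fun x => ENNReal.ofReal ((f x - g x) ^ 2)) μ :=
    ((hf.sub hg).pow_const 2).ennreal_ofReal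
  have m2 : AEMeasurable (fun x => ENNReal.ofReal (g x ^ 2)) μ := (hg.pow_const 2).ennreal_ofReal
  rw [← lintegral_const_mul'' _ m1, ← lintegral_const_mul'' _ m2,
    ← lintegral_add_right' _ (m2.const_mul 2)]
  refine lintegral_mono fun x => ?_
  rw [h2, ← ENNReal.ofReal_mul (by norm_num), ← ENNReal.ofReal_mul (by norm_num),
    ← ENNReal.ofReal_add (by positivity) (by positivity)]
  refine ENNReal.ofReal_le_ofReal ?_
  nlinarith [sq_nonneg (f x - 2 * g x)]

lemma lintegral_quad_le {μ : Measure (E n)} (hA : ∀ i j, AEMeasurable (fun x => A x i j) μ)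
    (hp : ∀ᵐ x ∂μ, (A x).PosSemidef) {ξ ζ : E n → E n} (hξ : AEStronglyMeasurable ξ μ)
    (hζ : AEStronglyMeasurable ζ μ) :
    ∫⁻ x, ENNReal.ofReal (quad (A x) (ξ x)) ∂μ
      ≤ 2 * (∫⁻ x, ENNReal.ofReal (quad (A x) (ξ x - ζ x)) ∂μ)
        + 2 * ∫⁻ x, ENNReal.ofReal (quad (A x) (ζ x)) ∂μ := by
  have h2 : (2 : ℝ≥0∞) = ENNReal.ofReal 2 := by simp
  have m1 := (aestronglyMeasurable_bil hA (hξ.sub hζ) (hξ.sub hζ)).aemeasurable.ennreal_ofReal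
  have m2 := (aestronglyMeasurable_bil hA hζ hζ).aemeasurable.ennreal_ofReal
  simp only [bil_self, Pi.sub_apply] at m1 m2
  rw [← lintegral_const_mul'' _ m1, ← lintegral_const_mul'' _ m2,
    ← lintegral_add_right' _ (m2.const_mul 2)]
  refine lintegral_mono_ae ?_
  filter_upwards [hp] with x hx
  have q1 := quad_nonneg hx (ξ x - ζ x)
  have q2 := quad_nonneg hx (ζ x)
  have h3 : ∀ a : ℝ, 2 * ENNReal.ofReal a = ENNReal.ofReal (2 * a) := fun a => by
    rw [ENNReal.ofReal_mul (by norm_num), h2]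
  rw [h3, h3, ← ENNReal.ofReal_add (by positivity) (by positivity)]
  refine ENNReal.ofReal_le_ofReal ?_
  have := quad_add_le hx (ξ x - ζ x) (ζ x)
  simpa using this

lemma LipC.memW0 (hA : GoodCoef Ω A) {g : E n → ℝ} (hg : g ∈ LipC Ω) :
    MemW0 Ω A g (gradient g) := by
  have b := LipC.bLip hg
  have := hA.isFiniteMeasure
  refine ⟨b.continuous.aestronglyMeasurable, (measurable_gradient g).aestronglyMeasurable,
    fun _ => g, fun _ => ⟨hg, ?_⟩, ?_⟩
  · exact (b.integrable_sq.add (hA.integrable_quad_gradient b)).lintegral_lt_top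
  · simp [sobolevNormSq, quad_zero]

/-- The equation holds for Lipschitz test functions of any sign. -/
lemma integral_bil_eq_zero (hA : GoodCoef Ω A) {p : E n → E n}
    (htest : ∀ (g : E n → ℝ) (q : E n → E n), MemW0 Ω A g q →
      (∀ᵐ x ∂(volume.restrict Ω), 0 ≤ g x) → -∫ x in Ω, inner ℝ (q x) (act (A x) (p x)) = 0)
    {U : Set (E n)} (hU : IsOpen U) (hUΩ : U ⊆ Ω)
    (hpm : AEStronglyMeasurable p (volume.restrict U))
    (hp : Integrable (fun x => quad (A x) (p x)) (volume.restrict U))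
    {g : E n → ℝ} (hg : g ∈ LipC U) :
    Integrable (fun x => bil (A x) (gradient g x) (p x)) (volume.restrict U) ∧
      ∫ x in U, bil (A x) (gradient g x) (p x) = 0 := by
  have hA' := hA.mono hU hUΩ
  have hint : ∀ f ∈ LipC U,
      Integrable (fun x => bil (A x) (gradient f x) (p x)) (volume.restrict U) := by
    intro f hf
    refine Integrable.mono' ((hA'.integrable_quad_gradient (LipC.bLip hf)).add hp)
      (aestronglyMeasurable_bil hA'.meas (measurable_gradient f).aestronglyMeasurable hpm) ?_
    filter_upwards [hA'.psd] with x hx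
    have h1 := two_mul_abs_bil_le hx (gradient f x) (p x) one_pos
    have h2 := quad_nonneg hx (gradient f x)
    have h3 := quad_nonneg hx (p x)
    simp only [inv_one, one_mul] at h1
    simp only [Pi.add_apply, Real.norm_eq_abs]
    linarith [abs_nonneg (bil (A x) (gradient f x) (p x))]
  have hpos : ∀ f ∈ LipC U, (∀ x, 0 ≤ f x) → ∫ x in U, bil (A x) (gradient f x) (p x) = 0 := by
    intro f hf h0
    have := htest f (gradient f) (LipC.memW0 hA (LipC.mono hUΩ hf)) (Eventually.of_forall h0)
    rw [neg_eq_zero] at this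
    rw [← this]
    refine (setIntegral_eq_of_subset_of_forall_sdiff_eq_zero hA.isOpen.measurableSet hUΩ
      fun x hx => ?_).symm
    rw [gradient_eq_zero_of_notMem_tsupport fun hx' => hx.2 (hf.2.2 hx'), bil_zero_left]
  refine ⟨hint g hg, ?_⟩
  -- The equation is assumed only for nonnegative test functions; splitting `g` into positive and
  -- negative parts, both Lipschitz with compact support, removes the sign.
  have h1 := LipC.max_zero hg
  have h2 := LipC.max_zero (LipC.neg hg)
  have hac := restrict_absolutelyContinuous U
  calc ∫ x in U, bil (A x) (gradient g x) (p x)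
      = ∫ x in U, (bil (A x) (gradient (fun x => max (g x) 0) x) (p x)
          - bil (A x) (gradient (fun x => max (-g x) 0) x) (p x)) := by
        refine integral_congr_ae ?_
        filter_upwards [(LipC.bLip h1).ae_differentiableAt _ hac,
          (LipC.bLip h2).ae_differentiableAt _ hac] with x e1 e2
        have e3 : g = fun x => max (g x) 0 - max (-g x) 0 := by
          funext y
          rcases le_total (g y) 0 with h | h
          · rw [max_eq_right h, max_eq_left (by linarith)]; ring
          · rw [max_eq_left h, max_eq_right (by linarith)]; ring
        rw [← bil_sub_left, ← gradient_sub e1 e2, ← e3]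
    _ = 0 := by
        rw [integral_sub (hint _ h1) (hint _ h2), hpos _ h1 fun x => le_max_right _ _,
          hpos _ h2 fun x => le_max_right _ _, sub_zero]

/-- A weak solution is, on a set where a cutoff function equals `1`, the limit of a sequence of
Lipschitz approximate solutions. -/
lemma IsWeakSolution.exists_isApprox (hA : GoodCoef Ω A) {u : E n → ℝ}
    (hu : IsWeakSolution Ω A u) {U : Set (E n)} (hU : IsOpen U) {χ : E n → ℝ} (hχ : χ ∈ LipC Ω)
    (hUΩ : U ⊆ Ω) (hχ1 : ∀ x ∈ U, χ x = 1) :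
    ∃ V : ℕ → E n → ℝ, IsApprox A U V ∧
      Tendsto (fun i => ∫⁻ x in U, ENNReal.ofReal ((V i x - u x) ^ 2)) atTop (𝓝 0) ∧
      ∀ᵐ x ∂(volume.restrict U), Tendsto (fun i => V i x) atTop (𝓝 (u x)) := by
  obtain ⟨p, ⟨hum, hpm, v, hv, hlim⟩, htest⟩ := hu
  have hA' := hA.mono hU hUΩ
  have := hA'.isFiniteMeasure
  have hle : volume.restrict U ≤ volume.restrict Ω := Measure.restrict_mono hUΩ le_rfl
  replace hum := hum.mono_measure hle
  replace hpm := hpm.mono_measure hle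
  -- Errors below 2^(-i) are summable, which gives convergence almost everywhere of the selected
  -- sequence itself.
  obtain ⟨σ, hσ, hσF⟩ := extraction_forall_of_eventually' (P := fun i k =>
    sobolevNormSq Ω A (fun x => v k x - u x) (fun x => gradient (v k) x - p x)
      < ENNReal.ofReal ((1 / 2) ^ i)) fun i => by
    have := hlim.eventually_lt_const (show (0 : ℝ≥0∞) < ENNReal.ofReal ((1 / 2) ^ i) by
      rw [ENNReal.ofReal_pos]; positivity)
    exact eventually_atTop.1 this
  -- The cutoff makes locally Lipschitz functions on Ω globally Lipschitz without changing them, or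
  -- their gradients, on `U`.
  set V : ℕ → E n → ℝ := fun i x => χ x * v (σ i) x with hVdef
  have hVL : ∀ i, V i ∈ LipC Ω := fun i => LipC.mul hχ (hv (σ i)).1
  have hVb : ∀ i, BLip (V i) := fun i => LipC.bLip (hVL i)
  have hVU : ∀ i, ∀ x ∈ U, V i x = v (σ i) x := fun i x hx => by simp [hVdef, hχ1 x hx]
  have hgU : ∀ i, ∀ x ∈ U, gradient (V i) x = gradient (v (σ i)) x := fun i x hx =>
    Filter.EventuallyEq.gradient_eq (by
      filter_upwards [hU.mem_nhds hx] with y hy using hVU i y hy)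
  have hS : ∀ i, ∫⁻ x in U, ENNReal.ofReal ((V i x - u x) ^ 2 +
      quad (A x) (gradient (V i) x - p x)) ≤ ENNReal.ofReal ((1 / 2) ^ i) := by
    intro i
    refine le_trans ?_ (hσF i).le
    refine le_trans (le_of_eq ?_) (lintegral_mono' hle le_rfl)
    exact setLIntegral_congr_fun hU.measurableSet fun x hx => by
      simp only [hVU i x hx, hgU i x hx]
  have hS1 : ∀ i, ∫⁻ x in U, ENNReal.ofReal ((V i x - u x) ^ 2) ≤ ENNReal.ofReal ((1 / 2) ^ i) := by
    refine fun i => le_trans (lintegral_mono_ae ?_) (hS i)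
    filter_upwards [hA'.psd] with x hx
    exact ENNReal.ofReal_le_ofReal (by linarith [quad_nonneg hx (gradient (V i) x - p x)])
  have hS2 : ∀ i, ∫⁻ x in U, ENNReal.ofReal (quad (A x) (gradient (V i) x - p x))
      ≤ ENNReal.ofReal ((1 / 2) ^ i) := by
    refine fun i => le_trans (lintegral_mono fun x => ?_) (hS i)
    exact ENNReal.ofReal_le_ofReal (by linarith [sq_nonneg (V i x - u x)])
  have hmV : ∀ i, AEMeasurable (V i) (volume.restrict U) := fun i =>
    (hVb i).continuous.aemeasurable
  have hgm : ∀ i, AEStronglyMeasurable (gradient (V i)) (volume.restrict U) := fun i =>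
    (measurable_gradient _).aestronglyMeasurable
  have hone : ∀ i, ENNReal.ofReal ((1 / 2) ^ i) ≤ 1 := fun i => by
    rw [ENNReal.ofReal_le_one]; exact pow_le_one₀ (by norm_num) (by norm_num)
  have hpow : Tendsto (fun i : ℕ => ENNReal.ofReal ((1 / 2) ^ i)) atTop (𝓝 0) := by
    have := ENNReal.tendsto_ofReal
      (tendsto_pow_atTop_nhds_zero_of_lt_one (r := (1 / 2 : ℝ)) (by norm_num) (by norm_num))
    simpa using this
  have hu2 : ∫⁻ x in U, ENNReal.ofReal (u x ^ 2) < ∞ := by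
    refine (lintegral_sq_le hum.aemeasurable (hmV 0)).trans_lt (ENNReal.add_lt_top.2 ⟨?_, ?_⟩)
    · refine ENNReal.mul_lt_top (by simp) ?_
      simp only [sub_sq_comm (u _)]
      exact ((hS1 0).trans (hone 0)).trans_lt ENNReal.one_lt_top
    · exact ENNReal.mul_lt_top (by simp) (hVb 0).integrable_sq.lintegral_lt_top
  have hp2 : ∫⁻ x in U, ENNReal.ofReal (quad (A x) (p x)) < ∞ := by
    refine (lintegral_quad_le hA'.meas hA'.psd hpm (hgm 0)).trans_lt
      (ENNReal.add_lt_top.2 ⟨?_, ?_⟩)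
    · refine ENNReal.mul_lt_top (by simp) ?_
      have : ∀ x, quad (A x) (p x - gradient (V 0) x) = quad (A x) (gradient (V 0) x - p x) := by
        intro x
        rw [← neg_sub, ← neg_one_smul ℝ, quad_smul]; norm_num
      simp only [this]
      exact ((hS2 0).trans (hone 0)).trans_lt ENNReal.one_lt_top
    · exact ENNReal.mul_lt_top (by simp) (hA'.integrable_quad_gradient (hVb 0)).lintegral_lt_top
  have hquadI : ∀ {ξ : E n → E n}, AEStronglyMeasurable ξ (volume.restrict U) →
      ∫⁻ x in U, ENNReal.ofReal (quad (A x) (ξ x)) < ∞ →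
      Integrable (fun x => quad (A x) (ξ x)) (volume.restrict U) := by
    intro ξ hξ hfin
    exact ⟨aestronglyMeasurable_bil hA'.meas hξ hξ,
      (hasFiniteIntegral_iff_ofReal (hA'.psd.mono fun x hx => quad_nonneg hx _)).2 hfin⟩
  refine ⟨V, ⟨hVb, ?_, ?_, ?_⟩, ?_, ?_⟩
  · refine ⟨(2 + 2 * ∫⁻ x in U, ENNReal.ofReal (u x ^ 2)).toReal, fun i => ?_⟩
    rw [integral_eq_lintegral_of_nonneg_ae (Eventually.of_forall fun x => sq_nonneg _)
      (hVb i).integrable_sq.aestronglyMeasurable]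
    refine ENNReal.toReal_mono (ENNReal.add_lt_top.2
      ⟨by simp, ENNReal.mul_lt_top (by simp) hu2⟩).ne ?_
    refine (lintegral_sq_le (hmV i) hum.aemeasurable).trans ?_
    gcongr
    calc 2 * ∫⁻ x in U, ENNReal.ofReal ((V i x - u x) ^ 2) ≤ 2 * 1 := by
          gcongr; exact (hS1 i).trans (hone i)
      _ = 2 := mul_one 2
  · refine ⟨(2 + 2 * ∫⁻ x in U, ENNReal.ofReal (quad (A x) (p x))).toReal, fun i => ?_⟩
    rw [integral_eq_lintegral_of_nonneg_ae (hA'.psd.mono fun x hx => quad_nonneg hx _)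
      (hA'.integrable_quad_gradient (hVb i)).aestronglyMeasurable]
    refine ENNReal.toReal_mono (ENNReal.add_lt_top.2
      ⟨by simp, ENNReal.mul_lt_top (by simp) hp2⟩).ne ?_
    refine (lintegral_quad_le hA'.meas hA'.psd (hgm i) hpm).trans ?_
    gcongr
    calc 2 * ∫⁻ x in U, ENNReal.ofReal (quad (A x) (gradient (V i) x - p x)) ≤ 2 * 1 := by
          gcongr; exact (hS2 i).trans (hone i)
      _ = 2 := mul_one 2
  · set t : ℕ → ℝ := fun i => Real.sqrt ((1 / 2) ^ i) + 1 / ((i : ℝ) + 1) with ht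
    have ht0 : ∀ i, Real.sqrt ((1 / 2) ^ i) < t i := fun i => by
      have : 0 < 1 / ((i : ℝ) + 1) := by positivity
      simp only [ht]; linarith
    refine ⟨t, fun i => (Real.sqrt_nonneg _).trans (ht0 i).le, ?_, fun i g hg => ?_⟩
    · have := ((Real.continuous_sqrt.tendsto 0).comp
        (tendsto_pow_atTop_nhds_zero_of_lt_one (r := (1 / 2 : ℝ)) (by norm_num)
          (by norm_num))).add (tendsto_one_div_add_atTop_nhds_zero_nat (𝕜 := ℝ))
      rwa [Real.sqrt_zero, add_zero] at this
    · obtain ⟨j1, j2⟩ := integral_bil_eq_zero hA htest hU hUΩ hpm (hquadI hpm hp2) hg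
      have hqi := hquadI ((hgm i).sub hpm)
        (((hS2 i).trans (hone i)).trans_lt ENNReal.one_lt_top)
      -- Since `p` satisfies the equation exactly, only ∇V_i - p contributes to the residual, and
      -- its energy is at most 2^(-i).
      have e : ∫ x in U, bil (A x) (gradient g x) (gradient (V i) x)
          = ∫ x in U, bil (A x) (gradient g x) ((gradient (V i) - p) x) := by
        simp only [Pi.sub_apply, bil_sub_right]
        rw [integral_sub (hA'.integrable_bil_gradient (LipC.bLip hg) (hVb i)) j1, j2, sub_zero]
      rw [e]
      refine hA'.abs_integral_bil_le (hA'.integrable_quad_gradient (LipC.bLip hg)) hqi ?_ (ht0 i)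
      rw [integral_eq_lintegral_of_nonneg_ae (hA'.psd.mono fun x hx => quad_nonneg hx _)
        hqi.aestronglyMeasurable]
      refine ENNReal.toReal_le_of_le_ofReal (by positivity) (hS2 i)
  · exact tendsto_of_tendsto_of_tendsto_of_le_of_le tendsto_const_nhds hpow (fun _ => zero_le) hS1
  · have hmd : ∀ i, AEMeasurable (fun x => ENNReal.ofReal ((V i x - u x) ^ 2))
        (volume.restrict U) := fun i => (((hmV i).sub hum.aemeasurable).pow_const 2).ennreal_ofReal
    have hsum : ∫⁻ x in U, ∑' i, ENNReal.ofReal ((V i x - u x) ^ 2) ≠ ∞ := by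
      rw [lintegral_tsum hmd]
      refine ((ENNReal.tsum_le_tsum hS1).trans_lt ?_).ne
      rw [← ENNReal.ofReal_tsum_of_nonneg (fun i => by positivity)
        (summable_geometric_of_lt_one (by norm_num) (by norm_num))]
      exact ENNReal.ofReal_lt_top
    filter_upwards [ae_lt_top' (AEMeasurable.tsum hmd) hsum] with x hx
    have h1 := ENNReal.tendsto_atTop_zero_of_tsum_ne_top hx.ne
    have h2 := (ENNReal.tendsto_toReal ENNReal.zero_ne_top).comp h1
    have h3 : Tendsto (fun i => Real.sqrt ((V i x - u x) ^ 2)) atTop (𝓝 0) := by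
      have := (Real.continuous_sqrt.tendsto 0).comp h2
      rw [Real.sqrt_zero] at this
      refine this.congr fun i => ?_
      simp [ENNReal.toReal_ofReal (sq_nonneg _)]
    simp only [Real.sqrt_sq_eq_abs] at h3
    have h4 := (tendsto_zero_iff_abs_tendsto_zero _).2 h3
    simpa using h4.add_const (u x)

end

/-! ### Iterated exponentials and logarithms -/

section Iterates

lemma iterate_exp_mono (m : ℕ) : Monotone (Real.exp^[m]) := Real.exp_monotone.iterate m

lemma le_iterate_exp (m : ℕ) (a : ℝ) : a ≤ Real.exp^[m] a := by
  induction m with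
  | zero => exact le_rfl
  | succ m ih =>
    rw [Function.iterate_succ_apply']
    linarith [Real.add_one_le_exp (Real.exp^[m] a)]

/-- Each logarithm removes one exponential. The arguments stay above values of `exp`, so the default
values of `Real.log` never enter. -/
lemma iterate_exp_le_iterate_log {m : ℕ} {a y : ℝ} (hy : Real.exp^[m] a ≤ y) :
    ∀ i ≤ m, Real.exp^[m - i] a ≤ Real.log^[i] y := by
  intro i
  induction i with
  | zero => intro _; simpa using hy
  | succ i ih =>
    intro hi
    have h1 := ih (by omega)
    rw [show m - i = (m - (i + 1)) + 1 by omega, Function.iterate_succ_apply'] at h1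
    rw [Function.iterate_succ_apply']
    rw [Real.le_log_iff_exp_le ((Real.exp_pos _).trans_le h1)]
    exact h1

lemma le_iterate_log {m : ℕ} {a y : ℝ} (hy : Real.exp^[m] a ≤ y) {i : ℕ} (hi : i ≤ m) :
    a ≤ Real.log^[i] y :=
  (le_iterate_exp _ a).trans (iterate_exp_le_iterate_log hy i hi)

lemma iterate_log_mono {m : ℕ} {a y z : ℝ} (ha : 1 ≤ a) (hy : Real.exp^[m] a ≤ y) (hyz : y ≤ z) :
    ∀ i ≤ m, Real.log^[i] y ≤ Real.log^[i] z := by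
  intro i
  induction i with
  | zero => intro _; simpa using hyz
  | succ i ih =>
    intro hi
    rw [Function.iterate_succ_apply', Function.iterate_succ_apply']
    have := le_iterate_log hy (i := i) (by omega)
    exact Real.log_le_log (by linarith) (ih (by omega))

lemma iterate_log_le {m : ℕ} {a y : ℝ} (ha : 1 ≤ a) (hy : Real.exp^[m] a ≤ y) :
    ∀ i ≤ m, Real.log^[i] y ≤ y := by
  intro i
  induction i with
  | zero => intro _; simp
  | succ i ih =>
    intro hi
    rw [Function.iterate_succ_apply']
    have := le_iterate_log hy (i := i) (by omega)
    linarith [Real.log_le_sub_one_of_pos (x := Real.log^[i] y) (by linarith), ih (by omega)]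

lemma iterate_log_iterate_exp (m : ℕ) (a : ℝ) : Real.log^[m] (Real.exp^[m] a) = a :=
  (Function.LeftInverse.iterate Real.log_exp m) a

lemma tendsto_iterate_log (m : ℕ) : Tendsto (Real.log^[m]) atTop atTop := by
  induction m with
  | zero => exact tendsto_id
  | succ m ih =>
    rw [Function.iterate_succ']
    exact Real.tendsto_log_atTop.comp ih

lemma eventually_iterate_exp_iterate_log (m : ℕ) :
    ∀ᶠ s in atTop, Real.exp^[m] (Real.log^[m] s) = s := by
  induction m with
  | zero => simp
  | succ m ih =>
    filter_upwards [ih, (tendsto_iterate_log m).eventually_gt_atTop 0] with s hs h0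
    rw [Function.iterate_succ_apply' Real.log, Function.iterate_succ_apply, Real.exp_log h0, hs]

/-- One step is e^(s/8) ≤ e^s/8 for s ≥ 4. It allows the innermost argument to be shrunk by a factor
while the whole tower shrinks at least as much. -/
lemma iterate_exp_div_eight {z : ℝ} (hz : 4 ≤ z) (m : ℕ) :
    Real.exp^[m] (z / 8) ≤ Real.exp^[m] z / 8 := by
  induction m with
  | zero => simp
  | succ m ih =>
    rw [Function.iterate_succ_apply', Function.iterate_succ_apply']
    set s := Real.exp^[m] z with hs
    have h4 : 4 ≤ s := hz.trans (le_iterate_exp m z)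
    have h8 : 8 ≤ Real.exp (7 * s / 8) := by
      have := Real.quadratic_le_exp_of_nonneg (x := 7 * s / 8) (by linarith)
      nlinarith
    calc Real.exp (Real.exp^[m] (z / 8)) ≤ Real.exp (s / 8) := Real.exp_le_exp.2 ih
      _ ≤ Real.exp (s / 8) * (Real.exp (7 * s / 8) / 8) :=
          le_mul_of_one_le_right (Real.exp_pos _).le (by linarith)
      _ = Real.exp s / 8 := by
          rw [← mul_div_assoc, ← Real.exp_add]; congr 2; ring

end Iterates

/-! ### The Young function and the cutoff growth -/

section Young

variable {k : ℕ} {N : ℝ}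

/-- The quotient `Φ_{k,N}(t) / t²`. -/
noncomputable def youngPsi (k : ℕ) (N : ℝ) (t : ℝ) : ℝ :=
  (∏ i ∈ Finset.Ico 1 k, (Real.log^[i] (max (t ^ 2) (expE k N))) ^ 2) *
    (Real.log^[k] (max (t ^ 2) (expE k N))) ^ (2 * N)

lemma youngPhi_eq (k : ℕ) (N t : ℝ) : youngPhi k N t = t ^ 2 * youngPsi k N t := by
  rw [youngPhi, youngPsi, mul_assoc]

lemma one_le_expE (hN : 1 < N) : 1 ≤ expE k N :=
  (by linarith : 1 ≤ 2 * N).trans (le_iterate_exp k _)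

lemma one_le_iterate_log (hN : 1 < N) {y : ℝ} (hy : expE k N ≤ y) {i : ℕ} (hi : i ≤ k) :
    1 ≤ Real.log^[i] y :=
  (by linarith : 1 ≤ 2 * N).trans (le_iterate_log hy hi)

lemma one_le_youngPsi (hN : 1 < N) (t : ℝ) : 1 ≤ youngPsi k N t := by
  have h : expE k N ≤ max (t ^ 2) (expE k N) := le_max_right _ _
  refine one_le_mul_of_one_le_of_one_le ?_
    (Real.one_le_rpow (one_le_iterate_log hN h le_rfl) (by linarith))
  exact Finset.prod_induction _ (fun t => 1 ≤ t) (fun a b => one_le_mul_of_one_le_of_one_le)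
    le_rfl fun i hi => one_le_pow₀ (one_le_iterate_log hN h (Finset.mem_Ico.1 hi).2.le)

lemma youngPsi_mono (hN : 1 < N) {s t : ℝ} (hs : 0 ≤ s) (hst : s ≤ t) :
    youngPsi k N s ≤ youngPsi k N t := by
  have h : expE k N ≤ max (s ^ 2) (expE k N) := le_max_right _ _
  have h2 : max (s ^ 2) (expE k N) ≤ max (t ^ 2) (expE k N) :=
    max_le_max (by gcongr) le_rfl
  have hm := iterate_log_mono (by linarith : 1 ≤ 2 * N) h h2
  have h1 : ∀ i ≤ k, 0 ≤ Real.log^[i] (max (s ^ 2) (expE k N)) := fun i hi =>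
    zero_le_one.trans (one_le_iterate_log hN h hi)
  have hb := h1 k le_rfl
  refine mul_le_mul (Finset.prod_le_prod (fun i _ => sq_nonneg _) fun i hi => ?_)
    (Real.rpow_le_rpow hb (hm k le_rfl) (by linarith)) (Real.rpow_nonneg hb _)
    (Finset.prod_nonneg fun i _ => sq_nonneg _)
  have hik : i ≤ k := (Finset.mem_Ico.1 hi).2.le
  exact pow_le_pow_left₀ (h1 i hik) (hm i hik) 2

/-- With t² = e^y every iterated logarithm loses one step, so the factors become exactly those of
`kappa`, squared, apart from the exponent of the last one. -/
lemma youngPsi_exp (hk : 1 ≤ k) {y : ℝ} (hy : expE k N ≤ y) :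
    youngPsi k N (Real.exp (y / 2)) = (∏ i ∈ Finset.range (k - 1), Real.log^[i] y) ^ 2 *
      (Real.log^[k - 1] y) ^ (2 * N) := by
  have h1 : Real.exp (y / 2) ^ 2 = Real.exp y := by
    rw [← Real.exp_nat_mul]; congr 1; push_cast; ring
  have h2 : max (Real.exp (y / 2) ^ 2) (expE k N) = Real.exp y := by
    rw [h1, max_eq_left]
    linarith [Real.add_one_le_exp y]
  rw [youngPsi, h2, Finset.prod_pow, Finset.prod_Ico_eq_prod_range]
  have h3 : ∀ i, Real.log^[1 + i] (Real.exp y) = Real.log^[i] y := fun i => by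
    rw [add_comm, Function.iterate_succ_apply, Real.log_exp]
  simp only [h3]
  congr 2
  have := h3 (k - 1)
  rwa [show 1 + (k - 1) = k by omega] at this

lemma kappa_nonneg (hk : 1 ≤ k) (hN : 1 < N) (j : ℕ) : 0 ≤ kappa k N j := by
  unfold kappa
  split_ifs with h
  · positivity
  · have h' : expE k N ≤ j := (not_le.1 h).le
    refine mul_nonneg (Finset.prod_nonneg fun i hi => ?_) (Real.rpow_nonneg ?_ _)
    · exact zero_le_one.trans (one_le_iterate_log hN h' (by have := Finset.mem_range.1 hi; omega))
    · exact zero_le_one.trans (one_le_iterate_log hN h' (by omega))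

/-- For j ≤ E the value j² is absorbed by the constant E⁴, the remaining factor being at least 1;
for j > E the iterated logarithms are monotone. -/
lemma kappa_sq_le (hk : 1 ≤ k) (hN : 1 < N) {y : ℝ} (hy : expE k N ≤ y) {j : ℕ} (hj : (j : ℝ) ≤ y) :
    kappa k N j ^ 2 ≤ expE k N ^ 4 * ((∏ i ∈ Finset.range (k - 1), Real.log^[i] y) ^ 2 *
      (Real.log^[k - 1] y) ^ (N + 1)) := by
  have hE := one_le_expE (k := k) hN
  have hE4 : 1 ≤ expE k N ^ 4 := one_le_pow₀ hE
  have hprod : ∀ {z}, expE k N ≤ z → 1 ≤ ∏ i ∈ Finset.range (k - 1), Real.log^[i] z := by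
    intro z hz
    refine Finset.prod_induction _ (fun t => 1 ≤ t) (fun a b => one_le_mul_of_one_le_of_one_le)
      le_rfl fun i hi => one_le_iterate_log hN hz (by have := Finset.mem_range.1 hi; omega)
  have hF : 1 ≤ (∏ i ∈ Finset.range (k - 1), Real.log^[i] y) ^ 2 *
      (Real.log^[k - 1] y) ^ (N + 1) :=
    one_le_mul_of_one_le_of_one_le (one_le_pow₀ (hprod hy))
      (Real.one_le_rpow (one_le_iterate_log hN hy (by omega)) (by linarith))
  unfold kappa
  split_ifs with h
  · calc ((j : ℝ) ^ 2) ^ 2 = (j : ℝ) ^ 4 := by ring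
      _ ≤ expE k N ^ 4 := by gcongr
      _ ≤ _ := le_mul_of_one_le_right (by positivity) hF
  · have h' : expE k N ≤ j := (not_le.1 h).le
    have hm := iterate_log_mono (by linarith : 1 ≤ 2 * N) h' hj
    have hl := zero_le_one.trans (one_le_iterate_log hN h' (i := k - 1) (by omega))
    refine le_trans ?_ (le_mul_of_one_le_left (zero_le_one.trans hF) hE4)
    rw [mul_pow]
    have e : ((Real.log^[k - 1] (j : ℝ)) ^ ((N + 1) / 2)) ^ 2 = (Real.log^[k - 1] (j : ℝ)) ^ (N + 1) := by
      rw [← Real.rpow_natCast, ← Real.rpow_mul hl]; congr 1; push_cast; ring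
    rw [e]
    refine mul_le_mul (pow_le_pow_left₀ (zero_le_one.trans (hprod h'))
      (Finset.prod_le_prod (fun i hi => ?_) fun i hi => ?_) 2)
      (Real.rpow_le_rpow hl (hm _ (by omega)) (by linarith)) (Real.rpow_nonneg hl _) (sq_nonneg _)
    · exact zero_le_one.trans (one_le_iterate_log hN h' (by have := Finset.mem_range.1 hi; omega))
    · exact hm i (by have := Finset.mem_range.1 hi; omega)

/-- The gain of the Young function dominates the loss caused by the cutoff functions. -/
lemma exists_kappa_sq_mul_le (hk : 1 ≤ k) (hN : 1 < N) : ∃ C : ℝ, 0 < C ∧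
    ∀ Q : ℝ, expE k N ≤ Q → ∀ j : ℕ,
      kappa k N j ^ 2 * (Real.exp (-(Q + j)) + 1 / youngPsi k N (Real.exp ((Q + j) / 2)))
        ≤ C / (Real.log^[k - 1] Q) ^ (N - 1) := by
  have hE := one_le_expE (k := k) hN
  set m := 2 * (k - 1) + ⌈2 * N⌉₊ with hm
  set C2 : ℝ := (m.factorial : ℝ) with hC2
  refine ⟨expE k N ^ 4 * (C2 + 1), by positivity, fun Q hQ j => ?_⟩
  set y := Q + j with hydef
  have hQy : Q ≤ y := by simp [hydef]
  have hy : expE k N ≤ y := hQ.trans hQy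
  have hjy : (j : ℝ) ≤ y := by rw [hydef]; linarith
  have hy1 : 1 ≤ y := hE.trans hy
  have hlog : ∀ i ≤ k, 1 ≤ Real.log^[i] y := fun i hi => one_le_iterate_log hN hy hi
  have hle := iterate_log_le (by linarith : 1 ≤ 2 * N) hy
  have hψ1 := one_le_youngPsi (k := k) hN (Real.exp (y / 2))
  have hψ := youngPsi_exp hk hy
  have hκ := kappa_sq_le hk hN hy hjy
  set ℓ := Real.log^[k - 1] y with hℓ
  set F := (∏ i ∈ Finset.range (k - 1), Real.log^[i] y) ^ 2 with hFdef
  have hℓ1 : 1 ≤ ℓ := hlog _ (by omega)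
  have hq1 : 1 ≤ Real.log^[k - 1] Q := one_le_iterate_log hN hQ (by omega)
  have hqℓ : Real.log^[k - 1] Q ≤ ℓ :=
    iterate_log_mono (by linarith : 1 ≤ 2 * N) hQ hQy _ (by omega)
  set ψ := youngPsi k N (Real.exp (y / 2)) with hψdef
  have hψ0 : 0 < ψ := by linarith
  have hF0 : 0 ≤ F := sq_nonneg _
  -- Ψ(e^(y/2)) grows at most like y^m, so e^(-y) is bounded by m!/Ψ.
  have hexp : Real.exp (-y) ≤ C2 / ψ := by
    rw [Real.exp_neg, le_div_iff₀ hψ0, inv_mul_le_iff₀ (Real.exp_pos y)]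
    have h1 : ∏ i ∈ Finset.range (k - 1), Real.log^[i] y ≤ y ^ (k - 1) := by
      refine (Finset.prod_le_prod (g := fun _ => y) (fun i hi => ?_) fun i hi => ?_).trans_eq
        (by simp)
      · exact zero_le_one.trans (hlog i (by have := Finset.mem_range.1 hi; omega))
      · exact hle i (by have := Finset.mem_range.1 hi; omega)
    have h0 : 0 ≤ ∏ i ∈ Finset.range (k - 1), Real.log^[i] y :=
      Finset.prod_nonneg fun i hi =>
        zero_le_one.trans (hlog i (by have := Finset.mem_range.1 hi; omega))
    have h2 : ℓ ^ (2 * N) ≤ y ^ ⌈2 * N⌉₊ := by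
      calc ℓ ^ (2 * N) ≤ y ^ (2 * N) :=
            Real.rpow_le_rpow (by linarith) (hle _ (by omega)) (by linarith)
        _ ≤ y ^ ((⌈2 * N⌉₊ : ℕ) : ℝ) := Real.rpow_le_rpow_of_exponent_le hy1 (Nat.le_ceil _)
        _ = _ := Real.rpow_natCast _ _
    have h3 : ψ ≤ y ^ m := by
      rw [hψ, hm, pow_add, pow_mul']
      exact mul_le_mul (pow_le_pow_left₀ h0 h1 2) h2 (by positivity) (by positivity)
    have h4 := Real.pow_div_factorial_le_exp y (by linarith) m
    rw [div_le_iff₀ (by positivity)] at h4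
    linarith [h4]
  -- Of the 2N powers of the last logarithm in Ψ, κ² uses up N + 1; the remaining N - 1 are the
  -- gain.
  have hsplit : ℓ ^ (2 * N) = ℓ ^ (N + 1) * ℓ ^ (N - 1) := by
    rw [← Real.rpow_add (by linarith)]; congr 1; ring
  have hℓN : 0 < ℓ ^ (N - 1) := by positivity
  have hqN : 0 < (Real.log^[k - 1] Q) ^ (N - 1) := by positivity
  calc kappa k N j ^ 2 * (Real.exp (-y) + 1 / ψ)
      ≤ kappa k N j ^ 2 * (C2 / ψ + 1 / ψ) := by gcongr
    _ = kappa k N j ^ 2 * ((C2 + 1) / ψ) := by rw [← add_div]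
    _ ≤ (expE k N ^ 4 * (F * ℓ ^ (N + 1))) * ((C2 + 1) / ψ) := by gcongr
    _ = expE k N ^ 4 * (C2 + 1) / ℓ ^ (N - 1) := by
        have : F * ℓ ^ (N + 1) * ℓ ^ (N - 1) = ψ := by rw [hψ, hsplit]; ring
        have hF1 : F ≠ 0 := by
          intro h; rw [h, zero_mul, zero_mul] at this; linarith
        rw [← this]
        field_simp
    _ ≤ _ := by
        gcongr

/-- The choice of the De Giorgi exponent under the growth restriction on the superradius. -/
lemma eventually_exists_exponent (hk : 1 ≤ k) {b : ℝ} (hb : 2 * b < N - 1)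
    (K K₂ : ℝ) :
    ∀ᶠ t in atTop, ∃ Q : ℝ, expE k N ≤ Q ∧
      K * ((Real.log^[k + 2] t) ^ b) ^ 2 ≤ (Real.log^[k - 1] Q) ^ (N - 1) ∧
      K₂ * Real.exp (4 * (Q + 1)) ≤ Real.log (Real.log t) ^ 2 := by
  have hz := tendsto_iterate_log (k + 2)
  have hY := tendsto_iterate_log 3
  -- Here 2b < N - 1 is used.
  have hpow : ∀ᶠ z : ℝ in atTop, K * (z ^ b) ^ 2 ≤ (z / 8) ^ (N - 1) := by
    have h1 := (tendsto_rpow_atTop (y := N - 1 - 2 * b) (by linarith)).eventually_ge_atTop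
      (K * 8 ^ (N - 1))
    filter_upwards [h1, eventually_gt_atTop 0] with z h1 h0
    rw [Real.div_rpow h0.le (by norm_num), le_div_iff₀ (by positivity)]
    calc K * (z ^ b) ^ 2 * 8 ^ (N - 1) = K * 8 ^ (N - 1) * (z ^ b) ^ 2 := by ring
      _ ≤ z ^ (N - 1 - 2 * b) * (z ^ b) ^ 2 := by gcongr
      _ = z ^ (N - 1) := by
        rw [← Real.rpow_natCast, ← Real.rpow_mul h0.le, ← Real.rpow_add h0]
        congr 1; push_cast; ring
  have hlarge : ∀ᶠ Y : ℝ in atTop, K₂ * Real.exp 4 ≤ Real.exp (3 / 2 * Y) :=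
    (Real.tendsto_exp_atTop.comp (tendsto_id.const_mul_atTop (by norm_num : (0 : ℝ) < 3 / 2))
      ).eventually_ge_atTop _
  filter_upwards [hz.eventually hpow, hz.eventually_ge_atTop (8 * Real.exp (2 * N)),
    hz.eventually_ge_atTop 4, hY.eventually hlarge,
    hY.eventually (eventually_iterate_exp_iterate_log (k - 1)),
    (tendsto_iterate_log 2).eventually_gt_atTop 0] with t h1 h2 h3 h4 h5 h6
  set z := Real.log^[k + 2] t with hzdef
  have hexpz : Real.exp^[k - 1] z = Real.log^[3] t := by
    rw [← h5, ← Function.iterate_add_apply, show k - 1 + 3 = k + 2 by omega]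
  -- With this Q, ln^(k-1) Q = z/8 is still comparable to z, while Q ≤ Y/8 for Y = ln ln ln t. Hence
  -- e^(4Q) ≤ e^(Y/2), far below (ln ln t)² = e^(2Y).
  refine ⟨Real.exp^[k - 1] (z / 8), ?_, ?_, ?_⟩
  · have : expE k N = Real.exp^[k - 1] (Real.exp (2 * N)) := by
      rw [expE, ← Function.iterate_succ_apply, Nat.succ_eq_add_one, Nat.sub_add_cancel hk]
    rw [this]
    exact iterate_exp_mono _ (by linarith)
  · rw [iterate_log_iterate_exp]; exact h1
  · set Y := Real.log^[3] t with hYdef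
    have hYe : Real.exp Y = Real.log (Real.log t) := Real.exp_log h6
    have hQ : Real.exp^[k - 1] (z / 8) ≤ Y / 8 := by
      rw [← hexpz]; exact iterate_exp_div_eight h3 _
    rw [← hYe]
    rcases le_total K₂ 0 with hK2 | hK2
    · exact (mul_nonpos_of_nonpos_of_nonneg hK2 (Real.exp_pos _).le).trans (sq_nonneg _)
    calc K₂ * Real.exp (4 * (Real.exp^[k - 1] (z / 8) + 1))
        ≤ K₂ * Real.exp (4 + 1 / 2 * Y) := by gcongr; linarith
      _ = K₂ * Real.exp 4 * Real.exp (1 / 2 * Y) := by rw [Real.exp_add]; ring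
      _ ≤ Real.exp (3 / 2 * Y) * Real.exp (1 / 2 * Y) := by gcongr
      _ = Real.exp Y ^ 2 := by
        rw [← Real.exp_add, ← Real.exp_nat_mul]; congr 1; push_cast; ring

end Young

/-! ### The weighted measure -/

section Weight

variable {n : ℕ} {Ω : Set (E n)} {w : E n → ℝ}

lemma IsWeight.aemeasurable (hw : IsWeight Ω w) {S : Set (E n)} (hS : S ⊆ Ω) :
    AEMeasurable (fun x => ENNReal.ofReal (w x)) (volume.restrict S) :=
  (hw.locallyIntegrable.aestronglyMeasurable.aemeasurable.mono_measure
    (Measure.restrict_mono hS le_rfl)).ennreal_ofReal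

lemma wMeasure_restrict {S : Set (E n)} (hSm : MeasurableSet S) :
    (wMeasure w).restrict S = (volume.restrict S).withDensity (fun x => ENNReal.ofReal (w x)) :=
  restrict_withDensity hSm _

lemma IsWeight.lintegral_eq (hw : IsWeight Ω w) {S : Set (E n)} (hSm : MeasurableSet S)
    (hS : S ⊆ Ω) {g : E n → ℝ≥0∞} (hg : AEMeasurable g (volume.restrict S)) :
    ∫⁻ x in S, g x ∂(wMeasure w) = ∫⁻ x in S, ENNReal.ofReal (w x) * g x := by
  rw [wMeasure_restrict hSm, lintegral_withDensity_eq_lintegral_mul₀ (hw.aemeasurable hS) hg]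
  rfl

lemma IsWeight.pos_restrict (hw : IsWeight Ω w) {S : Set (E n)} (hS : S ⊆ Ω) :
    ∀ᵐ x ∂(volume.restrict S), 0 < w x :=
  ae_mono (Measure.restrict_mono hS le_rfl) hw.pos

lemma IsWeight.measure_eq (hw : IsWeight Ω w) {S : Set (E n)} (hSm : MeasurableSet S)
    (hS : S ⊆ Ω) : wMeasure w S = ∫⁻ x in S, ENNReal.ofReal (w x) := by
  have := hw.lintegral_eq hSm hS (g := fun _ => 1) aemeasurable_const
  simpa using this

lemma IsWeight.measure_compact_lt_top (hw : IsWeight Ω w) {K : Set (E n)} (hK : IsCompact K)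
    (hKΩ : K ⊆ Ω) : wMeasure w K < ∞ := by
  rw [hw.measure_eq hK.measurableSet hKΩ]
  exact (hw.locallyIntegrable.integrableOn_compact_subset hKΩ hK).lintegral_lt_top

lemma IsWeight.measure_pos (hw : IsWeight Ω w) {S : Set (E n)} (hS : IsOpen S) (hne : S.Nonempty)
    (hSΩ : S ⊆ Ω) : 0 < wMeasure w S := by
  rw [hw.measure_eq hS.measurableSet hSΩ, pos_iff_ne_zero]
  intro h
  rw [lintegral_eq_zero_iff' (hw.aemeasurable hSΩ)] at h
  have h2 : ∀ᵐ x ∂(volume.restrict S), False := by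
    filter_upwards [h, hw.pos_restrict hSΩ] with x h1 h2
    simp only [Pi.zero_apply, ENNReal.ofReal_eq_zero] at h1
    linarith
  rw [ae_iff] at h2
  simp only [not_false_eq_true, Set.ofPred_true, Measure.restrict_apply_univ] at h2
  exact (hS.measure_pos volume hne).ne' h2

/-- Positivity of `w` almost everywhere makes Lebesgue measure on `S` absolutely continuous with
respect to w dx. -/
lemma IsWeight.ae_of_ae (hw : IsWeight Ω w) {S : Set (E n)} (hSm : MeasurableSet S) (hS : S ⊆ Ω)
    {P : E n → Prop} (h : ∀ᵐ x ∂((wMeasure w).restrict S), P x) :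
    ∀ᵐ x ∂(volume.restrict S), P x := by
  rw [wMeasure_restrict hSm] at h
  refine (withDensity_absolutelyContinuous' (hw.aemeasurable hS) ?_).ae_le h
  filter_upwards [hw.pos_restrict hS] with x hx
  simpa using hx

end Weight

/-! ### Consequences of the Orlicz–Sobolev inequality -/

section OrliczSobolev

variable {n : ℕ} {Ω U : Set (E n)} {w : E n → ℝ} {A B : E n → Matrix (Fin n) (Fin n) ℝ}
  {k : ℕ} {N : ℝ}

/-- The Orlicz–Sobolev inequality on the set `U` with constant `S`. -/
def OrliczSobolevOn (w : E n → ℝ) (B : E n → Matrix (Fin n) (Fin n) ℝ) (Φ : ℝ → ℝ) (S : ℝ)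
    (U : Set (E n)) : Prop :=
  ∀ v ∈ LipC U, orliczNorm Φ (normMeasure w U) v ≤
    ENNReal.ofReal S / (wMeasure w U) ^ (1 / 2 : ℝ) *
      (∫⁻ y in U, ENNReal.ofReal (‖gradA B v y‖ ^ 2)) ^ (1 / 2 : ℝ)

lemma lintegral_gradA_le {Cb : ℝ} (hCb : 0 ≤ Cb) (hA : GoodCoef U A)
    (hB : ∀ᵐ x ∂(volume.restrict U), ∀ ξ : E n, ‖act (B x) ξ‖ ^ 2 ≤ Cb * quad (A x) ξ)
    {v : E n → ℝ} (hv : BLip v) :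
    ∫⁻ y in U, ENNReal.ofReal (‖gradA B v y‖ ^ 2)
      ≤ ENNReal.ofReal (Cb * ∫ y in U, quad (A y) (gradient v y)) := by
  rw [← integral_const_mul, ofReal_integral_eq_lintegral_ofReal
    ((hA.integrable_quad_gradient hv).const_mul Cb)
    (hA.psd.mono fun x hx => mul_nonneg hCb (quad_nonneg hx _))]
  refine lintegral_mono_ae ?_
  filter_upwards [hB] with x hx
  exact ENNReal.ofReal_le_ofReal (hx _)

/-- By `haD`, `a` lies strictly above the Luxemburg norm. Strictness matters because an infimum need
not be attained: it yields an admissible `b` not exceeding `a`. -/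
lemma OrliczSobolevOn.exists_modular_le {Φ : ℝ → ℝ} {S Cb : ℝ}
    (hOS : OrliczSobolevOn w B Φ S U) (hCb : 0 ≤ Cb) (hA : GoodCoef U A)
    (hB : ∀ᵐ x ∂(volume.restrict U), ∀ ξ : E n, ‖act (B x) ξ‖ ^ 2 ≤ Cb * quad (A x) ξ)
    (hm0 : 0 < wMeasure w U) (hm : wMeasure w U < ∞) {v : E n → ℝ} (hv : v ∈ LipC U) {D a : ℝ}
    (hD : ∫ y in U, quad (A y) (gradient v y) ≤ D) (ha : 0 < a)
    (haD : S ^ 2 * (Cb * D) < a ^ 2 * (wMeasure w U).toReal) :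
    ∃ b : ℝ, 0 < b ∧ b ≤ a ∧
      ∫⁻ x in U, ENNReal.ofReal (Φ (|v x| / b)) ∂(wMeasure w) ≤ wMeasure w U := by
  set m := wMeasure w U with hmdef
  set mr := m.toReal with hmr
  have hmr0 : 0 < mr := ENNReal.toReal_pos hm0.ne' hm.ne
  have hD0 : 0 ≤ D :=
    (integral_nonneg_of_ae (hA.psd.mono fun x hx => quad_nonneg hx _)).trans hD
  have h1 : orliczNorm Φ (normMeasure w U) v < ENNReal.ofReal a := by
    refine (hOS v hv).trans_lt ?_
    have e1 : m ^ (1 / 2 : ℝ) = ENNReal.ofReal (Real.sqrt mr) := by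
      rw [Real.sqrt_eq_rpow, ← ENNReal.ofReal_rpow_of_pos hmr0, ENNReal.ofReal_toReal hm.ne]
    have e2 : (∫⁻ y in U, ENNReal.ofReal (‖gradA B v y‖ ^ 2)) ^ (1 / 2 : ℝ)
        ≤ ENNReal.ofReal (Real.sqrt (Cb * D)) := by
      rw [Real.sqrt_eq_rpow, ← ENNReal.ofReal_rpow_of_nonneg (by positivity) (by norm_num)]
      refine ENNReal.rpow_le_rpow ((lintegral_gradA_le hCb hA hB (LipC.bLip hv)).trans ?_)
        (by norm_num)
      exact ENNReal.ofReal_le_ofReal (by gcongr)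
    have hs : 0 < Real.sqrt mr := Real.sqrt_pos.2 hmr0
    calc ENNReal.ofReal S / m ^ (1 / 2 : ℝ) *
          (∫⁻ y in U, ENNReal.ofReal (‖gradA B v y‖ ^ 2)) ^ (1 / 2 : ℝ)
        ≤ ENNReal.ofReal |S| / ENNReal.ofReal (Real.sqrt mr) *
          ENNReal.ofReal (Real.sqrt (Cb * D)) := by
          rw [e1]; gcongr; exact le_abs_self S
      _ = ENNReal.ofReal (|S| / Real.sqrt mr * Real.sqrt (Cb * D)) := by
          rw [← ENNReal.ofReal_div_of_pos hs, ← ENNReal.ofReal_mul (by positivity)]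
      _ < ENNReal.ofReal a := by
          rw [ENNReal.ofReal_lt_ofReal_iff ha]
          refine lt_of_pow_lt_pow_left₀ 2 ha.le ?_
          rw [mul_pow, div_pow, Real.sq_sqrt hmr0.le, Real.sq_sqrt (by positivity), sq_abs,
            div_mul_eq_mul_div, div_lt_iff₀ hmr0]
          exact haD
  obtain ⟨_, ⟨b, hb, rfl, hb1⟩, hba⟩ := sInf_lt_iff.1 h1
  refine ⟨b, hb, ((ENNReal.ofReal_lt_ofReal_iff ha).1 hba).le, ?_⟩
  rw [normMeasure, lintegral_smul_measure, smul_eq_mul, ← hmdef,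
    ENNReal.inv_mul_le_iff hm0.ne' hm.ne, mul_one] at hb1
  exact hb1

/-- Split at |v| = bT. Below, v² ≤ b²T², and this is paid only where v ≠ 0; above, Ψ(|v|/b) ≥ Ψ(T).
It replaces Hölder's inequality, which has no power to exploit here. -/
lemma sq_le_of_youngPsi (hN : 1 < N) {b T : ℝ} (hb : 0 < b) (hT : 0 ≤ T) (v : ℝ) :
    v ^ 2 ≤ b ^ 2 * ((if v ≠ 0 then T ^ 2 else 0) +
      youngPhi k N (|v| / b) * (youngPsi k N T)⁻¹) := by
  have hψ : 0 < youngPsi k N T := zero_lt_one.trans_le (one_le_youngPsi hN T)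
  have hψ' : 0 < youngPsi k N (|v| / b) := zero_lt_one.trans_le (one_le_youngPsi hN _)
  by_cases hv : v = 0
  · rw [hv]
    simp [youngPhi_eq]
  rw [if_pos hv, youngPhi_eq]
  have e : v ^ 2 = b ^ 2 * (|v| / b) ^ 2 := by
    rw [div_pow, sq_abs]; field_simp
  rw [e]
  refine mul_le_mul_of_nonneg_left ?_ (sq_nonneg b)
  have hs0 : 0 ≤ |v| / b := by positivity
  rcases le_total (|v| / b) T with h | h
  · have : (|v| / b) ^ 2 ≤ T ^ 2 := by gcongr
    have : 0 ≤ (|v| / b) ^ 2 * youngPsi k N (|v| / b) * (youngPsi k N T)⁻¹ := by positivity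
    linarith
  · have h1 := youngPsi_mono (k := k) hN hT h
    have h2 : 1 ≤ youngPsi k N (|v| / b) * (youngPsi k N T)⁻¹ := by
      rw [← div_eq_mul_inv, one_le_div hψ]; exact h1
    rw [mul_assoc]
    nlinarith [sq_nonneg T, sq_nonneg (|v| / b)]

lemma OrliczSobolevOn.lintegral_sq_le {S Cb : ℝ} (hN : 1 < N)
    (hOS : OrliczSobolevOn w B (youngPhi k N) S U) (hCb : 0 ≤ Cb) (hA : GoodCoef U A)
    (hB : ∀ᵐ x ∂(volume.restrict U), ∀ ξ : E n, ‖act (B x) ξ‖ ^ 2 ≤ Cb * quad (A x) ξ)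
    (hm0 : 0 < wMeasure w U) (hm : wMeasure w U < ∞) {v : E n → ℝ} (hv : v ∈ LipC U) {D a : ℝ}
    (hD : ∫ y in U, quad (A y) (gradient v y) ≤ D) (ha : 0 < a)
    (haD : S ^ 2 * (Cb * D) < a ^ 2 * (wMeasure w U).toReal) {T : ℝ} (hT : 0 ≤ T) :
    ∫⁻ x in U, ENNReal.ofReal (v x ^ 2) ∂(wMeasure w) ≤
      ENNReal.ofReal (a ^ 2) * (ENNReal.ofReal (T ^ 2) * wMeasure w (U ∩ {x | v x ≠ 0}) +
        wMeasure w U * ENNReal.ofReal (youngPsi k N T)⁻¹) := by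
  obtain ⟨b, hb, hba, hle⟩ := hOS.exists_modular_le hCb hA hB hm0 hm hv hD ha haD
  have hψ : 0 < youngPsi k N T := zero_lt_one.trans_le (one_le_youngPsi hN T)
  have hvm : MeasurableSet {x | v x ≠ 0} :=
    (isOpen_ne_fun (LipC.bLip hv).continuous continuous_const).measurableSet
  have hΦ0 : ∀ t, 0 ≤ youngPhi k N t := fun t => by
    rw [youngPhi_eq]
    exact mul_nonneg (sq_nonneg _) (zero_le_one.trans (one_le_youngPsi hN t))
  have hpt : ∀ x, ENNReal.ofReal (v x ^ 2) ≤ ENNReal.ofReal (a ^ 2) *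
      (ENNReal.ofReal (T ^ 2) * ({x | v x ≠ 0}.indicator (fun _ => 1) x) +
        ENNReal.ofReal (youngPhi k N (|v x| / b)) * ENNReal.ofReal (youngPsi k N T)⁻¹) := by
    intro x
    have h1 := sq_le_of_youngPsi (k := k) hN hb hT (v x)
    refine (ENNReal.ofReal_le_ofReal h1).trans ?_
    rw [ENNReal.ofReal_mul (sq_nonneg b), ENNReal.ofReal_add (by split_ifs <;> positivity)
      (mul_nonneg (hΦ0 _) (inv_nonneg.2 hψ.le)), ENNReal.ofReal_mul (hΦ0 _)]
    gcongr
    by_cases hx : v x = 0 <;> simp [hx]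
  refine (lintegral_mono hpt).trans ?_
  rw [lintegral_const_mul' _ _ ENNReal.ofReal_ne_top]
  gcongr
  rw [lintegral_add_left ((measurable_const.indicator hvm).const_mul _),
    lintegral_const_mul' _ _ ENNReal.ofReal_ne_top, lintegral_mul_const' _ _ ENNReal.ofReal_ne_top,
    lintegral_indicator hvm, setLIntegral_const, one_mul, Measure.restrict_apply hvm, Set.inter_comm]
  gcongr

end OrliczSobolev

/-! ### De Giorgi iteration -/

section DeGiorgi

variable {n : ℕ} {Ω U : Set (E n)} {w : E n → ℝ} {A B : E n → Matrix (Fin n) (Fin n) ℝ}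
  {k : ℕ} {N : ℝ}

/-- A decreasing family of open sets `D_j` with cutoff functions `ψ_j`, supported in `D_j` and equal
to `1` on `D_{j+1}`, whose gradients grow like `G κ_{k,N}(j)`. -/
structure CutoffFamily (A : E n → Matrix (Fin n) (Fin n) ℝ) (w : E n → ℝ) (U : Set (E n)) (k : ℕ)
    (N G : ℝ) (D : ℕ → Set (E n)) (ψ : ℕ → E n → ℝ) : Prop where
  isOpen : ∀ j, IsOpen (D j)
  subset : ∀ j, 1 ≤ j → D j ⊆ U
  lipC : ∀ j, 1 ≤ j → ψ j ∈ LipC U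
  support : ∀ j, 1 ≤ j → tsupport (ψ j) ⊆ D j
  eq_one : ∀ j, 1 ≤ j → ∀ x ∈ D (j + 1), ψ j x = 1
  grad : ∀ j, 1 ≤ j → ∀ᵐ x ∂(volume.restrict U),
    quad (A x) (gradient (ψ j) x) ≤ G ^ 2 * kappa k N j ^ 2 * w x

/-- The weighted energy of a cutoff function. -/
lemma integral_sq_mul_quad_le (hA : GoodCoef U A) (hw : IsWeight Ω w) (hUΩ : U ⊆ Ω)
    {ψ W : E n → ℝ} (hψ : ψ ∈ LipC U) (hW : BLip W) {D : Set (E n)} (hD : IsOpen D) (hDU : D ⊆ U)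
    (hsupp : tsupport ψ ⊆ D) {g : ℝ} (hg : 0 ≤ g)
    (hgrad : ∀ᵐ x ∂(volume.restrict U), quad (A x) (gradient ψ x) ≤ g * w x)
    {y : ℝ} (hy : 0 ≤ y) (hm : wMeasure w U < ∞)
    (hX : ∫⁻ x in D, ENNReal.ofReal (W x ^ 2) ∂(wMeasure w) ≤ ENNReal.ofReal y * wMeasure w U) :
    ∫ x in U, W x ^ 2 * quad (A x) (gradient ψ x) ≤ g * y * (wMeasure w U).toReal := by
  have hnn : 0 ≤ᵐ[volume.restrict U] fun x => W x ^ 2 * quad (A x) (gradient ψ x) :=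
    hA.psd.mono fun x hx => mul_nonneg (sq_nonneg _) (quad_nonneg hx _)
  rw [integral_eq_lintegral_of_nonneg_ae hnn
    (hW.integrable_sq_mul (hA.integrable_quad_gradient (LipC.bLip hψ))).aestronglyMeasurable]
  refine ENNReal.toReal_le_of_le_ofReal (by positivity) ?_
  have hWm : Measurable fun x => ENNReal.ofReal (W x ^ 2) :=
    (hW.continuous.measurable.pow_const 2).ennreal_ofReal
  calc ∫⁻ x in U, ENNReal.ofReal (W x ^ 2 * quad (A x) (gradient ψ x))
      = ∫⁻ x in D, ENNReal.ofReal (W x ^ 2 * quad (A x) (gradient ψ x)) := by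
        rw [← lintegral_indicator hA.isOpen.measurableSet, ← lintegral_indicator hD.measurableSet]
        congr 1; funext x
        by_cases hx : x ∈ D
        · rw [Set.indicator_of_mem hx, Set.indicator_of_mem (hDU hx)]
        · rw [Set.indicator_of_notMem hx]
          by_cases hxU : x ∈ U
          · rw [Set.indicator_of_mem hxU,
              gradient_eq_zero_of_notMem_tsupport fun h => hx (hsupp h), quad_zero]
            simp
          · rw [Set.indicator_of_notMem hxU]
    _ ≤ ∫⁻ x in D, ENNReal.ofReal g * (ENNReal.ofReal (w x) * ENNReal.ofReal (W x ^ 2)) := by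
        refine lintegral_mono_ae ?_
        filter_upwards [ae_mono (Measure.restrict_mono hDU le_rfl) hgrad] with x hx
        rw [← ENNReal.ofReal_mul' (sq_nonneg _), ← ENNReal.ofReal_mul hg]
        refine ENNReal.ofReal_le_ofReal ?_
        calc W x ^ 2 * quad (A x) (gradient ψ x) ≤ W x ^ 2 * (g * w x) := by gcongr
          _ = g * (w x * W x ^ 2) := by ring
    _ = ENNReal.ofReal g * ∫⁻ x in D, ENNReal.ofReal (W x ^ 2) ∂(wMeasure w) := by
        rw [lintegral_const_mul' _ _ ENNReal.ofReal_ne_top,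
          hw.lintegral_eq hD.measurableSet (hDU.trans hUΩ) hWm.aemeasurable]
    _ ≤ ENNReal.ofReal g * (ENNReal.ofReal y * wMeasure w U) := by gcongr
    _ = ENNReal.ofReal (g * y * (wMeasure w U).toReal) := by
        rw [ENNReal.ofReal_mul (by positivity), ENNReal.ofReal_mul hg,
          ENNReal.ofReal_toReal hm.ne, mul_assoc]

lemma integral_quad_mul_le (hA : GoodCoef U A) {ψ W : E n → ℝ} (hψ : BLip ψ) (hW : BLip W) :
    ∫ x in U, quad (A x) (gradient (fun y => ψ y * W y) x) ≤
      2 * (∫ x in U, ψ x ^ 2 * quad (A x) (gradient W x)) +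
        2 * ∫ x in U, W x ^ 2 * quad (A x) (gradient ψ x) := by
  have j1 := hψ.integrable_sq_mul (hA.integrable_quad_gradient hW)
  have j2 := hW.integrable_sq_mul (hA.integrable_quad_gradient hψ)
  have hac := restrict_absolutelyContinuous U
  rw [← integral_const_mul, ← integral_const_mul, ← integral_add (j1.const_mul _) (j2.const_mul _)]
  refine integral_mono_ae (hA.integrable_quad_gradient (hψ.mul hW))
    ((j1.const_mul _).add (j2.const_mul _)) ?_
  filter_upwards [hA.psd, hψ.ae_differentiableAt _ hac, hW.ae_differentiableAt _ hac]
    with x hx e1 e2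
  rw [gradient_mul e1 e2]
  refine (quad_add_le hx _ _).trans ?_
  rw [quad_smul, quad_smul]

/-- One step of the De Giorgi iteration. -/
lemma deGiorgi_step {S Cb G : ℝ} (hN : 1 < N) (hA : GoodCoef U A) (hw : IsWeight Ω w)
    (hUΩ : U ⊆ Ω) (hCb : 0 ≤ Cb)
    (hB : ∀ᵐ x ∂(volume.restrict U), ∀ ξ : E n, ‖act (B x) ξ‖ ^ 2 ≤ Cb * quad (A x) ξ)
    (hm0 : 0 < wMeasure w U) (hm : wMeasure w U < ∞)
    (hOS : OrliczSobolevOn w B (youngPhi k N) S U) {D : ℕ → Set (E n)} {ψ : ℕ → E n → ℝ}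
    (hD : CutoffFamily A w U k N G D ψ) {j : ℕ} (hj : 1 ≤ j) {f : E n → ℝ} (hf : BLip f)
    {c c' e : ℝ} (hc : c < c')
    (hcacc : ∫ x in U, ψ j x ^ 2 * quad (A x) (gradient (fun y => max (f y - c') 0) x)
      ≤ 4 * (∫ x in U, max (f x - c') 0 ^ 2 * quad (A x) (gradient (ψ j) x)) + e)
    {y : ℝ} (hy : 0 ≤ y)
    (hX : ∫⁻ x in D j, ENNReal.ofReal (max (f x - c) 0 ^ 2) ∂(wMeasure w)
      ≤ ENNReal.ofReal y * wMeasure w U)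
    {a : ℝ} (ha : 0 < a)
    (haD : S ^ 2 * (Cb * (10 * (G ^ 2 * kappa k N j ^ 2 * y * (wMeasure w U).toReal) + 2 * e))
      < a ^ 2 * (wMeasure w U).toReal) {T : ℝ} (hT : 0 ≤ T) :
    ∫⁻ x in D (j + 1), ENNReal.ofReal (max (f x - c') 0 ^ 2) ∂(wMeasure w) ≤
      ENNReal.ofReal (a ^ 2 * (T ^ 2 * y / (c' - c) ^ 2 + 1 / youngPsi k N T)) * wMeasure w U := by
  have hψL := hD.lipC j hj
  have hψB := LipC.bLip hψL
  have hW : BLip (fun x => max (f x - c') 0) := (hf.sub_const c').max_zero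
  have hv := LipC.mul_bLip hψL hW
  have hδ : 0 < (c' - c) ^ 2 := by have := sub_pos.2 hc; positivity
  have hψT : 0 < youngPsi k N T := zero_lt_one.trans_le (one_le_youngPsi hN T)
  have hXW : ∫⁻ x in D j, ENNReal.ofReal (max (f x - c') 0 ^ 2) ∂(wMeasure w)
      ≤ ENNReal.ofReal y * wMeasure w U := by
    refine le_trans (lintegral_mono fun x => ENNReal.ofReal_le_ofReal ?_) hX
    have : max (f x - c') 0 ≤ max (f x - c) 0 := max_le_max (by linarith) le_rfl
    exact pow_le_pow_left₀ (le_max_right _ _) this 2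
  have hE := integral_sq_mul_quad_le hA hw hUΩ hψL hW (hD.isOpen j) (hD.subset j hj)
    (hD.support j hj) (by positivity) (hD.grad j hj) hy hm hXW
  have hQ := integral_quad_mul_le hA hψB hW
  -- 10 = 2·4 + 2: the Caccioppoli constant, doubled by the product rule, plus the term with ∇ψ_j.
  have hsq := hOS.lintegral_sq_le hN hCb hA hB hm0 hm hv (D := 10 * (G ^ 2 * kappa k N j ^ 2 * y *
    (wMeasure w U).toReal) + 2 * e) (by linarith) ha haD hT
  -- Chebyshev: where the new truncation is nonzero, the old one exceeds c' - c.
  have hmeas : wMeasure w (U ∩ {x | ψ j x * max (f x - c') 0 ≠ 0})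
      ≤ ENNReal.ofReal (y / (c' - c) ^ 2) * wMeasure w U := by
    have hmark := mul_meas_ge_le_lintegral₀ (μ := (wMeasure w).restrict (D j))
      (f := fun x => ENNReal.ofReal (max (f x - c) 0 ^ 2))
      (((hf.sub_const c).max_zero.continuous.measurable.pow_const 2).ennreal_ofReal.aemeasurable)
      (ENNReal.ofReal ((c' - c) ^ 2))
    have hsub : wMeasure w (U ∩ {x | ψ j x * max (f x - c') 0 ≠ 0}) ≤
        (wMeasure w).restrict (D j)
          {x | ENNReal.ofReal ((c' - c) ^ 2) ≤ ENNReal.ofReal (max (f x - c) 0 ^ 2)} := by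
      rw [Measure.restrict_apply' (hD.isOpen j).measurableSet]
      refine measure_mono fun x hx => ⟨?_, ?_⟩
      · have h2 : max (f x - c') 0 ≠ 0 := right_ne_zero_of_mul hx.2
        have h3 : 0 < f x - c' := by
          by_contra h
          exact h2 (max_eq_right (not_lt.1 h))
        refine ENNReal.ofReal_le_ofReal (pow_le_pow_left₀ (sub_pos.2 hc).le ?_ 2)
        exact le_max_of_le_left (by linarith)
      · exact hD.support j hj (subset_tsupport _ (left_ne_zero_of_mul hx.2))
    rw [ENNReal.ofReal_div_of_pos hδ, ENNReal.div_eq_inv_mul, mul_assoc]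
    refine hsub.trans ?_
    rw [← ENNReal.mul_le_iff_le_inv (by simpa using hδ.ne') ENNReal.ofReal_ne_top]
    exact hmark.trans hX
  calc ∫⁻ x in D (j + 1), ENNReal.ofReal (max (f x - c') 0 ^ 2) ∂(wMeasure w)
      = ∫⁻ x in D (j + 1), ENNReal.ofReal ((ψ j x * max (f x - c') 0) ^ 2) ∂(wMeasure w) :=
        setLIntegral_congr_fun (hD.isOpen _).measurableSet fun x hx => by
          simp [hD.eq_one j hj x hx]
    _ ≤ ∫⁻ x in U, ENNReal.ofReal ((ψ j x * max (f x - c') 0) ^ 2) ∂(wMeasure w) :=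
        lintegral_mono_set (hD.subset _ (by omega))
    _ ≤ _ := hsq
    _ ≤ ENNReal.ofReal (a ^ 2) * (ENNReal.ofReal (T ^ 2) *
          (ENNReal.ofReal (y / (c' - c) ^ 2) * wMeasure w U) +
            wMeasure w U * ENNReal.ofReal (youngPsi k N T)⁻¹) := by gcongr
    _ = _ := by
        rw [ENNReal.ofReal_mul (sq_nonneg a), ENNReal.ofReal_add (by positivity) (by positivity),
          mul_div_assoc, ENNReal.ofReal_mul (sq_nonneg T), one_div]
        ring

/-- De Giorgi's iteration: a bound in mean square on `D_1` becomes an almost everywhere bound on a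
set contained in all `D_j`. -/
lemma exists_deGiorgi_constant (hk : 1 ≤ k) (hN : 1 < N) {Cb : ℝ} (hCb : 0 ≤ Cb) :
    ∃ c₁ : ℝ, 0 < c₁ ∧ ∀ {n : ℕ} {Ω U : Set (E n)} {w : E n → ℝ}
      {A B : E n → Matrix (Fin n) (Fin n) ℝ} {S G : ℝ} {D : ℕ → Set (E n)} {ψ : ℕ → E n → ℝ}
      {f : ℕ → E n → ℝ} {F : E n → ℝ} {D' : Set (E n)} {Q τ : ℝ},
      GoodCoef U A → IsWeight Ω w → U ⊆ Ω →
      (∀ᵐ x ∂(volume.restrict U), ∀ ξ : E n, ‖act (B x) ξ‖ ^ 2 ≤ Cb * quad (A x) ξ) →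
      0 < wMeasure w U → wMeasure w U < ∞ →
      OrliczSobolevOn w B (youngPhi k N) S U →
      CutoffFamily A w U k N G D ψ → IsSubSeq A U f →
      IsOpen D' → (∀ j, 1 ≤ j → D' ⊆ D j) →
      (∀ᵐ x ∂(volume.restrict D'), Tendsto (fun i => f i x) atTop (𝓝 (F x))) →
      expE k N ≤ Q → 0 < τ → c₁ * (S * G) ^ 2 ≤ (Real.log^[k - 1] Q) ^ (N - 1) →
      (∀ᶠ i in atTop, ∫⁻ x in D 1, ENNReal.ofReal (f i x ^ 2) ∂(wMeasure w)
        ≤ ENNReal.ofReal (τ ^ 2 * Real.exp (-(4 * (Q + 1)))) * wMeasure w U) →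
      ∀ᵐ x ∂(volume.restrict D'), F x ≤ τ := by
  obtain ⟨C, hC, hnum⟩ := exists_kappa_sq_mul_le hk hN
  refine ⟨20 * Real.exp 4 * (Cb + 1) * C, by positivity, ?_⟩
  intro n Ω U w A B S G D ψ f F D' Q τ hA hw hUΩ hB hm0 hm hOS hD hf hD'o hD' hlim hQ hτ hthr hinit
  set mr := (wMeasure w U).toReal with hmr
  have hmr0 : 0 < mr := ENNReal.toReal_pos hm0.ne' hm.ne
  have hE := one_le_expE (k := k) hN
  have hq1 : 1 ≤ Real.log^[k - 1] Q := one_le_iterate_log hN hQ (by omega)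
  set q := (Real.log^[k - 1] Q) ^ (N - 1) with hq
  have hq0 : 0 < q := by positivity
  -- These are the target mean squares, relative to w(U). Each step must gain the factor e^(-4).
  set Y : ℕ → ℝ := fun j => τ ^ 2 * Real.exp (-(4 * (Q + j))) with hYdef
  have hY0 : ∀ j, 0 < Y j := fun j => by positivity
  have hYs : ∀ j, Y (j + 1) = Real.exp (-4) * Y j := fun j => by
    simp only [hYdef]
    rw [show -(4 * (Q + ((j + 1 : ℕ) : ℝ))) = -4 + -(4 * (Q + j)) by push_cast; ring, Real.exp_add]
    ring
  -- The levels start at c_1 = 0, since the radii are indexed from 1, and increase to τ.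
  set c : ℕ → ℝ := fun j => τ * (1 - 2 * (1 / 2) ^ j) with hcdef
  have hcs : ∀ j, c (j + 1) - c j = τ * (1 / 2) ^ j := fun j => by
    simp only [hcdef, pow_succ]; ring
  have hc0 : ∀ j, 1 ≤ j → 0 ≤ c j := fun j hj => by
    have : (1 / 2 : ℝ) ^ j ≤ (1 / 2) ^ 1 := pow_le_pow_of_le_one (by norm_num) (by norm_num) hj
    simp only [hcdef]
    exact mul_nonneg hτ.le (by linarith)
  have hcτ : ∀ j, c j ≤ τ := fun j => by
    have : (0 : ℝ) ≤ (1 / 2) ^ j := by positivity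
    simp only [hcdef]; nlinarith
  have claim : ∀ j, 1 ≤ j → ∀ᶠ i in atTop,
      ∫⁻ x in D j, ENNReal.ofReal (max (f i x - c j) 0 ^ 2) ∂(wMeasure w)
        ≤ ENNReal.ofReal (Y j) * wMeasure w U := by
    intro j hj
    induction j, hj using Nat.le_induction with
    | base =>
      filter_upwards [hinit] with i hi
      have h1 : c 1 = 0 := by simp [hcdef]
      simp only [h1, sub_zero, max_eq_left (hf.nonneg i _)]
      simpa [hYdef] using hi
    | succ j hj ih =>
      set y := Q + (j : ℝ) with hy
      set T := Real.exp (y / 2) with hT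
      have hT2 : T ^ 2 = Real.exp y := by
        rw [hT, ← Real.exp_nat_mul]; congr 1; push_cast; ring
      have hψT : 0 < youngPsi k N T := zero_lt_one.trans_le (one_le_youngPsi hN T)
      set θ := Real.exp (-y) + 1 / youngPsi k N T with hθ
      have hθ0 : 0 < θ := by positivity
      -- `s` makes sθ half of the target Y_(j+1). It absorbs the error e_i for large i and at the
      -- same time makes the Orlicz–Sobolev condition strict.
      set s := Real.exp (-4) / 2 * Y j / θ with hs
      have hs0 : 0 < s := by have := hY0 j; positivity
      obtain ⟨e, he, he0, hcacc⟩ := hf.caccioppoli (c (j + 1)) (hc0 _ (by omega)) _ (hD.lipC j hj)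
      have hsmall : ∀ᶠ i in atTop, S ^ 2 * (Cb * (2 * e i)) < s * mr := by
        have : Tendsto (fun i => S ^ 2 * (Cb * (2 * e i))) atTop (𝓝 0) := by
          simpa using ((he.const_mul 2).const_mul Cb).const_mul (S ^ 2)
        exact this.eventually_lt_const (by positivity)
      filter_upwards [ih, hsmall] with i hi hei
      set a2 := S ^ 2 * (Cb * (10 * (G ^ 2 * kappa k N j ^ 2 * Y j))) + s with ha2
      have hYj := hY0 j
      have ha20 : 0 < a2 := by positivity
      have hstep := deGiorgi_step hN hA hw hUΩ hCb hB hm0 hm hOS hD hj (hf.bLip i)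
        (c := c j) (c' := c (j + 1)) (by
          have := hcs j
          have : 0 < τ * (1 / 2) ^ j := by positivity
          linarith) (hcacc i) (hY0 j).le hi (a := Real.sqrt a2) (Real.sqrt_pos.2 ha20)
        (by
          rw [Real.sq_sqrt ha20.le, ha2, ← hmr]
          linarith) (T := T) (Real.exp_pos _).le
      refine hstep.trans ?_
      gcongr
      rw [Real.sq_sqrt ha20.le, hcs]
      -- The quotient is e^(-3y)·4^j, and 4^j ≤ e^(2y). The exponent 4 in Y_j leaves room for T² =
      -- e^y, for the level gaps and for a remaining e^(-y).
      have hfirst : T ^ 2 * Y j / (τ * (1 / 2) ^ j) ^ 2 ≤ Real.exp (-y) := by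
        have e1 : (τ * (1 / 2) ^ j) ^ 2 = τ ^ 2 * ((4 : ℝ) ^ j)⁻¹ := by
          rw [mul_pow, ← pow_mul, mul_comm j 2, pow_mul, ← inv_pow]; norm_num
        have e2 : (4 : ℝ) ^ j ≤ Real.exp (2 * y) := by
          have h4 : (4 : ℝ) ≤ Real.exp 2 := by
            have := Real.quadratic_le_exp_of_nonneg (x := 2) (by norm_num); linarith
          calc (4 : ℝ) ^ j ≤ Real.exp 2 ^ j := by gcongr
            _ = Real.exp (2 * j) := by rw [← Real.exp_nat_mul]; ring_nf
            _ ≤ Real.exp (2 * y) := by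
              refine Real.exp_le_exp.2 ?_
              rw [hy]; linarith
        rw [hT2, e1]
        simp only [hYdef, ← hy]
        have e3 : Real.exp y * (τ ^ 2 * Real.exp (-(4 * y))) / (τ ^ 2 * ((4 : ℝ) ^ j)⁻¹)
            = Real.exp (-(3 * y)) * 4 ^ j := by
          rw [show -(3 * y) = y + -(4 * y) by ring, Real.exp_add y (-(4 * y))]
          generalize Real.exp y = p1
          generalize Real.exp (-(4 * y)) = p2
          field_simp
        rw [e3]
        calc Real.exp (-(3 * y)) * 4 ^ j ≤ Real.exp (-(3 * y)) * Real.exp (2 * y) := by gcongr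
          _ = Real.exp (-y) := by rw [← Real.exp_add]; congr 1; ring
      have hκ := hnum Q hQ j
      have hκ' : kappa k N j ^ 2 * θ * q ≤ C := by
        rw [← le_div_iff₀ hq0]; exact hκ
      have hgain : S ^ 2 * (Cb * (10 * (G ^ 2 * kappa k N j ^ 2))) * θ ≤ Real.exp (-4) / 2 := by
        have h1 : S ^ 2 * (Cb * (10 * (G ^ 2 * kappa k N j ^ 2))) * θ * q
            ≤ 10 * (Cb + 1) * C * (S * G) ^ 2 := by
          calc S ^ 2 * (Cb * (10 * (G ^ 2 * kappa k N j ^ 2))) * θ * q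
              = 10 * Cb * (S * G) ^ 2 * (kappa k N j ^ 2 * θ * q) := by ring
            _ ≤ 10 * Cb * (S * G) ^ 2 * C := by gcongr
            _ ≤ 10 * (Cb + 1) * (S * G) ^ 2 * C := by gcongr; linarith
            _ = _ := by ring
        have h2 : 10 * (Cb + 1) * C * (S * G) ^ 2 ≤ Real.exp (-4) / 2 * q := by
          have h3 := mul_le_mul_of_nonneg_left hthr (by positivity : 0 ≤ Real.exp (-4) / 2)
          have h4 : Real.exp (-4) * Real.exp 4 = 1 := by rw [← Real.exp_add]; simp
          calc 10 * (Cb + 1) * C * (S * G) ^ 2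
              = (Real.exp (-4) * Real.exp 4) * (10 * (Cb + 1) * C * (S * G) ^ 2) := by
                rw [h4, one_mul]
            _ = Real.exp (-4) / 2 * (20 * Real.exp 4 * (Cb + 1) * C * (S * G) ^ 2) := by ring
            _ ≤ _ := h3
        exact le_of_mul_le_mul_right (h1.trans h2) hq0
      calc a2 * (T ^ 2 * Y j / (τ * (1 / 2) ^ j) ^ 2 + 1 / youngPsi k N T)
          ≤ a2 * θ := by rw [hθ]; gcongr
        _ = S ^ 2 * (Cb * (10 * (G ^ 2 * kappa k N j ^ 2))) * θ * Y j + s * θ := by rw [ha2]; ring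
        _ ≤ Real.exp (-4) / 2 * Y j + Real.exp (-4) / 2 * Y j := by
            have : s * θ = Real.exp (-4) / 2 * Y j := by rw [hs, div_mul_cancel₀ _ hθ0.ne']
            rw [this]
            gcongr
        _ = Y (j + 1) := by rw [hYs]; ring
  have hfm : ∀ i, Measurable fun x => ENNReal.ofReal (max (f i x - τ) 0 ^ 2) := fun i =>
    ((((hf.bLip i).sub_const τ).max_zero).continuous.measurable.pow_const 2).ennreal_ofReal
  -- How large i must be depends on j, so i → ∞ is taken first, by Fatou, and j → ∞ afterwards.
  have hfin : ∀ j, 1 ≤ j → ∫⁻ x in D', liminf (fun i => ENNReal.ofReal (max (f i x - τ) 0 ^ 2)) atTop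
      ∂(wMeasure w) ≤ ENNReal.ofReal (Y j) * wMeasure w U := by
    intro j hj
    refine (lintegral_liminf_le hfm).trans ((liminf_le_limsup).trans (limsup_le_of_le (h := ?_)))
    filter_upwards [claim j hj] with i hi
    refine le_trans ?_ hi
    refine (lintegral_mono fun x => ENNReal.ofReal_le_ofReal ?_).trans (lintegral_mono_set (hD' j hj))
    have := hcτ j
    exact pow_le_pow_left₀ (le_max_right _ _) (max_le_max (by linarith) le_rfl) 2
  have hYt : Tendsto (fun j => ENNReal.ofReal (Y j) * wMeasure w U) atTop (𝓝 0) := by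
    have h1 : Tendsto Y atTop (𝓝 0) := by
      have : Tendsto (fun j : ℕ => -(4 * (Q + (j : ℝ)))) atTop atBot :=
        tendsto_neg_atTop_atBot.comp ((tendsto_atTop_add_const_left _ Q
          tendsto_natCast_atTop_atTop).const_mul_atTop (by norm_num))
      simpa using (Real.tendsto_exp_atBot.comp this).const_mul (τ ^ 2)
    have h2 := ENNReal.tendsto_ofReal h1
    rw [ENNReal.ofReal_zero] at h2
    simpa using ENNReal.Tendsto.mul_const h2 (Or.inr hm.ne)
  have hzero : ∫⁻ x in D', liminf (fun i => ENNReal.ofReal (max (f i x - τ) 0 ^ 2)) atTop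
      ∂(wMeasure w) = 0 := by
    refine le_antisymm (ge_of_tendsto hYt ?_) zero_le
    filter_upwards [eventually_ge_atTop 1] with j hj using hfin j hj
  have hD'Ω : D' ⊆ Ω := (hD' 1 le_rfl).trans ((hD.subset 1 le_rfl).trans hUΩ)
  rw [lintegral_eq_zero_iff (Measurable.liminf hfm)] at hzero
  filter_upwards [hw.ae_of_ae hD'o.measurableSet hD'Ω hzero, hlim] with x h1 h2
  have h3 : Tendsto (fun i => ENNReal.ofReal (max (f i x - τ) 0 ^ 2)) atTop
      (𝓝 (ENNReal.ofReal (max (F x - τ) 0 ^ 2))) :=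
    ENNReal.tendsto_ofReal (((h2.sub_const τ).max tendsto_const_nhds).pow 2)
  rw [h3.liminf_eq] at h1
  simp only [Pi.zero_apply, ENNReal.ofReal_eq_zero] at h1
  have h4 : max (F x - τ) 0 = 0 := pow_eq_zero_iff two_ne_zero |>.1 (le_antisymm h1 (sq_nonneg _))
  have := le_max_left (F x - τ) 0
  linarith

end DeGiorgi

/-! ### Local boundedness and decay of the oscillation -/

section Oscillation

variable {n : ℕ} {Ω U U₀ : Set (E n)} {w : E n → ℝ} {A B : E n → Matrix (Fin n) (Fin n) ℝ}
  {k : ℕ} {N : ℝ} {V : ℕ → E n → ℝ} {u : E n → ℝ}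

/-- `V` is a sequence of Lipschitz approximate solutions that converges to `u`. -/
structure Approximates (A : E n → Matrix (Fin n) (Fin n) ℝ) (U : Set (E n)) (V : ℕ → E n → ℝ)
    (u : E n → ℝ) : Prop where
  isApprox : IsApprox A U V
  l2 : Tendsto (fun i => ∫⁻ x in U, ENNReal.ofReal ((V i x - u x) ^ 2)) atTop (𝓝 0)
  ae : ∀ᵐ x ∂(volume.restrict U), Tendsto (fun i => V i x) atTop (𝓝 (u x))

lemma Approximates.affine (hA : GoodCoef U A) (h : Approximates A U V u) (a b : ℝ) :
    Approximates A U (fun i x => a * V i x + b) (fun x => a * u x + b) where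
  isApprox := h.isApprox.affine hA a b
  l2 := by
    have e : ∀ i, ∫⁻ x in U, ENNReal.ofReal ((a * V i x + b - (a * u x + b)) ^ 2)
        = ENNReal.ofReal (a ^ 2) * ∫⁻ x in U, ENNReal.ofReal ((V i x - u x) ^ 2) := by
      intro i
      rw [← lintegral_const_mul' _ _ ENNReal.ofReal_ne_top]
      congr 1; funext x
      rw [← ENNReal.ofReal_mul (sq_nonneg a)]
      congr 1; ring
    simp only [e]
    simpa using ENNReal.Tendsto.const_mul h.l2 (Or.inr ENNReal.ofReal_ne_top)
  ae := h.ae.mono fun x hx => (hx.const_mul a).add_const b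

lemma Approximates.subseq (h : Approximates A U V u) {σ : ℕ → ℕ} (hσ : StrictMono σ) :
    Approximates A U (fun i => V (σ i)) u where
  isApprox := h.isApprox.subseq hσ
  l2 := h.l2.comp hσ.tendsto_atTop
  ae := h.ae.mono fun _ hx => hx.comp hσ.tendsto_atTop

lemma exists_exponent (hN : 1 < N) (K : ℝ) :
    ∃ Q : ℝ, expE k N ≤ Q ∧ K ≤ (Real.log^[k - 1] Q) ^ (N - 1) := by
  have h := ((tendsto_rpow_atTop (y := N - 1) (by linarith)).comp
    (tendsto_iterate_log (k - 1))).eventually_ge_atTop K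
  obtain ⟨Q, h1, h2⟩ := (h.and (eventually_ge_atTop (expE k N))).exists
  exact ⟨Q, h2, h1⟩

/-- On a fixed set S and G are fixed, so Q can simply be taken large, without any growth condition
on the superradius; τ is then chosen to match the uniform mean square bound of χV_i. -/
lemma exists_ae_le (hk : 1 ≤ k) (hN : 1 < N) {S Cb G : ℝ} (hA : GoodCoef U A) (hw : IsWeight Ω w)
    (hUΩ : U ⊆ Ω) (hCb : 0 ≤ Cb)
    (hB : ∀ᵐ x ∂(volume.restrict U), ∀ ξ : E n, ‖act (B x) ξ‖ ^ 2 ≤ Cb * quad (A x) ξ)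
    (hm0 : 0 < wMeasure w U) (hm : wMeasure w U < ∞)
    (hOS : OrliczSobolevOn w B (youngPhi k N) S U) {D : ℕ → Set (E n)} {ψ : ℕ → E n → ℝ}
    (hD : CutoffFamily A w U k N G D ψ) {D' : Set (E n)} (hD'o : IsOpen D')
    (hD' : ∀ j, 1 ≤ j → D' ⊆ D j) {χ : E n → ℝ} (hχ : χ ∈ LipC U) (hχ1 : ∀ x ∈ D 1, χ x = 1)
    (hV : Approximates A U V u) :
    ∃ τ : ℝ, ∀ᵐ x ∂(volume.restrict D'), u x ≤ τ := by
  obtain ⟨c₁, hc₁, hdG⟩ := exists_deGiorgi_constant hk hN hCb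
  obtain ⟨Q, hQ, hthr⟩ := exists_exponent (k := k) hN (c₁ * (S * G) ^ 2)
  have hsub := hV.isApprox.isSubSeq hA convexData_id (fun _ _ => trivial)
  have hχB := LipC.bLip hχ
  have := hA.isFiniteMeasure
  set mr := (wMeasure w U).toReal with hmr
  have hmr0 : 0 < mr := ENNReal.toReal_pos hm0.ne' hm.ne
  obtain ⟨M1, hM1⟩ := hV.isApprox.l2
  obtain ⟨M2, hM2⟩ := hV.isApprox.energy
  obtain ⟨P, hP⟩ := hχB.2
  obtain ⟨q, hq0, hq⟩ := hA.quad_gradient_le hχB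
  set M := 2 * (P ^ 2 * M2) + 2 * (q * M1) with hM
  have hDM : ∀ i, ∫ x in U, quad (A x) (gradient (fun y => χ y * V i y) x) ≤ M := by
    intro i
    have b := hV.isApprox.bLip i
    refine (integral_quad_mul_le hA hχB b).trans ?_
    rw [hM]
    gcongr
    · refine le_trans ?_ (mul_le_mul_of_nonneg_left (hM2 i) (sq_nonneg P))
      rw [← integral_const_mul]
      refine integral_mono_ae (hχB.integrable_sq_mul (hA.integrable_quad_gradient b))
        ((hA.integrable_quad_gradient b).const_mul _) ?_
      filter_upwards [hA.psd] with x hx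
      have := quad_nonneg hx (gradient (V i) x)
      have h2 : χ x ^ 2 ≤ P ^ 2 := by rw [← sq_abs]; gcongr; exact hP x
      gcongr
    · refine le_trans ?_ (mul_le_mul_of_nonneg_left (hM1 i) hq0)
      rw [← integral_const_mul]
      refine integral_mono_ae (b.integrable_sq_mul (hA.integrable_quad_gradient hχB))
        (b.integrable_sq.const_mul _) ?_
      filter_upwards [hq] with x hx
      rw [mul_comm q]
      gcongr
  set a2 := S ^ 2 * (Cb * |M|) / mr + 1 with ha2
  have ha20 : 0 < a2 := by positivity
  have hinit : ∀ i, ∫⁻ x in D 1, ENNReal.ofReal (V i x ^ 2) ∂(wMeasure w)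
      ≤ ENNReal.ofReal a2 * wMeasure w U := by
    intro i
    -- This is the case T = 0, where the support term disappears and Ψ(0) ≥ 1 gives a plain weighted
    -- Sobolev inequality.
    have h1 := hOS.lintegral_sq_le hN hCb hA hB hm0 hm (LipC.mul_bLip hχ (hV.isApprox.bLip i))
      ((hDM i).trans (le_abs_self M)) (a := Real.sqrt a2) (Real.sqrt_pos.2 ha20) (by
        rw [Real.sq_sqrt ha20.le, ha2, ← hmr, add_mul, div_mul_cancel₀ _ hmr0.ne']
        linarith) le_rfl
    rw [Real.sq_sqrt ha20.le] at h1
    calc ∫⁻ x in D 1, ENNReal.ofReal (V i x ^ 2) ∂(wMeasure w)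
        = ∫⁻ x in D 1, ENNReal.ofReal ((χ x * V i x) ^ 2) ∂(wMeasure w) :=
          setLIntegral_congr_fun (hD.isOpen 1).measurableSet fun x hx => by simp [hχ1 x hx]
      _ ≤ ∫⁻ x in U, ENNReal.ofReal ((χ x * V i x) ^ 2) ∂(wMeasure w) :=
          lintegral_mono_set (hD.subset 1 le_rfl)
      _ ≤ _ := h1
      _ ≤ ENNReal.ofReal a2 * (0 + wMeasure w U * 1) := by
          gcongr
          · simp
          · rw [ENNReal.ofReal_le_one]
            exact inv_le_one_of_one_le₀ (one_le_youngPsi hN 0)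
      _ = _ := by simp
  set τ := Real.sqrt (a2 * Real.exp (4 * (Q + 1))) with hτ
  have hτ2 : τ ^ 2 * Real.exp (-(4 * (Q + 1))) = a2 := by
    rw [hτ, Real.sq_sqrt (by positivity), mul_assoc, ← Real.exp_add]; simp
  refine ⟨τ, ?_⟩
  have hτ0 : 0 < τ := Real.sqrt_pos.2 (by positivity)
  have hres := hdG (F := fun x => max (u x) 0) (τ := τ) hA hw hUΩ hB hm0 hm hOS hD hsub hD'o hD'
    (by
      filter_upwards [ae_mono (Measure.restrict_mono ((hD' 1 le_rfl).trans (hD.subset 1 le_rfl))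
        le_rfl) hV.ae] with x hx
      exact hx.max tendsto_const_nhds) hQ hτ0 hthr
    (Eventually.of_forall fun i => by
      rw [hτ2]
      refine (lintegral_mono fun x => ENNReal.ofReal_le_ofReal (sq_le_sq.2 ?_)).trans (hinit i)
      rw [abs_of_nonneg (le_max_right _ _)]
      exact max_le (le_abs_self _) (abs_nonneg _))
  filter_upwards [hres] with x hx
  exact (le_max_left _ _).trans hx

/-- Improvement of the upper bound: if `u ≤ 1` and the approximations are nonpositive on half of
`D_1`, then `u` stays below `1` by a definite amount. -/
lemma exists_oscillation_constant (hk : 1 ≤ k) (hN : 1 < N) {Cb : ℝ} (hCb : 0 ≤ Cb) :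
    ∃ c₁ : ℝ, 0 < c₁ ∧ ∀ {n : ℕ} {Ω U U₀ P : Set (E n)} {w : E n → ℝ}
      {A B : E n → Matrix (Fin n) (Fin n) ℝ} {S G Cp g : ℝ} {D : ℕ → Set (E n)}
      {ψ : ℕ → E n → ℝ} {χ₀ χ : E n → ℝ} {V : ℕ → E n → ℝ} {u : E n → ℝ} {D' : Set (E n)}
      {Q τ : ℝ},
      GoodCoef U₀ A → IsWeight Ω w → IsOpen U → U ⊆ U₀ → U₀ ⊆ Ω →
      χ₀ ∈ LipC U₀ → (∀ x ∈ U, χ₀ x = 1) →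
      (∀ᵐ x ∂(volume.restrict U₀), ∀ ξ : E n, ‖act (B x) ξ‖ ^ 2 ≤ Cb * quad (A x) ξ) →
      0 < wMeasure w U → wMeasure w U < ∞ →
      OrliczSobolevOn w B (youngPhi k N) S U →
      CutoffFamily A w U k N G D ψ →
      IsOpen D' → (∀ j, 1 ≤ j → D' ⊆ D j) →
      IsOpen P → P ⊆ U → χ ∈ LipC U → (∀ x ∈ P, χ x = 1) → 0 ≤ g →
      (∀ᵐ x ∂(volume.restrict U), quad (A x) (gradient χ x) ≤ g * w x) →
      0 ≤ Cp → (∀ v : E n → ℝ, BLip v → (∃ T ⊆ D 1, wMeasure w (D 1) / 2 ≤ wMeasure w T ∧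
          ∀ y ∈ T, v y = 0) →
        ∫⁻ y in D 1, ENNReal.ofReal (v y ^ 2) ∂(wMeasure w) ≤
          ENNReal.ofReal Cp * ∫⁻ y in P, ENNReal.ofReal (‖gradA B v y‖ ^ 2)) →
      Approximates A U₀ V u → (∀ᵐ x ∂(volume.restrict U₀), u x ≤ 1) →
      (∀ i, wMeasure w (D 1) / 2 ≤ wMeasure w {y ∈ D 1 | V i y ≤ 0}) →
      expE k N ≤ Q → 0 < τ → c₁ * (S * G) ^ 2 ≤ (Real.log^[k - 1] Q) ^ (N - 1) →
      (4 * (Cp * Cb * g) + 1) * Real.exp (4 * (Q + 1)) ≤ τ ^ 2 →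
      ∀ᵐ x ∂(volume.restrict D'), u x ≤ 1 - Real.exp (-τ) / 2 := by
  obtain ⟨c₁, hc₁, hdG⟩ := exists_deGiorgi_constant hk hN hCb
  refine ⟨c₁, hc₁, ?_⟩
  intro n Ω U U₀ P w A B S G Cp g D ψ χ₀ χ V u D' Q τ hA₀ hw hU hUU₀ hU₀Ω hχ₀ hχ₀1 hB₀ hm0 hm hOS hD
    hD'o hD' hPo hPU hχ hχ1 hg hgrad hCp hPoin hV hu hhalf hQ hτ hthr hτQ
  have hA := hA₀.mono hU hUU₀
  have hB := ae_mono (Measure.restrict_mono hUU₀ le_rfl) hB₀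
  have hUΩ := hUU₀.trans hU₀Ω
  have hV₁ : IsApprox A U (fun i x => min (V i x) 1) :=
    hV.isApprox.min_one hA₀ hu hV.l2 hU hUU₀ hχ₀ hχ₀1
  -- With this δ, f ≤ τ gives 1 + δ - u ≥ (1 + δ)e^(-τ) ≥ 2δ, that is, u ≤ 1 - δ.
  set δ := Real.exp (-τ) / 2 with hδ
  have hδ0 : 0 < δ := by positivity
  obtain ⟨L, hL⟩ := convexData_log hδ0
  have h1 : ∀ i x, min (V i x) 1 ≤ 1 := fun i x => min_le_right _ _
  have hsub := hV₁.isSubSeq hA hL h1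
  obtain ⟨e, he, he0, hlog⟩ := hV₁.log_energy hA h1 hδ0 hχ
  set f : ℕ → E n → ℝ := fun i x =>
    max (Real.log (1 + δ) - Real.log (1 + δ - min (V i x) 1)) 0 with hf
  have hχB := LipC.bLip hχ
  set mr := (wMeasure w U).toReal with hmr
  have hmr0 : 0 < mr := ENNReal.toReal_pos hm0.ne' hm.ne
  have hmU : wMeasure w U = ENNReal.ofReal mr := (ENNReal.ofReal_toReal hm.ne).symm
  have hχE : ∫ x in U, quad (A x) (gradient χ x) ≤ g * mr := by
    have := integral_sq_mul_quad_le hA hw hUΩ hχ (BLip.const 1) hU le_rfl hχ.2.2 hg hgrad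
      zero_le_one hm (by simp)
    simpa using this
  have hCC : 0 ≤ Cp * Cb := by positivity
  -- The error is absorbed by the summand 1 in `4 * (Cp * Cb * g) + 1`.
  have hsmall : ∀ᶠ i in atTop, Cp * Cb * e i < mr := by
    have : Tendsto (fun i => Cp * Cb * e i) atTop (𝓝 0) := by simpa using he.const_mul (Cp * Cb)
    exact this.eventually_lt_const hmr0
  have hinit : ∀ᶠ i in atTop, ∫⁻ x in D 1, ENNReal.ofReal (f i x ^ 2) ∂(wMeasure w)
      ≤ ENNReal.ofReal (τ ^ 2 * Real.exp (-(4 * (Q + 1)))) * wMeasure w U := by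
    filter_upwards [hsmall] with i hi
    -- The function f_i vanishes where V_i ≤ 0, which is what makes the Poincaré inequality
    -- applicable.
    have hfz : ∀ y ∈ {y ∈ D 1 | V i y ≤ 0}, f i y = 0 := by
      intro y hy
      have h0 : V i y ≤ 0 := hy.2
      refine max_eq_right ?_
      rw [min_eq_left (by linarith)]
      have := Real.log_le_log (by linarith : 0 < 1 + δ) (by linarith : 1 + δ ≤ 1 + δ - V i y)
      linarith
    have hfP : ∫ x in P, quad (A x) (gradient (f i) x) ≤ 4 * (g * mr) + e i := by
      have j1 := hχB.integrable_sq_mul (hA.integrable_quad_gradient (hsub.bLip i))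
      calc ∫ x in P, quad (A x) (gradient (f i) x)
          = ∫ x in P, χ x ^ 2 * quad (A x) (gradient (f i) x) :=
            setIntegral_congr_fun hPo.measurableSet fun x hx => by simp [hχ1 x hx]
        _ ≤ ∫ x in U, χ x ^ 2 * quad (A x) (gradient (f i) x) :=
            setIntegral_mono_set j1
              (hA.psd.mono fun x hx => mul_nonneg (sq_nonneg _) (quad_nonneg hx _))
              (Eventually.of_forall hPU)
        _ ≤ _ := hlog i
        _ ≤ _ := by gcongr
    calc ∫⁻ x in D 1, ENNReal.ofReal (f i x ^ 2) ∂(wMeasure w)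
        ≤ ENNReal.ofReal Cp * ∫⁻ y in P, ENNReal.ofReal (‖gradA B (f i) y‖ ^ 2) :=
          hPoin (f i) (hsub.bLip i) ⟨_, Set.sep_subset _ _, hhalf i, hfz⟩
      _ ≤ ENNReal.ofReal Cp * ENNReal.ofReal (Cb * ∫ x in P, quad (A x) (gradient (f i) x)) := by
          gcongr
          exact lintegral_gradA_le hCb (hA.mono hPo hPU)
            (ae_mono (Measure.restrict_mono hPU le_rfl) hB) (hsub.bLip i)
      _ ≤ ENNReal.ofReal Cp * ENNReal.ofReal (Cb * (4 * (g * mr) + e i)) := by gcongr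
      _ = ENNReal.ofReal (Cp * (Cb * (4 * (g * mr) + e i))) := (ENNReal.ofReal_mul hCp).symm
      _ ≤ ENNReal.ofReal ((4 * (Cp * Cb * g) + 1) * mr) := by
          refine ENNReal.ofReal_le_ofReal ?_
          linarith
      _ ≤ ENNReal.ofReal (τ ^ 2 * Real.exp (-(4 * (Q + 1))) * mr) := by
          refine ENNReal.ofReal_le_ofReal (mul_le_mul_of_nonneg_right ?_ hmr0.le)
          rw [Real.exp_neg, ← div_eq_mul_inv, le_div_iff₀ (Real.exp_pos _)]
          exact hτQ
      _ = _ := by rw [hmU, ← ENNReal.ofReal_mul (by positivity)]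
  have hD'U : D' ⊆ U := (hD' 1 le_rfl).trans (hD.subset 1 le_rfl)
  have hle := Measure.restrict_mono (μ := (volume : Measure (E n))) (hD'U.trans hUU₀) le_rfl
  have hres := hdG (F := fun x => max (Real.log (1 + δ) - Real.log (1 + δ - min (u x) 1)) 0)
    hA hw hUΩ hB hm0 hm hOS hD hsub hD'o hD'
    (by
      filter_upwards [ae_mono hle hV.ae] with x hx
      have hne : 1 + δ - min (u x) 1 ≠ 0 := by
        have := min_le_right (u x) 1
        linarith
      exact (tendsto_const_nhds.sub ((tendsto_const_nhds.sub
        (hx.min tendsto_const_nhds)).log hne)).max tendsto_const_nhds) hQ hτ hthr hinit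
  filter_upwards [hres, ae_mono hle hu] with x h2 h3
  rw [min_eq_left h3] at h2
  have h4 : 0 < 1 + δ - u x := by linarith
  have h5 : Real.log (1 + δ) - τ ≤ Real.log (1 + δ - u x) := by
    have := (le_max_left _ _).trans h2
    linarith
  rw [Real.le_log_iff_exp_le h4, Real.exp_sub, Real.exp_log (by linarith)] at h5
  have h6 : Real.exp (-τ) ≤ (1 + δ) / Real.exp τ := by
    rw [Real.exp_neg, div_eq_mul_inv]
    exact le_mul_of_one_le_left (by positivity) (by linarith)
  have : δ + δ = Real.exp (-τ) := by rw [hδ]; ring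
  linarith

end Oscillation

/-! ### Metric balls -/

section Balls

variable {n : ℕ} {Ω : Set (E n)} {d : E n → E n → ℝ} {w : E n → ℝ}
  {A B : E n → Matrix (Fin n) (Fin n) ℝ} {k : ℕ} {N : ℝ}

lemma mball_subset (x : E n) (r : ℝ) : mball Ω d x r ⊆ Ω := fun _ h => h.1

lemma mball_mono (x : E n) {r s : ℝ} (h : r ≤ s) : mball Ω d x r ⊆ mball Ω d x s :=
  fun _ hy => ⟨hy.1, hy.2.trans_le h⟩

lemma mem_mball_self (hd : IsMetricOn Ω d) {x : E n} (hx : x ∈ Ω) {r : ℝ} (hr : 0 < r) :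
    x ∈ mball Ω d x r := ⟨hx, by rwa [(hd.eq_zero_iff x hx x hx).2 rfl]⟩

lemma IsAdaptedRadii.bounds (hk : 1 ≤ k) (hN : 1 < N) {r : ℝ} (hr : 0 < r) {ρ : ℕ → ℝ}
    (h : IsAdaptedRadii k N r ρ) {j : ℕ} (hj : 1 ≤ j) : r / 2 ≤ ρ j ∧ ρ j ≤ r := by
  obtain ⟨h1, ⟨c, hc, hstep⟩, hlim⟩ := h
  have hanti : ∀ i, 1 ≤ i → ρ (i + 1) ≤ ρ i := fun i hi => by
    have := hstep i hi
    have : 0 ≤ c * r / kappa k N i := div_nonneg (by positivity) (kappa_nonneg hk hN i)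
    linarith
  have hmono : ∀ i, 1 ≤ i → ∀ l, i ≤ l → ρ l ≤ ρ i := by
    intro i hi l hl
    induction l, hl using Nat.le_induction with
    | base => exact le_rfl
    | succ l hl ih => exact (hanti l (hi.trans hl)).trans ih
  refine ⟨le_of_tendsto hlim ?_, h1 ▸ hmono 1 le_rfl j hj⟩
  filter_upwards [eventually_ge_atTop j] with l hl using hmono j hj l hl

/-- The metric is not assumed to induce the Euclidean topology. Openness comes from the cutoffs:
around each point y of the ball, the Euclidean open set {ψ_1 ≠ 0} of a cutoff at y lies in a small
metric ball about y. -/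
lemma isOpen_mball (hd : IsMetricOn Ω d) (hk : 1 ≤ k) (hN : 1 < N)
    (hcut : ∀ x ∈ Ω, ∃ R > 0, ∃ C > 0, ∀ r, 0 < r → r < R → HasAdaptedCutoffs Ω d w B k N C x r)
    {x : E n} (hx : x ∈ Ω) (r : ℝ) : IsOpen (mball Ω d x r) := by
  rw [isOpen_iff_mem_nhds]
  intro y hy
  obtain ⟨R, hR, C, hC, h⟩ := hcut y hy.1
  have hs0 : 0 < min (r - d x y) R := lt_min (sub_pos.2 hy.2) hR
  set s := min (r - d x y) R / 2 with hs
  have hsp : 0 < s := by positivity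
  have hs1 : s < r - d x y := by
    have := min_le_left (r - d x y) R; linarith
  have hs2 : s < R := by
    have := min_le_right (r - d x y) R; linarith
  obtain ⟨ρ, ψ, hρ, hψ⟩ := h s hsp hs2
  obtain ⟨⟨K, hK⟩, hsupp, hone, -⟩ := hψ 1 le_rfl
  have hy1 : ψ 1 y = 1 := hone y (mem_mball_self hd hy.1
    (by linarith [(hρ.bounds hk hN hsp (j := 1 + 1) (by omega)).1]))
  have hmem : {z | ψ 1 z ≠ 0} ∈ 𝓝 y :=
    (isOpen_ne_fun hK.continuous continuous_const).mem_nhds (by simp [hy1])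
  refine mem_of_superset hmem fun z hz => ?_
  have hz' := hsupp (subset_tsupport _ hz)
  rw [hρ.1] at hz'
  refine ⟨hz'.1, ?_⟩
  have := hd.triangle x hx y hy.1 z hz'.1
  have := hz'.2
  linarith

/-- The supports are compact because they are closed and lie in the bounded set Ω. The lower bound c
ξᵀAξ ≤ |Bξ|² converts the bound on ∇_Aψ_j into one for the form of `A` and produces √c in the
constant. -/
lemma HasAdaptedCutoffs.exists_family (hΩb : Bornology.IsBounded Ω)
    (hk : 1 ≤ k) (hN : 1 < N)
    (hopen : ∀ x ∈ Ω, ∀ r, IsOpen (mball Ω d x r)) (hw : IsWeight Ω w) {c : ℝ} (hc : 0 < c)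
    (hB : ∀ᵐ x ∂(volume.restrict Ω), ∀ ξ : E n, c * quad (A x) ξ ≤ ‖act (B x) ξ‖ ^ 2)
    {C r : ℝ} (hr : 0 < r) {x : E n} (hx : x ∈ Ω)
    (h : HasAdaptedCutoffs Ω d w B k N C x r) {U : Set (E n)} (hU : mball Ω d x r ⊆ U)
    (hUΩ : U ⊆ Ω) :
    ∃ (D : ℕ → Set (E n)) (ψ : ℕ → E n → ℝ),
      CutoffFamily A w U k N (C / (r * Real.sqrt c)) D ψ ∧ D 1 = mball Ω d x r ∧
      (∀ j, 1 ≤ j → mball Ω d x (r / 2) ⊆ D j) := by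
  obtain ⟨ρ, ψ, hρ, hψ⟩ := h
  have hb := fun j (hj : 1 ≤ j) => hρ.bounds hk hN hr hj
  refine ⟨fun j => mball Ω d x (ρ j), ψ, ⟨fun j => hopen x hx _, fun j hj =>
    (mball_mono x (hb j hj).2).trans hU, fun j hj => ?_, fun j hj => (hψ j hj).2.1,
    fun j hj => (hψ j hj).2.2.1, fun j hj => ?_⟩, by simp only [hρ.1], fun j hj => mball_mono x (hb j hj).1⟩
  · refine ⟨(hψ j hj).1, ?_, (hψ j hj).2.1.trans ((mball_mono x (hb j hj).2).trans hU)⟩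
    exact Metric.isCompact_of_isClosed_isBounded (isClosed_tsupport _)
      (hΩb.subset ((hψ j hj).2.1.trans (mball_subset x _)))
  · have hle := Measure.restrict_mono (μ := (volume : Measure (E n))) hUΩ le_rfl
    filter_upwards [ae_mono hle hB, ae_mono hle (hψ j hj).2.2.2, hw.pos_restrict hUΩ]
      with y h1 h2 h3
    have h4 := h1 (gradient (ψ j) y)
    have hs : 0 < Real.sqrt (w y) := Real.sqrt_pos.2 h3
    rw [div_le_iff₀ hs] at h2
    have h5 : ‖gradA B (ψ j) y‖ ^ 2 ≤ (C * kappa k N j / r * Real.sqrt (w y)) ^ 2 := by gcongr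
    rw [mul_pow, Real.sq_sqrt h3.le] at h5
    have h6 : c * quad (A y) (gradient (ψ j) y) ≤ (C * kappa k N j / r) ^ 2 * w y := h4.trans h5
    rw [← le_div_iff₀' hc] at h6
    refine h6.trans_eq ?_
    rw [div_pow, div_pow, mul_pow, mul_pow, Real.sq_sqrt hc.le]
    field_simp

lemma kappa_one (hN : 1 < N) : kappa k N 1 = 1 := by
  rw [kappa, if_pos (by simpa using one_le_expE (k := k) hN)]; simp

/-- The first function ψ_1 serves, since κ(1) = 1. -/
lemma CutoffFamily.exists_cutoff (hN : 1 < N) {U : Set (E n)} {G : ℝ} {D : ℕ → Set (E n)}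
    {ψ : ℕ → E n → ℝ} (h : CutoffFamily A w U k N G D ψ) {D' : Set (E n)}
    (hD' : ∀ j, 1 ≤ j → D' ⊆ D j) :
    ∃ χ ∈ LipC U, (∀ x ∈ D', χ x = 1) ∧
      ∀ᵐ x ∂(volume.restrict U), quad (A x) (gradient χ x) ≤ G ^ 2 * w x := by
  refine ⟨ψ 1, h.lipC 1 le_rfl, fun x hx => h.eq_one 1 le_rfl x (hD' _ (by omega) hx), ?_⟩
  have := h.grad 1 le_rfl
  simpa [kappa_one hN] using this

end Balls

/-! ### Continuity from decay of the oscillation -/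

/-- Countably many basic open sets, rational centres and tolerances 1/(l+1) leave a set G of full
measure on which every almost everywhere oscillation bound holds pointwise. Then u restricted to Ω ∩
G, which is dense in Ω, has a limit at every point of Ω, and its extension by limits is the
continuous representative. -/
lemma exists_continuousOn_of_oscillation {n : ℕ} {Ω : Set (E n)} (hΩ : IsOpen Ω) {u : E n → ℝ}
    (h : ∀ x ∈ Ω, ∀ ε > 0, ∃ U : Set (E n), IsOpen U ∧ x ∈ U ∧ ∃ m : ℝ,
      ∀ᵐ y ∂(volume.restrict U), |u y - m| ≤ ε) :
    ∃ v : E n → ℝ, ContinuousOn v Ω ∧ u =ᵐ[volume.restrict Ω] v := by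
  set 𝓑 := TopologicalSpace.countableBasis (E n) with h𝓑
  have h𝓑c : 𝓑.Countable := TopologicalSpace.countable_countableBasis _
  set G : Set (E n) := {y | ∀ b ∈ 𝓑, ∀ (q : ℚ) (l : ℕ),
    (∀ᵐ z ∂(volume.restrict b), |u z - q| ≤ 1 / ((l : ℝ) + 1)) → y ∈ b →
      |u y - q| ≤ 1 / ((l : ℝ) + 1)} with hG
  have hGae : ∀ᵐ y ∂(volume : Measure (E n)), y ∈ G := by
    refine (ae_ball_iff h𝓑c).2 fun b hb => ae_all_iff.2 fun q => ae_all_iff.2 fun l => ?_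
    by_cases hP : ∀ᵐ z ∂(volume.restrict b), |u z - q| ≤ 1 / ((l : ℝ) + 1)
    · have hbm : MeasurableSet b :=
        ((TopologicalSpace.isBasis_countableBasis (E n)).isOpen hb).measurableSet
      filter_upwards [(ae_restrict_iff' hbm).1 hP] with y hy _ hyb using hy hyb
    · exact Eventually.of_forall fun y h => absurd h hP
  have hdense : Ω ⊆ closure (Ω ∩ G) := by
    intro x hx
    rw [mem_closure_iff]
    intro W hW hxW
    by_contra hne
    rw [Set.not_nonempty_iff_eq_empty] at hne
    have hpos := (hW.inter hΩ).measure_pos volume ⟨x, hxW, hx⟩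
    refine hpos.ne' (measure_mono_null (fun y hy => ?_) hGae)
    intro hyG
    have : y ∈ W ∩ (Ω ∩ G) := ⟨hy.1, hy.2, hyG⟩
    simp [hne] at this
  have hlim : ∀ x ∈ Ω, ∃ y, Tendsto u (𝓝[Ω ∩ G] x) (𝓝 y) := by
    intro x hx
    have hne : (𝓝[Ω ∩ G] x).NeBot := mem_closure_iff_nhdsWithin_neBot.1 (hdense hx)
    refine cauchy_map_iff_exists_tendsto.1 (Metric.cauchy_iff.2 ⟨inferInstance, fun ε hε => ?_⟩)
    obtain ⟨l, hl⟩ := exists_nat_one_div_lt (show 0 < ε / 2 by positivity)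
    have hl0 : 0 < 1 / ((l : ℝ) + 1) := by positivity
    obtain ⟨U, hU, hxU, m, hm⟩ := h x hx (1 / ((l : ℝ) + 1) / 2) (by positivity)
    obtain ⟨q, hq1, hq2⟩ := exists_rat_btwn (show m < m + 1 / ((l : ℝ) + 1) / 2 by linarith)
    obtain ⟨b, hb, hxb, hbU⟩ :=
      (TopologicalSpace.isBasis_countableBasis (E n)).exists_subset_of_mem_open hxU hU
    have hbq : ∀ᵐ z ∂(volume.restrict b), |u z - q| ≤ 1 / ((l : ℝ) + 1) := by
      filter_upwards [ae_mono (Measure.restrict_mono hbU le_rfl) hm] with z hz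
      rw [abs_le] at hz ⊢
      constructor <;> linarith [hz.1, hz.2]
    have hbo := (TopologicalSpace.isBasis_countableBasis (E n)).isOpen hb
    refine ⟨u '' (b ∩ (Ω ∩ G)), image_mem_map (inter_mem (mem_nhdsWithin_of_mem_nhds (hbo.mem_nhds hxb))
      self_mem_nhdsWithin), ?_⟩
    rintro _ ⟨y, ⟨hyb, -, hyG⟩, rfl⟩ _ ⟨z, ⟨hzb, -, hzG⟩, rfl⟩
    have h1 := abs_le.1 (hyG b hb q l hbq hyb)
    have h2 := abs_le.1 (hzG b hb q l hbq hzb)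
    rw [Real.dist_eq, abs_lt]
    constructor <;> linarith [h1.1, h1.2, h2.1, h2.2]
  refine ⟨extendFrom (Ω ∩ G) u, continuousOn_extendFrom hdense hlim, ?_⟩
  filter_upwards [ae_restrict_mem hΩ.measurableSet, ae_restrict_of_ae hGae] with x hx hxG
  obtain ⟨y, hy⟩ := hlim x hx
  have : y = u x := tendsto_nhds_unique (hy.mono_left (pure_le_nhdsWithin ⟨hx, hxG⟩))
    (tendsto_pure_nhds u x)
  rw [extendFrom_eq (hdense hx) hy, this]

/-! ### The hypotheses at one point and the iteration over shrinking balls -/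

section Final

variable {n : ℕ} {Ω : Set (E n)} {d : E n → E n → ℝ} {w : E n → ℝ}
  {A B : E n → Matrix (Fin n) (Fin n) ℝ} {k : ℕ} {N : ℝ} {V : ℕ → E n → ℝ} {u : E n → ℝ}

lemma Approximates.mono {U U' : Set (E n)} (hA : GoodCoef U A) (h : Approximates A U V u)
    (hU : U' ⊆ U) : Approximates A U' V u where
  isApprox := h.isApprox.mono hA hU
  l2 := tendsto_of_tendsto_of_tendsto_of_le_of_le tendsto_const_nhds h.l2 (fun _ => zero_le)
    fun _ => lintegral_mono_set hU
  ae := ae_mono (Measure.restrict_mono hU le_rfl) h.ae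

/-- The hypotheses of the continuity theorem at the point `x`, for all radii below `R`. -/
structure LocalHyp (Ω : Set (E n)) (d : E n → E n → ℝ) (w : E n → ℝ)
    (A B : E n → Matrix (Fin n) (Fin n) ℝ) (k : ℕ) (N : ℝ) (φ : ℝ → ℝ) (c Cb C₁ C₂ C₃ R : ℝ)
    (x : E n) : Prop where
  metric : IsMetricOn Ω d
  bdd : Bornology.IsBounded Ω
  coef : GoodCoef Ω A
  weight : IsWeight Ω w
  isOpen : ∀ x ∈ Ω, ∀ r, IsOpen (mball Ω d x r)
  k_pos : 1 ≤ k
  one_lt : 1 < N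
  c_pos : 0 < c
  Cb_pos : 0 < Cb
  lower : ∀ᵐ x ∂(volume.restrict Ω), ∀ ξ : E n, c * quad (A x) ξ ≤ ‖act (B x) ξ‖ ^ 2
  upper : ∀ᵐ x ∂(volume.restrict Ω), ∀ ξ : E n, ‖act (B x) ξ‖ ^ 2 ≤ Cb * quad (A x) ξ
  mem : x ∈ Ω
  C₁_pos : 0 < C₁
  C₃_pos : 0 < C₃
  R_pos : 0 < R
  poincare : ∀ r, 0 < r → r < R → ProportionalPoincare Ω d w B C₁ x r
  orlicz : ∀ r, 0 < r → r < R → OrliczSobolev Ω d w B (youngPhi k N) φ C₂ x r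
  cutoffs : ∀ r, 0 < r → r < R → HasAdaptedCutoffs Ω d w B k N C₃ x r

namespace LocalHyp

variable {φ : ℝ → ℝ} {c Cb C₁ C₂ C₃ R : ℝ} {x : E n}

lemma family (h : LocalHyp Ω d w A B k N φ c Cb C₁ C₂ C₃ R x) {r : ℝ} (hr : 0 < r) (hrR : r < R)
    {U : Set (E n)} (hU : mball Ω d x r ⊆ U) (hUΩ : U ⊆ Ω) :
    ∃ (D : ℕ → Set (E n)) (ψ : ℕ → E n → ℝ),
      CutoffFamily A w U k N (C₃ / (r * Real.sqrt c)) D ψ ∧ D 1 = mball Ω d x r ∧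
      (∀ j, 1 ≤ j → mball Ω d x (r / 2) ⊆ D j) :=
  HasAdaptedCutoffs.exists_family h.bdd h.k_pos h.one_lt h.isOpen h.weight h.c_pos h.lower hr
    h.mem (h.cutoffs r hr hrR) hU hUΩ

lemma cutoff (h : LocalHyp Ω d w A B k N φ c Cb C₁ C₂ C₃ R x) {r : ℝ} (hr : 0 < r) (hrR : r < R) :
    ∃ χ ∈ LipC (mball Ω d x r), (∀ y ∈ mball Ω d x (r / 2), χ y = 1) ∧
      ∀ᵐ y ∂(volume.restrict (mball Ω d x r)),
        quad (A y) (gradient χ y) ≤ (C₃ / (r * Real.sqrt c)) ^ 2 * w y := by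
  obtain ⟨D, ψ, hD, -, hD'⟩ := h.family hr hrR (U := mball Ω d x r) le_rfl (mball_subset x r)
  exact hD.exists_cutoff h.one_lt hD'

lemma goodCoef (h : LocalHyp Ω d w A B k N φ c Cb C₁ C₂ C₃ R x) (r : ℝ) :
    GoodCoef (mball Ω d x r) A :=
  h.coef.mono (h.isOpen x h.mem r) (mball_subset x r)

lemma upper_mball (h : LocalHyp Ω d w A B k N φ c Cb C₁ C₂ C₃ R x) (r : ℝ) :
    ∀ᵐ y ∂(volume.restrict (mball Ω d x r)), ∀ ξ : E n,
      ‖act (B y) ξ‖ ^ 2 ≤ Cb * quad (A y) ξ :=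
  ae_mono (Measure.restrict_mono (mball_subset x r) le_rfl) h.upper

lemma measure_pos (h : LocalHyp Ω d w A B k N φ c Cb C₁ C₂ C₃ R x) {r : ℝ} (hr : 0 < r) :
    0 < wMeasure w (mball Ω d x r) :=
  h.weight.measure_pos (h.isOpen x h.mem r) ⟨x, mem_mball_self h.metric h.mem hr⟩
    (mball_subset x r)

/-- The weight is only locally integrable, but the cutoff for radius 2r places the ball inside a
compact subset of Ω. -/
lemma measure_lt_top (h : LocalHyp Ω d w A B k N φ c Cb C₁ C₂ C₃ R x) {r : ℝ} (hr : 0 < r)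
    (hrR : 2 * r < R) : wMeasure w (mball Ω d x r) < ∞ := by
  obtain ⟨χ, hχ, hχ1, -⟩ := h.cutoff (r := 2 * r) (by positivity) hrR
  refine (measure_mono fun y hy => ?_).trans_lt
    (h.weight.measure_compact_lt_top hχ.2.1 (hχ.2.2.trans (mball_subset x _)))
  refine subset_tsupport _ ?_
  rw [Function.mem_support, hχ1 y (by rwa [mul_div_cancel_left₀ _ two_ne_zero])]
  exact one_ne_zero

/-- The upper bound is applied to u and to -u. -/
lemma exists_abs_le (h : LocalHyp Ω d w A B k N φ c Cb C₁ C₂ C₃ R x) {r : ℝ} (hr : 0 < r)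
    (hrR : 4 * r < R) (hV : Approximates A (mball Ω d x (2 * r)) V u) :
    ∃ M : ℝ, ∀ᵐ y ∂(volume.restrict (mball Ω d x (r / 2))), |u y| ≤ M := by
  have hA := h.goodCoef (2 * r)
  have h2r : 0 < 2 * r := by positivity
  obtain ⟨D, ψ, hD, hD1, hD'⟩ := h.family hr (by linarith) (U := mball Ω d x (2 * r))
    (mball_mono x (by linarith)) (mball_subset x _)
  obtain ⟨χ, hχ, hχ1, -⟩ := h.cutoff h2r (by linarith)
  have hχ1' : ∀ y ∈ D 1, χ y = 1 := fun y hy => hχ1 y (by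
    rwa [mul_div_cancel_left₀ _ two_ne_zero, ← hD1])
  have key : ∀ {V : ℕ → E n → ℝ} {u : E n → ℝ}, Approximates A (mball Ω d x (2 * r)) V u →
      ∃ τ : ℝ, ∀ᵐ y ∂(volume.restrict (mball Ω d x (r / 2))), u y ≤ τ := fun hV =>
    exists_ae_le h.k_pos h.one_lt hA h.weight (mball_subset x _) h.Cb_pos.le (h.upper_mball _)
      (h.measure_pos h2r) (h.measure_lt_top h2r (by linarith))
      (h.orlicz (2 * r) h2r (by linarith)) hD (h.isOpen x h.mem _) hD' hχ hχ1' hV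
  obtain ⟨τ₁, h1⟩ := key hV
  obtain ⟨τ₂, h2⟩ := key (hV.affine hA (-1) 0)
  refine ⟨max τ₁ τ₂, ?_⟩
  filter_upwards [h1, h2] with y e1 e2
  refine abs_le.2 ⟨?_, e1.trans (le_max_left _ _)⟩
  linarith [le_max_right τ₁ τ₂]

/-- Decay of the oscillation between two concentric balls. -/
lemma oscillation_decay (h : LocalHyp Ω d w A B k N φ c Cb C₁ C₂ C₃ R x) {b C₀ r₀ R₀ : ℝ}
    (hb : 2 * b < N - 1) (hr₀ : 0 < r₀) (hR₀ : 0 < R₀)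
    (hφ : ∀ r ∈ Set.Icc 0 R₀, 0 ≤ φ r)
    (hgrowth : ∀ r, 0 < r → r < r₀ → φ r ≤ C₀ * r * (Real.log^[k + 2] (1 / r)) ^ b) :
    ∃ rs > 0, ∀ r, 0 < r → r < rs → 1 ≤ Real.log (1 / (3 * r)) ∧
      ∀ {V : ℕ → E n → ℝ} {u : E n → ℝ}, Approximates A (mball Ω d x (6 * r)) V u →
      ∀ m ω : ℝ, 0 < ω →
        (∀ᵐ y ∂(volume.restrict (mball Ω d x (6 * r))), m ≤ u y ∧ u y ≤ m + ω) →
        ∃ m' : ℝ, ∀ᵐ y ∂(volume.restrict (mball Ω d x (r / 2))),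
          m' ≤ u y ∧ u y ≤ m' + ω * (1 - 1 / (4 * Real.log (1 / (3 * r)))) := by
  have hs := Real.sqrt_pos.2 h.c_pos
  have hC₁ := h.C₁_pos
  have hC₃ := h.C₃_pos
  have hCb := h.Cb_pos
  obtain ⟨c₁, hc₁, hosc⟩ := exists_oscillation_constant h.k_pos h.one_lt h.Cb_pos.le
  -- With S = C₂φ(3r) and G = C₃/(r√c), the growth bound on φ(3r) cancels the powers of r in SG and
  -- leaves a constant times (ln^(k+2)(1/(3r)))^b.
  set K := c₁ * (3 * C₂ * C₀ * C₃ / Real.sqrt c) ^ 2 with hK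
  set g₀ := C₃ ^ 2 / (9 * c) with hg₀
  have hev := (eventually_exists_exponent h.k_pos hb K (4 * (C₁ * Cb * g₀) + 1)).and
    (((tendsto_iterate_log 2).eventually_gt_atTop 0).and
    (Real.tendsto_log_atTop.eventually_ge_atTop 1))
  obtain ⟨t₀, ht₀⟩ := eventually_atTop.1 hev
  refine ⟨min (min (R / 6) (r₀ / 3)) (min (R₀ / 3) (1 / (3 * (|t₀| + 1)))), by
    have := h.R_pos
    positivity, fun r hr hrs => ?_⟩
  have hr1 : 6 * r < R := by
    have := hrs.trans_le ((min_le_left _ _).trans (min_le_left _ _)); linarith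
  have hr2 : 3 * r < r₀ := by
    have := hrs.trans_le ((min_le_left _ _).trans (min_le_right _ _)); linarith
  have hr3 : 3 * r < R₀ := by
    have := hrs.trans_le ((min_le_right _ _).trans (min_le_left _ _)); linarith
  have hr4 : t₀ ≤ 1 / (3 * r) := by
    have h1 := hrs.trans_le ((min_le_right _ _).trans (min_le_right _ _))
    rw [lt_div_iff₀ (by positivity)] at h1
    rw [le_div_iff₀ (by positivity)]
    nlinarith [le_abs_self t₀]
  obtain ⟨⟨Q, hQ, hthr, hτQ⟩, hτ, hlog1⟩ := ht₀ _ hr4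
  refine ⟨hlog1, ?_⟩
  intro V u hV m ω hω hu
  have h3r : 0 < 3 * r := by positivity
  have h6r : 0 < 6 * r := by positivity
  -- This makes e^(-τ) = 1/ln(1/(3r)), just large enough for a divergent sum over geometric radii.
  set τ := Real.log (Real.log (1 / (3 * r))) with hτdef
  have hτ0 : 0 < τ := hτ
  have hexpτ : Real.exp (-τ) = 1 / Real.log (1 / (3 * r)) := by
    rw [Real.exp_neg, hτdef, Real.exp_log (by linarith)]
    exact (one_div _).symm
  obtain ⟨D, ψ, hD, hD1, hD'⟩ := h.family hr (by linarith) (U := mball Ω d x (3 * r))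
    (mball_mono x (by linarith)) (mball_subset x _)
  obtain ⟨χ₀, hχ₀, hχ₀1, -⟩ := h.cutoff h6r (by linarith)
  obtain ⟨χ, hχ, hχ1, hχg⟩ := h.cutoff h3r (by linarith)
  have e6 : 6 * r / 2 = 3 * r := by ring
  have e3 : 3 * r / 2 = 3 / 2 * r := by ring
  rw [e6] at hχ₀1
  rw [e3] at hχ1
  have hthr' : c₁ * (C₂ * φ (3 * r) * (C₃ / (r * Real.sqrt c))) ^ 2
      ≤ (Real.log^[k - 1] Q) ^ (N - 1) := by
    refine le_trans ?_ hthr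
    have g1 := hgrowth (3 * r) h3r hr2
    have g0 := hφ (3 * r) ⟨h3r.le, hr3.le⟩
    rw [hK, mul_assoc c₁ ((3 * C₂ * C₀ * C₃ / Real.sqrt c) ^ 2), ← mul_pow]
    refine mul_le_mul_of_nonneg_left ?_ hc₁.le
    set z := (Real.log^[k + 2] (1 / (3 * r))) ^ b
    have e1 : (C₂ * φ (3 * r) * (C₃ / (r * Real.sqrt c))) ^ 2
        = φ (3 * r) ^ 2 * (C₂ * (C₃ / (r * Real.sqrt c))) ^ 2 := by ring
    have e2 : (3 * C₂ * C₀ * C₃ / Real.sqrt c * z) ^ 2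
        = (C₀ * (3 * r) * z) ^ 2 * (C₂ * (C₃ / (r * Real.sqrt c))) ^ 2 := by
      field_simp
    rw [e1, e2]
    gcongr
  have hg : C₁ * r ^ 2 * Cb * (C₃ / (3 * r * Real.sqrt c)) ^ 2 = C₁ * Cb * g₀ := by
    rw [hg₀, div_pow, mul_pow, Real.sq_sqrt h.c_pos.le]
    field_simp
    ring
  have hPoin : ∀ v : E n → ℝ, BLip v →
      (∃ T ⊆ D 1, wMeasure w (D 1) / 2 ≤ wMeasure w T ∧ ∀ y ∈ T, v y = 0) →
      ∫⁻ y in D 1, ENNReal.ofReal (v y ^ 2) ∂(wMeasure w) ≤ ENNReal.ofReal (C₁ * r ^ 2) *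
        ∫⁻ y in mball Ω d x (3 / 2 * r), ENNReal.ofReal (‖gradA B v y‖ ^ 2) := by
    intro v hv hT
    rw [hD1] at hT ⊢
    obtain ⟨L, hL⟩ := hv.1
    exact h.poincare r hr (by linarith) v ⟨L, hL.lipschitzOnWith⟩ hT
  have key : ∀ {V : ℕ → E n → ℝ} {u : E n → ℝ}, Approximates A (mball Ω d x (6 * r)) V u →
      (∀ᵐ y ∂(volume.restrict (mball Ω d x (6 * r))), u y ≤ 1) →
      (∃ᶠ i in atTop, wMeasure w (D 1) / 2 ≤ wMeasure w {y ∈ D 1 | V i y ≤ 0}) →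
      ∀ᵐ y ∂(volume.restrict (mball Ω d x (r / 2))), u y ≤ 1 - Real.exp (-τ) / 2 := by
    intro V u hV hu hfr
    -- The sign condition is only known for infinitely many i; approximation survives on a
    -- subsequence.
    obtain ⟨σ, hσ, hhalf⟩ := extraction_of_frequently_atTop hfr
    exact hosc (h.goodCoef (6 * r)) h.weight (h.isOpen x h.mem (3 * r))
      (mball_mono x (by linarith)) (mball_subset x _) hχ₀ hχ₀1 (h.upper_mball _)
      (h.measure_pos h3r) (h.measure_lt_top h3r (by linarith)) (h.orlicz (3 * r) h3r (by linarith))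
      hD (h.isOpen x h.mem _) hD' (h.isOpen x h.mem (3 / 2 * r)) (mball_mono x (by linarith)) hχ hχ1
      (sq_nonneg _) hχg (by positivity) hPoin (hV.subseq hσ) hu hhalf hQ hτ0 hthr'
      (by rw [hg]; exact hτQ)
  have hA6 := h.goodCoef (6 * r)
  -- The first map takes [m, m + ω] to [-1, 1]; the second is its negative. At each point one of the
  -- two scaled functions is nonpositive, so for each i one of them is so on half of D_1, and one
  -- alternative recurs infinitely often.
  have hV₁ := hV.affine hA6 (2 / ω) (-(2 / ω * m) - 1)
  have hV₂ := hV.affine hA6 (-(2 / ω)) (2 / ω * m + 1)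
  have hdich : (∃ᶠ i in atTop, wMeasure w (D 1) / 2 ≤
        wMeasure w {y ∈ D 1 | 2 / ω * V i y + (-(2 / ω * m) - 1) ≤ 0}) ∨
      ∃ᶠ i in atTop, wMeasure w (D 1) / 2 ≤
        wMeasure w {y ∈ D 1 | -(2 / ω) * V i y + (2 / ω * m + 1) ≤ 0} := by
    rw [← frequently_or_distrib]
    refine Eventually.frequently (Eventually.of_forall fun i => ?_)
    by_contra hcon
    rw [not_or, not_le, not_le] at hcon
    have hcov : D 1 ⊆ {y ∈ D 1 | 2 / ω * V i y + (-(2 / ω * m) - 1) ≤ 0} ∪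
        {y ∈ D 1 | -(2 / ω) * V i y + (2 / ω * m + 1) ≤ 0} := by
      intro y hy
      rcases le_total (2 / ω * V i y + (-(2 / ω * m) - 1)) 0 with h0 | h0
      · exact Or.inl ⟨hy, h0⟩
      · exact Or.inr ⟨hy, by linarith⟩
    have h1 := (measure_mono (μ := wMeasure w) hcov).trans (measure_union_le _ _)
    have h2 := ENNReal.add_lt_add hcon.1 hcon.2
    rw [ENNReal.add_halves] at h2
    exact absurd (h1.trans_lt h2) (lt_irrefl _)
  have hexp : ω * (1 - 1 / (4 * Real.log (1 / (3 * r)))) = ω - ω * Real.exp (-τ) / 4 := by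
    rw [hexpτ]
    field_simp
  have hsub : mball Ω d x (r / 2) ⊆ mball Ω d x (6 * r) := mball_mono x (by linarith)
  have hu' := ae_mono (Measure.restrict_mono hsub le_rfl) hu
  have hscale : ∀ y, 2 / ω * u y + (-(2 / ω * m) - 1) = 2 / ω * (u y - m) - 1 := fun y => by ring
  have hscale' : ∀ y, -(2 / ω) * u y + (2 / ω * m + 1) = 1 - 2 / ω * (u y - m) := fun y => by ring
  rcases hdich with hfr | hfr
  · have hres := key hV₁ (by
      filter_upwards [hu] with y hy
      rw [hscale]
      have : 2 / ω * (u y - m) ≤ 2 / ω * ω := by gcongr; linarith [hy.2]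
      rw [div_mul_cancel₀ _ hω.ne'] at this
      linarith) hfr
    refine ⟨m, ?_⟩
    filter_upwards [hres, hu'] with y h1 h2
    refine ⟨h2.1, ?_⟩
    rw [hscale] at h1
    have h3 : 2 / ω * (u y - m) ≤ 2 - Real.exp (-τ) / 2 := by linarith
    rw [div_mul_eq_mul_div, div_le_iff₀ hω] at h3
    rw [hexp]
    linarith
  · have hres := key hV₂ (by
      filter_upwards [hu] with y hy
      rw [hscale']
      have : 0 ≤ 2 / ω * (u y - m) := mul_nonneg (by positivity) (by linarith [hy.1])
      linarith) hfr
    refine ⟨m + ω * Real.exp (-τ) / 4, ?_⟩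
    filter_upwards [hres, hu'] with y h1 h2
    rw [hscale'] at h1
    have h3 : Real.exp (-τ) / 2 ≤ 2 / ω * (u y - m) := by linarith
    rw [div_mul_eq_mul_div, le_div_iff₀ hω] at h3
    rw [hexp]
    exact ⟨by linarith, by linarith [h2.2]⟩

end LocalHyp

/-- A product of factors `1 - 1 / (4 log(1 / (3 r_j)))` along geometric radii tends to `0`. -/
lemma tendsto_prod_log_zero {s : ℝ} (hs : 0 < s) (h1 : ∀ j : ℕ, 1 ≤ Real.log (1 / (3 * (s / 12 ^ j)))) :
    Tendsto (fun j => ∏ i ∈ Finset.range j, (1 - 1 / (4 * Real.log (1 / (3 * (s / 12 ^ i))))))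
      atTop (𝓝 0) := by
  set a : ℕ → ℝ := fun i => 1 / (4 * Real.log (1 / (3 * (s / 12 ^ i)))) with ha
  -- The logarithm is affine in i, so a_i dominates a multiple of the harmonic series.
  have hlog : ∀ i : ℕ, Real.log (1 / (3 * (s / 12 ^ i))) = Real.log (1 / (3 * s)) + i * Real.log 12 := by
    intro i
    rw [← Real.log_pow, ← Real.log_mul (by positivity) (by positivity)]
    congr 1
    field_simp
  have h10 : 1 ≤ Real.log (1 / (3 * s)) := by simpa using h1 0
  have hl12 : 0 < Real.log 12 := Real.log_pos (by norm_num)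
  set M := Real.log (1 / (3 * s)) + Real.log 12 with hM
  have hM0 : 0 < M := by positivity
  have ha_ge : ∀ i : ℕ, 1 / (4 * M) * (1 / ((i : ℝ) + 1)) ≤ a i := by
    intro i
    simp only [ha]
    rw [one_div_mul_one_div]
    have := h1 i
    refine one_div_le_one_div_of_le (by positivity) ?_
    rw [hlog, hM]
    nlinarith [(Nat.cast_nonneg i : (0 : ℝ) ≤ i)]
  have hdiv : Tendsto (fun j => ∑ i ∈ Finset.range j, a i) atTop atTop := by
    refine tendsto_atTop_mono (fun j => ?_)
      (Real.tendsto_sum_range_one_div_nat_succ_atTop.const_mul_atTop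
        (show 0 < 1 / (4 * M) by positivity))
    rw [Finset.mul_sum]
    exact Finset.sum_le_sum fun i _ => ha_ge i
  have ha1 : ∀ i, a i ≤ 1 := fun i => by
    have := h1 i
    simp only [ha]
    rw [div_le_one (by positivity)]
    linarith
  refine tendsto_of_tendsto_of_tendsto_of_le_of_le tendsto_const_nhds
    (Real.tendsto_exp_atBot.comp (tendsto_neg_atTop_atBot.comp hdiv))
    (fun j => Finset.prod_nonneg fun i _ => by linarith [ha1 i]) fun j => ?_
  simp only [Function.comp_apply]
  rw [← Finset.sum_neg_distrib, Real.exp_sum]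
  exact Finset.prod_le_prod (fun i _ => by linarith [ha1 i])
    fun i _ => by linarith [Real.add_one_le_exp (-a i)]

lemma LocalHyp.exists_small_oscillation {φ : ℝ → ℝ} {c Cb C₁ C₂ C₃ R : ℝ} {x : E n}
    (h : LocalHyp Ω d w A B k N φ c Cb C₁ C₂ C₃ R x) {b C₀ r₀ R₀ : ℝ}
    (hb : 2 * b < N - 1) (hr₀ : 0 < r₀) (hR₀ : 0 < R₀) (hφ : ∀ r ∈ Set.Icc 0 R₀, 0 ≤ φ r)
    (hgrowth : ∀ r, 0 < r → r < r₀ → φ r ≤ C₀ * r * (Real.log^[k + 2] (1 / r)) ^ b)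
    (hu : IsWeakSolution Ω A u) {ε : ℝ} (hε : 0 < ε) :
    ∃ U : Set (E n), IsOpen U ∧ x ∈ U ∧ ∃ m : ℝ, ∀ᵐ y ∂(volume.restrict U), |u y - m| ≤ ε := by
  have hR := h.R_pos
  set r₁ := R / 10 with hr₁
  have hr₁0 : 0 < r₁ := by positivity
  obtain ⟨χ, hχ, hχ1, -⟩ := h.cutoff (r := 4 * r₁) (by positivity) (by rw [hr₁]; linarith)
  rw [show 4 * r₁ / 2 = 2 * r₁ by ring] at hχ1
  have hA := h.goodCoef (2 * r₁)
  obtain ⟨V, hV1, hV2, hV3⟩ := hu.exists_isApprox h.coef (h.isOpen x h.mem (2 * r₁))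
    (LipC.mono (mball_subset x _) hχ) (mball_subset x _) hχ1
  have hV : Approximates A (mball Ω d x (2 * r₁)) V u := ⟨hV1, hV2, hV3⟩
  obtain ⟨M, hM⟩ := h.exists_abs_le hr₁0 (by rw [hr₁]; linarith) hV
  obtain ⟨rs, hrs0, hdecay⟩ := h.oscillation_decay hb hr₀ hR₀ hφ hgrowth
  set s := min (rs / 2) (r₁ / 12) with hs
  have hs0 : 0 < s := by positivity
  have hpow : ∀ j : ℕ, s / 12 ^ j ≤ s := fun j =>
    div_le_self hs0.le (one_le_pow₀ (by norm_num))
  have hsr : ∀ j : ℕ, s / 12 ^ j < rs := fun j => by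
    have := hpow j
    have := min_le_left (rs / 2) (r₁ / 12)
    linarith
  have hsj : ∀ j : ℕ, 0 < s / 12 ^ j := fun j => by positivity
  have hs1 : s ≤ r₁ / 12 := min_le_right _ _
  set ω₀ := 2 * |M| + 1 with hω₀
  have hω₀0 : 0 < ω₀ := by positivity
  set f : ℕ → ℝ := fun i => 1 - 1 / (4 * Real.log (1 / (3 * (s / 12 ^ i)))) with hf
  have hf0 : ∀ i, 0 < f i := fun i => by
    have := (hdecay _ (hsj i) (hsr i)).1
    simp only [hf]
    rw [sub_pos, div_lt_one (by linarith)]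
    linarith
  have claim : ∀ j : ℕ, ∃ m : ℝ, ∀ᵐ y ∂(volume.restrict (mball Ω d x (6 * (s / 12 ^ j)))),
      m ≤ u y ∧ u y ≤ m + ω₀ * ∏ i ∈ Finset.range j, f i := by
    intro j
    induction j with
    | zero =>
      refine ⟨-|M|, ?_⟩
      have hsub : mball Ω d x (6 * (s / 12 ^ 0)) ⊆ mball Ω d x (r₁ / 2) :=
        mball_mono x (by rw [pow_zero, div_one]; linarith)
      filter_upwards [ae_mono (Measure.restrict_mono hsub le_rfl) hM] with y hy
      have := abs_le.1 (hy.trans (le_abs_self M))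
      simp only [Finset.range_zero, Finset.prod_empty, mul_one]
      exact ⟨this.1, by linarith [this.2]⟩
    | succ j ih =>
      obtain ⟨m, hm⟩ := ih
      have hVj := hV.mono hA (U' := mball Ω d x (6 * (s / 12 ^ j)))
        (mball_mono x (by linarith [hpow j]))
      obtain ⟨m', hm'⟩ := (hdecay _ (hsj j) (hsr j)).2 hVj m
        (ω₀ * ∏ i ∈ Finset.range j, f i)
        (mul_pos hω₀0 (Finset.prod_pos fun i _ => hf0 i)) hm
      refine ⟨m', ?_⟩
      -- The ratio 12 is forced by the passage from radius 6r to r/2.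
      have e : 6 * (s / 12 ^ (j + 1)) = s / 12 ^ j / 2 := by rw [pow_succ]; field_simp; norm_num
      rw [e, Finset.prod_range_succ, ← mul_assoc]
      exact hm'
  have hlim : Tendsto (fun j => ω₀ * ∏ i ∈ Finset.range j, f i) atTop (𝓝 0) := by
    have := (tendsto_prod_log_zero hs0 fun j => (hdecay _ (hsj j) (hsr j)).1).const_mul ω₀
    rwa [mul_zero] at this
  obtain ⟨j, hj⟩ := (hlim.eventually_lt_const hε).exists
  obtain ⟨m, hm⟩ := claim j
  refine ⟨_, h.isOpen x h.mem (6 * (s / 12 ^ j)),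
    mem_mball_self h.metric h.mem (by positivity), m, ?_⟩
  filter_upwards [hm] with y hy
  rw [abs_le]
  exact ⟨by linarith [hy.1], by linarith [hy.2]⟩

end Final

end DegElliptic

theorem theorem2 (n : ℕ) (Ω : Set (DegElliptic.E n))
    (hΩo : IsOpen Ω) (hΩc : IsConnected Ω) (hΩb : Bornology.IsBounded Ω)
    (w : DegElliptic.E n → ℝ) (hw : DegElliptic.IsWeight Ω w)
    (A : DegElliptic.E n → Matrix (Fin n) (Fin n) ℝ) (hA : DegElliptic.IsCoefficient Ω w A)
    (B : DegElliptic.E n → Matrix (Fin n) (Fin n) ℝ) (hB : DegElliptic.IsLipschitzRoot Ω A B)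
    (d : DegElliptic.E n → DegElliptic.E n → ℝ) (hd : DegElliptic.IsMetricOn Ω d)
    (hP : ∀ x ∈ Ω, ∃ R > 0, ∃ C > 0, ∀ r, 0 < r → r < R →
      DegElliptic.ProportionalPoincare Ω d w B C x r)
    (k : ℕ) (hk : 1 ≤ k) (N : ℝ) (hN : 1 < N)
    (R₀ : ℝ) (hR₀ : 0 < R₀) (φ : ℝ → ℝ) (hφ : DegElliptic.IsSuperradius R₀ φ)
    (hOS : ∀ x ∈ Ω, ∃ R > 0, ∃ C > 0, ∀ r, 0 < r → r < R →
      DegElliptic.OrliczSobolev Ω d w B (DegElliptic.youngPhi k N) φ C x r)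
    (hcut : ∀ x ∈ Ω, ∃ R > 0, ∃ C > 0, ∀ r, 0 < r → r < R →
      DegElliptic.HasAdaptedCutoffs Ω d w B k N C x r)
    (r₀ : ℝ) (hr₀ : 0 < r₀) (α : ℝ) (hα₀ : 0 < α) (hα₁ : α < (N - 1) / (2 * N))
    (C₀ : ℝ) (hC₀ : 0 < C₀)
    (hφgrowth : ∀ r, 0 < r → r < r₀ →
      φ r ≤ C₀ * r * (Real.log^[k + 2] (1 / r)) ^ (α * N))
    (u : DegElliptic.E n → ℝ) (hu : DegElliptic.IsWeakSolution Ω A u) :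
    ∃ v : DegElliptic.E n → ℝ,
      ContinuousOn v Ω ∧ u =ᵐ[volume.restrict Ω] v := by
  refine DegElliptic.exists_continuousOn_of_oscillation hΩo fun x hx ε hε => ?_
  obtain ⟨R₁, hR₁, C₁, hC₁, h1⟩ := hP x hx
  obtain ⟨R₂, hR₂, C₂, hC₂, h2⟩ := hOS x hx
  obtain ⟨R₃, hR₃, C₃, hC₃, h3⟩ := hcut x hx
  obtain ⟨c, Cb, hc, hCb, hcomp⟩ := hB.comparable
  have hyp : DegElliptic.LocalHyp Ω d w A B k N φ c Cb C₁ C₂ C₃ (min R₁ (min R₂ R₃)) x :=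
    { metric := hd
      bdd := hΩb
      coef := hA.goodCoef hΩo hΩb
      weight := hw
      isOpen := fun y hy r => DegElliptic.isOpen_mball hd hk hN hcut hy r
      k_pos := hk
      one_lt := hN
      c_pos := hc
      Cb_pos := hCb
      lower := hcomp.mono fun y hy ξ => (hy ξ).1
      upper := hcomp.mono fun y hy ξ => (hy ξ).2
      mem := hx
      C₁_pos := hC₁
      C₃_pos := hC₃
      R_pos := lt_min hR₁ (lt_min hR₂ hR₃)
      poincare := fun r hr hrR => h1 r hr (hrR.trans_le (min_le_left _ _))
      orlicz := fun r hr hrR =>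
        h2 r hr (hrR.trans_le ((min_le_right _ _).trans (min_le_left _ _)))
      cutoffs := fun r hr hrR =>
        h3 r hr (hrR.trans_le ((min_le_right _ _).trans (min_le_right _ _))) }
  refine hyp.exists_small_oscillation (b := α * N) ?_ hr₀ hR₀
    (fun r hr => hr.1.trans (hφ.ge r hr)) hφgrowth hu hε
  -- With b = αN, the bound α < (N - 1)/(2N) is precisely 2b < N - 1.
  rw [lt_div_iff₀ (by linarith)] at hα₁
  linarith
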